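/- Let $G=(V,E)$ be a non-empty finite simple graph that is maximal planar (that is, $G$ can be embedded in the plane without edge crossings, and no edge can be added between vertices of $G$ without destroying planarity) and in which every vertex belongs to at least one 3-clique. Let $K$ be the set of 3-cliques of $G$, i.e. of triples of mutually adjacent vertices; subgraphs and unions of subgraphs are understood as subgraphs of $G$ induced by the corresponding vertex sets. A set $C$ of vertices divides $G$ into $S$ and $S'$ if $S$ and $S'$ are disjoint, $S\cup S'=V\setminus C$, and every path from a vertex of $S$ to a vertex of $S'$ meets $C$; $C$ is separating in $G$ if this is possible with $S$ and $S'$ both non-empty. For each $k\in K$, let $k$ divide $G$ into an interior $G^k_{in}$ and an exterior $G^k_{out}$, both non-empty if $k$ is separating, where the interior has at most as many vertices as the exterior (if both have the same number of vertices, the choice of interior is arbitrary; if $k$ is non-separating, the interior is empty). For $k,k'\in K$ put $k\preceq_K k'$ if and only if $k\cup G^{k}_{in}\subseteq k'\cup G^{k'}_{in}$. Theorem. For every such choice of interiors, the union $b_\rho$ of all maximal elements of $(K,\preceq_K)$, i.e. the subgraph of $G$ induced by the set of all vertices lying in a maximal 3-clique, is a bubble: it is a non-empty maximal planar graph in which every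 vertex belongs to a 3-clique and none of whose 3-cliques is separating in $b_\rho$. -/

import Mathlib

/-- `A` is a polygonal arc in the plane from `x` to `y`: a simple polygonal chain with corners
`p 0 = x, p 1, …, p n = y`.  Consecutive segments share only their common corner and all other
pairs of segments are disjoint. -/
def IsPolygonalArc (x y : ℝ × ℝ) (A : Set (ℝ × ℝ)) : Prop :=
  ∃ (n : ℕ) (p : ℕ → ℝ × ℝ),
    0 < n ∧ p 0 = x ∧ p n = y ∧
    (∀ i, i < n → p i ≠ p (i + 1)) ∧
    (∀ i, i + 1 < n →
      segment ℝ (p i) (p (i + 1)) ∩ segment ℝ (p (i + 1)) (p (i + 2)) = {p (i + 1)}) ∧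
    (∀ i j, i + 1 < j → j < n →
      Disjoint (segment ℝ (p i) (p (i + 1))) (segment ℝ (p j) (p (j + 1)))) ∧
    A = ⋃ i ∈ Set.Iio n, segment ℝ (p i) (p (i + 1))

/-- An embedding of the graph `G` in the plane: vertices are distinct points, edges are polygonal
arcs joining their endpoints, an edge passes through no vertex other than its endpoints, and two
different edges meet at most in common endpoints.  (The values of `edge` at non-edges of `G` are
irrelevant.) -/
structure PlaneEmbedding {V : Type*} (G : SimpleGraph V) where
  point : V → ℝ × ℝ
  edge : Sym2 V → Set (ℝ × ℝ)
  point_injective : Function.Injective point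
  isArc : ∀ u v, G.Adj u v → IsPolygonalArc (point u) (point v) (edge s(u, v))
  vertex_on_edge : ∀ e ∈ G.edgeSet, ∀ w, point w ∈ edge e → w ∈ e
  edge_inter_edge : ∀ e ∈ G.edgeSet, ∀ e' ∈ G.edgeSet, e ≠ e' →
    edge e ∩ edge e' ⊆ point '' {w | w ∈ e ∧ w ∈ e'}

/-- `G` is planar if it has an embedding in the plane. -/
def IsPlanar {V : Type*} (G : SimpleGraph V) : Prop :=
  Nonempty (PlaneEmbedding G)

/-- `G` is maximal planar if it is planar and no edges can be inserted (on the same vertex set)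
without violating planarity. -/
def IsMaximalPlanar {V : Type*} (G : SimpleGraph V) : Prop :=
  Maximal (fun G' : SimpleGraph V => IsPlanar G') G

/-- Removing the vertex set `C` divides `G` into the vertex sets `S` and `T`: they partition the
complement of `C`, and every walk between a vertex of `S` and a vertex of `T` meets `C`. -/
structure DividesInto {V : Type*} (G : SimpleGraph V) (C S T : Set V) : Prop where
  union_eq : S ∪ T = Cᶜ
  disjoint : Disjoint S T
  meets : ∀ i ∈ S, ∀ j ∈ T, ∀ p : G.Walk i j, ∃ v ∈ p.support, v ∈ C

/-- `C` is separating if its removal divides `G` into two non-empty parts. -/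
def IsSeparating {V : Type*} (G : SimpleGraph V) (C : Set V) : Prop :=
  ∃ S T : Set V, S.Nonempty ∧ T.Nonempty ∧ DividesInto G C S T

/-- A choice of interior and exterior for every 3-clique `k` of `G`: these are the two parts into
which `k` divides `G`, both non-empty if `k` is separating, the interior being one of smaller
order.  If the orders agree, either choice is allowed; if `k` is not separating, the interior is
necessarily empty.  (Subgraphs are induced, hence represented by their vertex sets; the values at
finsets that are not 3-cliques are irrelevant.) -/
structure CliqueOrientation {V : Type*} (G : SimpleGraph V) where
  interior : Finset V → Set V
  exterior : Finset V → Set V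
  divides : ∀ k, G.IsNClique 3 k → DividesInto G (k : Set V) (interior k) (exterior k)
  nonempty : ∀ k, G.IsNClique 3 k → IsSeparating G (k : Set V) →
    (interior k).Nonempty ∧ (exterior k).Nonempty
  card_le : ∀ k, G.IsNClique 3 k → (interior k).ncard ≤ (exterior k).ncard

namespace CliqueOrientation

/-- The order of 3-cliques: `k ⪯ k'` iff `k` together with its interior is contained in `k'`
together with its interior. -/
def CliqueLE {V : Type*} {G : SimpleGraph V} (o : CliqueOrientation G) (k k' : Finset V) : Prop :=
  (k : Set V) ∪ o.interior k ⊆ (k' : Set V) ∪ o.interior k'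

/-- `k` is a maximal element of the set of 3-cliques of `G` ordered by `CliqueLE`. -/
def IsMaximalClique {V : Type*} {G : SimpleGraph V} (o : CliqueOrientation G) (k : Finset V) :
    Prop :=
  G.IsNClique 3 k ∧ ∀ k', G.IsNClique 3 k' → o.CliqueLE k k' → o.CliqueLE k' k

/-- The vertices of the union of all maximal 3-cliques. -/
def maximalUnionVerts {V : Type*} {G : SimpleGraph V} (o : CliqueOrientation G) : Set V :=
  {v | ∃ k, o.IsMaximalClique k ∧ v ∈ k}

/-- The graph union of all maximal 3-cliques: its vertices are the vertices of the maximal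
3-cliques, and two of them are adjacent iff they are adjacent in `G`. -/
def maximalUnion {V : Type*} {G : SimpleGraph V} (o : CliqueOrientation G) :
    SimpleGraph o.maximalUnionVerts :=
  G.induce o.maximalUnionVerts

end CliqueOrientation

/-- A bubble: a non-empty maximal planar graph, each of whose vertices lies in a 3-clique, and
whose 3-cliques are all non-separating. -/
structure IsBubble {W : Type*} (H : SimpleGraph W) : Prop where
  nonempty : Nonempty W
  maximalPlanar : IsMaximalPlanar H
  mem_clique : ∀ v, ∃ k, H.IsNClique 3 k ∧ v ∈ k
  nonseparating : ∀ k, H.IsNClique 3 k → ¬ IsSeparating H (k : Set W)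

/-! The engine is edge counting. In a planar graph every set of m ≥ 3 vertices spans at most 3m - 6
edges (`IsPlanar.dartCount_add_le`), while a maximal planar graph on n vertices, all of them in
triangles, has at least 3n - 6 (`IsMaximalPlanar.le_dartCount_add`). Darts, i.e. oriented edges, are
counted, so the bound reads 6m - 12.

Let k be a triangle and call a union of components of G - k a part. If a vertex a of k had no
neighbour in a non-empty part U, then G would be glued from the graphs on U ∪ (k \ a) and on V \ U
along one edge, and would have too few edges; so each vertex of k sees each part. Consecutive
neighbours of a in the rotation at a are adjacent, so the part can change only at the two other
vertices of k, and at most two parts exist. Hence exteriors are connected. If a triangle lies in k ∪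
int k, so does its interior: otherwise this interior would contain ext k and a vertex of k, and be
too large. It follows that vertices of maximal triangles lie in no interior
(`notMem_interior_of_isMaximalClique`), and b_ρ is V with the interiors of the maximal triangles
deleted. Deleting these interiors one by one preserves the lower bound 3n - 6, so no edge can be
added to b_ρ. A separation of b_ρ by a triangle t would extend to G and split the connected exterior
of t.

The two bounds are derived from the topology of the plane without the Jordan curve theorem. Cut the
drawing into straight segments; faces are components of the complement. The winding number of a
circulation is constant on faces and jumps across an edge by its weight (up to a common factor), so
every circulation is the difference of a face potential (`exists_face_potential`). `PlaneRotation`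
retains just this and the cyclic orders at the vertices. Linear algebra then gives e - v + 1 ≤ f -
1, because circulations are face differences, and (v - 1) + (f - 1) ≤ e for connected graphs,
because gradients are orthogonal to face differences. Maximality enters through arcs: two vertices
on the boundary of one face can be joined inside it and so are adjacent. This yields connectedness
and triangular faces. -/

/-! ### Polygonal arcs and connected open sets -/

/-- Cutting a polygonal arc at one of its points gives a polygonal arc. -/
theorem IsPolygonalArc.exists_truncate {x y q : ℝ × ℝ} {A : Set (ℝ × ℝ)}
    (h : IsPolygonalArc x y A) (hq : q ∈ A) (hqx : q ≠ x) :
    ∃ A' ⊆ A, IsPolygonalArc x q A' := by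
  classical
  obtain ⟨n, p, hn, h0, hpn, hne, hcons, hdisj, rfl⟩ := h
  have hex : ∃ i, i < n ∧ q ∈ segment ℝ (p i) (p (i + 1)) := by
    simpa using hq
  -- The first segment through `q` is used: if `q` were its initial corner, an earlier segment would
  -- contain `q`, or `q` would be `x`. Hence the shortened last segment is non-degenerate.
  set i := Nat.find hex with hi
  obtain ⟨hin, hqi⟩ : i < n ∧ q ∈ segment ℝ (p i) (p (i + 1)) := Nat.find_spec hex
  have hmin : ∀ j < i, q ∉ segment ℝ (p j) (p (j + 1)) := fun j hj hqj =>
    Nat.find_min hex hj ⟨by omega, hqj⟩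
  have hqpi : p i ≠ q := by
    intro he
    rcases Nat.eq_zero_or_pos i with h | h
    · rw [h, h0] at he; exact hqx he.symm
    · apply hmin (i - 1) (by omega)
      rw [show i - 1 + 1 = i by omega, he]
      exact right_mem_segment _ _ _
  have hsub : segment ℝ (p i) q ⊆ segment ℝ (p i) (p (i + 1)) :=
    (convex_segment _ _).segment_subset (left_mem_segment _ _ _) hqi
  set r : ℕ → ℝ × ℝ := fun j => if j ≤ i then p j else q with hr
  have hr1 : ∀ j ≤ i, r j = p j := fun j hj => by simp [hr, hj]
  have hr2 : r (i + 1) = q := by simp [hr]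
  have hseg : ∀ j < i + 1, segment ℝ (r j) (r (j + 1)) ⊆ segment ℝ (p j) (p (j + 1)) := by
    intro j hj
    rcases Nat.lt_or_ge j i with h | h
    · rw [hr1 j h.le, hr1 (j + 1) h]
    · obtain rfl : j = i := by omega
      rw [hr1 _ le_rfl, hr2]; exact hsub
  refine ⟨⋃ j ∈ Set.Iio (i + 1), segment ℝ (r j) (r (j + 1)), ?_, i + 1, r, by omega, ?_, hr2,
    ?_, ?_, ?_, rfl⟩
  · apply Set.iUnion₂_subset
    intro j hj
    exact (hseg j hj).trans
      (Set.subset_biUnion_of_mem (u := fun j => segment ℝ (p j) (p (j + 1)))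
        (show j ∈ Set.Iio n by simp at hj ⊢; omega))
  · rw [hr1 0 (by omega), h0]
  · intro j hj
    rcases Nat.lt_or_ge j i with h | h
    · rw [hr1 j h.le, hr1 (j + 1) h]; exact hne j (by omega)
    · obtain rfl : j = i := by omega
      rw [hr1 _ le_rfl, hr2]; exact hqpi
  · intro j hj
    apply Set.Subset.antisymm
    · rw [hr1 (j + 1) (by omega), ← hcons j (by omega), ← hr1 (j + 1) (by omega)]
      have h1 := hseg j (by omega)
      have h2 := hseg (j + 1) (by omega)
      rw [hr1 (j + 1) (by omega)] at h1 h2 ⊢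
      exact Set.inter_subset_inter h1 h2
    · rintro _ rfl
      exact ⟨right_mem_segment _ _ _, left_mem_segment _ _ _⟩
  · intro j k hjk hk
    exact (hdisj j k hjk (by omega)).mono (hseg j (by omega)) (hseg k (by omega))

/-- A segment that meets a polygonal arc in its end only may be appended. -/
theorem IsPolygonalArc.append {x y z : ℝ × ℝ} {A : Set (ℝ × ℝ)} (h : IsPolygonalArc x y A)
    (hyz : y ≠ z) (hA : A ∩ segment ℝ y z ⊆ {y}) :
    IsPolygonalArc x z (A ∪ segment ℝ y z) := by
  obtain ⟨n, p, hn, h0, hpn, hne, hcons, hdisj, rfl⟩ := h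
  set r : ℕ → ℝ × ℝ := fun j => if j ≤ n then p j else z with hr
  have hr1 : ∀ j ≤ n, r j = p j := fun j hj => by simp [hr, hj]
  have hr2 : r (n + 1) = z := by simp [hr]
  have hmem : ∀ j < n, segment ℝ (p j) (p (j + 1)) ∩ segment ℝ y z ⊆ {y} := by
    intro j hj
    refine Set.Subset.trans (Set.inter_subset_inter_left _ ?_) hA
    exact Set.subset_biUnion_of_mem (u := fun j => segment ℝ (p j) (p (j + 1)))
        (show j ∈ Set.Iio n from hj)
  refine ⟨n + 1, r, by omega, ?_, hr2, ?_, ?_, ?_, ?_⟩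
  · rw [hr1 0 (by omega), h0]
  · intro j hj
    rcases Nat.lt_or_ge j n with h | h
    · rw [hr1 j h.le, hr1 (j + 1) h]; exact hne j h
    · obtain rfl : j = n := by omega
      rw [hr1 _ le_rfl, hr2, hpn]; exact hyz
  · intro j hj
    rcases Nat.lt_or_ge (j + 1) n with h | h
    · rw [hr1 j (by omega), hr1 (j + 1) (by omega), hr1 (j + 2) (by omega)]; exact hcons j h
    · obtain rfl : n = j + 1 := by omega
      rw [hr1 j (by omega), hr1 (j + 1) (by omega), hr2, hpn]
      apply Set.Subset.antisymm
      · have := hmem j (by omega)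
        rwa [hpn] at this
      · rintro _ rfl
        exact ⟨right_mem_segment _ _ _, left_mem_segment _ _ _⟩
  · intro j k hjk hk
    rcases Nat.lt_or_ge k n with h | h
    · rw [hr1 j (by omega), hr1 (j + 1) (by omega), hr1 k (by omega), hr1 (k + 1) (by omega)]
      exact hdisj j k hjk h
    · obtain rfl : k = n := by omega
      rw [hr1 j (by omega), hr1 (j + 1) (by omega), hr1 k (by omega), hr2, hpn]
      rw [Set.disjoint_iff]
      rintro w hw
      have hwy : w = y := hmem j (by omega) hw
      subst hwy
      have hlast : w ∈ segment ℝ (p (k - 1)) (p (k - 1 + 1)) := by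
        rw [show k - 1 + 1 = k by omega, hpn]; exact right_mem_segment _ _ _
      rcases Nat.lt_or_ge (j + 1) (k - 1) with h' | h'
      · exact Set.disjoint_iff.1 (hdisj j (k - 1) h' (by omega)) ⟨hw.1, hlast⟩
      -- The end `w` of the old chain would lie on its last two segments, hence be their common
      -- corner, and the last segment would be degenerate.
      · have hj : k - 1 = j + 1 := by omega
        have hc := hcons j (by omega)
        have : w ∈ ({p (j + 1)} : Set (ℝ × ℝ)) := by
          rw [← hc]; rw [hj] at hlast; exact ⟨hw.1, hlast⟩
        apply hne (k - 1) (by omega)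
        rw [show k - 1 + 1 = k by omega, hpn, hj]
        exact (Set.mem_singleton_iff.1 this).symm
  · ext w
    simp only [Set.mem_union, Set.mem_iUnion, Set.mem_Iio, exists_prop]
    constructor
    · rintro (⟨j, hj, hw⟩ | hw)
      · exact ⟨j, by omega, by rwa [hr1 j (by omega), hr1 (j + 1) (by omega)]⟩
      · exact ⟨n, by omega, by rwa [hr1 n (by omega), hr2, hpn]⟩
    · rintro ⟨j, hj, hw⟩
      rcases Nat.lt_or_ge j n with h | h
      · left; exact ⟨j, h, by rwa [hr1 j (by omega), hr1 (j + 1) (by omega)] at hw⟩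
      · obtain rfl : j = n := by omega
        right; rwa [hr1 j (by omega), hr2, hpn] at hw

theorem IsPolygonalArc.isCompact {x y : ℝ × ℝ} {A : Set (ℝ × ℝ)} (h : IsPolygonalArc x y A) :
    IsCompact A := by
  obtain ⟨n, p, -, -, -, -, -, -, rfl⟩ := h
  apply (Set.finite_Iio n).isCompact_biUnion
  intro i _
  rw [segment_eq_image_lineMap]
  exact isCompact_Icc.image (by fun_prop)

theorem IsPolygonalArc.right_mem {x y : ℝ × ℝ} {A : Set (ℝ × ℝ)} (h : IsPolygonalArc x y A) :
    y ∈ A := by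
  obtain ⟨n, p, hn, -, hpn, -, -, -, rfl⟩ := h
  simp only [Set.mem_iUnion, Set.mem_Iio, exists_prop]
  refine ⟨n - 1, by omega, ?_⟩
  rw [show n - 1 + 1 = n by omega, hpn]
  exact right_mem_segment _ _ _

theorem isPolygonalArc_segment {x y : ℝ × ℝ} (h : x ≠ y) :
    IsPolygonalArc x y (segment ℝ x y) := by
  refine ⟨1, fun i => if i = 0 then x else y, by omega, rfl, rfl, ?_, ?_, ?_, ?_⟩
  · intro i hi
    obtain rfl : i = 0 := by omega
    simpa using h
  · intro i hi; omega
  · intro i j hi hj; omega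
  · ext w
    simp

/-- `y` can be reached from `x` along a polygonal arc inside `S`. -/
def ArcReachable (S : Set (ℝ × ℝ)) (x y : ℝ × ℝ) : Prop :=
  ∃ A ⊆ S, IsPolygonalArc x y A

/-- The new segment may cross the old arc. Leaving the arc at its point on the segment that is
nearest to `z` keeps the result simple. -/
theorem ArcReachable.extend {S : Set (ℝ × ℝ)} {x y z : ℝ × ℝ} (h : ArcReachable S x y)
    (hS : segment ℝ y z ⊆ S) (hxz : z ≠ x) : ArcReachable S x z := by
  obtain ⟨A, hAS, hA⟩ := h
  have hcomp : IsCompact (A ∩ segment ℝ y z) := by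
    apply hA.isCompact.inter_right
    rw [segment_eq_image_lineMap]
    exact (isCompact_Icc.image (by fun_prop)).isClosed
  obtain ⟨q, ⟨hqA, hqs⟩, hmin⟩ := hcomp.exists_isMinOn ⟨y, hA.right_mem, left_mem_segment _ _ _⟩
    (f := fun w => dist w z) (by fun_prop)
  have hqz : segment ℝ q z ⊆ segment ℝ y z :=
    (convex_segment _ _).segment_subset hqs (right_mem_segment _ _ _)
  by_cases hqx : q = x
  · subst hqx
    exact ⟨_, hqz.trans hS, isPolygonalArc_segment hxz.symm⟩
  obtain ⟨A', hA', hq⟩ := hA.exists_truncate hqA hqx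
  by_cases hqz' : q = z
  · subst hqz'; exact ⟨A', hA'.trans hAS, hq⟩
  refine ⟨_, Set.union_subset (hA'.trans hAS) (hqz.trans hS), hq.append hqz' ?_⟩
  rintro w ⟨hw, hwq⟩
  have h1 : dist q z ≤ dist w z := hmin ⟨hA' hw, hqz hwq⟩
  rw [segment_eq_image_lineMap] at hwq
  obtain ⟨t, ⟨ht0, ht1⟩, rfl⟩ := hwq
  rw [dist_lineMap_right, Real.norm_of_nonneg (by linarith)] at h1
  have hpos : 0 < dist q z := dist_pos.2 hqz'
  have : t = 0 := by nlinarith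
  simp [this]

/-- Inside an open preconnected set, points visible from the outside are joined by arcs. -/
theorem exists_isPolygonalArc_of_isPreconnected {U : Set (ℝ × ℝ)} (hU : IsOpen U)
    (hc : IsPreconnected U) {x y p q : ℝ × ℝ} (hx : x ∉ U) (hxy : x ≠ y)
    (hp : p ∈ U) (hq : q ∈ U) (hxp : segment ℝ x p ⊆ insert x U)
    (hyq : segment ℝ q y ⊆ insert y U) :
    ∃ A, IsPolygonalArc x y A ∧ A ⊆ insert x (insert y U) := by
  set S := insert x (insert y U) with hS
  have hUS : U ⊆ S := fun w hw => Or.inr (Or.inr hw)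
  have hne : ∀ w ∈ U, w ≠ x := fun w hw h => hx (h ▸ hw)
  have step : ∀ w ∈ U, ∃ ε > 0, Metric.ball w ε ⊆ U ∧ ∀ w₁ ∈ Metric.ball w ε,
      ∀ w₂ ∈ Metric.ball w ε, ArcReachable S x w₁ → ArcReachable S x w₂ := by
    intro w hw
    obtain ⟨ε, hε, hb⟩ := Metric.isOpen_iff.1 hU w hw
    refine ⟨ε, hε, hb, fun w₁ h₁ w₂ h₂ h => h.extend ?_ (hne _ (hb h₂))⟩
    exact ((convex_ball w ε).segment_subset h₁ h₂).trans (hb.trans hUS)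
  have hpr : ArcReachable S x p :=
    ⟨_, hxp.trans (Set.insert_subset_insert (Set.subset_insert _ _)),
      isPolygonalArc_segment (hne p hp).symm⟩
  have hqr : ArcReachable S x q := by
    -- Reachable and unreachable points would form two non-empty relatively open pieces of `U`.
    by_contra hcon
    have h1 : IsOpen {w | w ∈ U ∧ ArcReachable S x w} := by
      rw [Metric.isOpen_iff]
      rintro w ⟨hw, hr⟩
      obtain ⟨ε, hε, hb, h⟩ := step w hw
      exact ⟨ε, hε, fun w' hw' => ⟨hb hw', h w (Metric.mem_ball_self hε) w' hw' hr⟩⟩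
    have h2 : IsOpen {w | w ∈ U ∧ ¬ ArcReachable S x w} := by
      rw [Metric.isOpen_iff]
      rintro w ⟨hw, hr⟩
      obtain ⟨ε, hε, hb, h⟩ := step w hw
      exact ⟨ε, hε, fun w' hw' => ⟨hb hw', fun h' => hr (h w' hw' w (Metric.mem_ball_self hε) h')⟩⟩
    obtain ⟨w, -, hw1, hw2⟩ := hc _ _ h1 h2 (fun w hw => by
      by_cases h : ArcReachable S x w
      · exact Or.inl ⟨hw, h⟩
      · exact Or.inr ⟨hw, h⟩) ⟨p, hp, hp, hpr⟩ ⟨q, hq, hq, hcon⟩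
    exact hw2.2 hw1.2
  obtain ⟨A, hAS, hA⟩ := hqr.extend (z := y) (hyq.trans (Set.subset_insert _ _)) hxy.symm
  exact ⟨A, hA, hAS⟩

/-! ### Systems of straight segments and their faces -/

open Filter Topology in
-- This is the normalised situation, one dart being [0, 1] and the other segment [c, e]. If they
-- share the end 0 or 1, a triangle with a base angle flatter than the slope of [c, e] misses it;
-- otherwise compactness gives a positive distance.
theorem eventually_not_mem_segment_of_cone {c e : ℂ}
    (h : ∀ r : ℝ, 0 ≤ r → r ≤ 1 → (r : ℂ) ∈ segment ℝ c e →
      (r = 0 ∨ r = 1) ∧ ((r : ℂ) = c ∨ (r : ℂ) = e)) :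
    ∀ᶠ ε : ℝ in 𝓝[>] 0, ∀ s t : ℝ, 0 < t → t < ε * s → t < ε * (1 - s) →
      (s + t * Complex.I : ℂ) ∉ segment ℝ c e := by
  have main : ∃ ε₀ > 0, ∀ s t : ℝ, 0 < s → s < 1 → 0 < t → t < ε₀ * s → t < ε₀ * (1 - s) →
      (s + t * Complex.I : ℂ) ∉ segment ℝ c e := by
    have key0 : ∀ e : ℂ, ∃ ε₀ > 0, ∀ s t : ℝ, 0 < s → s < 1 → 0 < t → t < ε₀ * s →
        t < ε₀ * (1 - s) → (s + t * Complex.I : ℂ) ∉ segment ℝ 0 e := by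
      intro e
      by_cases hpos : 0 < e.re ∧ 0 < e.im
      · refine ⟨e.im / e.re, div_pos hpos.2 hpos.1, fun s t hs hs1 ht h1 _ hmem => ?_⟩
        rw [segment_eq_image] at hmem
        obtain ⟨r, -, hr⟩ := hmem
        have hre := congrArg Complex.re hr
        have him := congrArg Complex.im hr
        simp at hre him
        rw [← hre, ← him] at h1
        have : e.im / e.re * (r * e.re) = r * e.im := by
          field_simp [hpos.1.ne']
        linarith
      · refine ⟨1, one_pos, fun s t hs hs1 ht _ _ hmem => hpos ?_⟩
        rw [segment_eq_image] at hmem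
        obtain ⟨r, ⟨hr0, -⟩, hr⟩ := hmem
        have hre := congrArg Complex.re hr
        have him := congrArg Complex.im hr
        simp at hre him
        exact ⟨pos_of_mul_pos_right (hre ▸ hs) hr0, pos_of_mul_pos_right (him ▸ ht) hr0⟩
    have key1 : ∀ e : ℂ, ∃ ε₀ > 0, ∀ s t : ℝ, 0 < s → s < 1 → 0 < t → t < ε₀ * s →
        t < ε₀ * (1 - s) → (s + t * Complex.I : ℂ) ∉ segment ℝ 1 e := by
      intro e
      by_cases hpos : 0 < 1 - e.re ∧ 0 < e.im
      · refine ⟨e.im / (1 - e.re), div_pos hpos.2 hpos.1, fun s t hs hs1 ht _ h1 hmem => ?_⟩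
        rw [segment_eq_image] at hmem
        obtain ⟨r, -, hr⟩ := hmem
        have hre := congrArg Complex.re hr
        have him := congrArg Complex.im hr
        simp at hre him
        rw [← hre, ← him] at h1
        have : e.im / (1 - e.re) * (1 - (1 - r + r * e.re)) = r * e.im := by
          field_simp [hpos.1.ne']; ring
        linarith
      · refine ⟨1, one_pos, fun s t hs hs1 ht _ _ hmem => hpos ?_⟩
        rw [segment_eq_image] at hmem
        obtain ⟨r, ⟨hr0, -⟩, hr⟩ := hmem
        have hre := congrArg Complex.re hr
        have him := congrArg Complex.im hr
        simp at hre him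
        exact ⟨pos_of_mul_pos_right (a := r) (by nlinarith) hr0,
          pos_of_mul_pos_right (him ▸ ht) hr0⟩
    by_cases h0 : (0 : ℂ) ∈ segment ℝ c e
    · rcases (h 0 le_rfl zero_le_one (by simpa using h0)).2 with h' | h'
      · rw [← h']; simpa using key0 e
      · rw [← h', segment_symm]; simpa using key0 c
    by_cases h1 : (1 : ℂ) ∈ segment ℝ c e
    · rcases (h 1 zero_le_one le_rfl (by simpa using h1)).2 with h' | h'
      · rw [← h']; simpa using key1 e
      · rw [← h', segment_symm]; simpa using key1 c
    have hK : IsCompact ((fun r : ℝ => (r : ℂ)) '' Set.Icc 0 1) :=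
      isCompact_Icc.image Complex.continuous_ofReal
    have hcl : IsClosed (segment ℝ c e) := by
      rw [segment_eq_image_lineMap]
      exact (isCompact_Icc.image (by fun_prop)).isClosed
    have hdis : Disjoint ((fun r : ℝ => (r : ℂ)) '' Set.Icc 0 1) (segment ℝ c e) := by
      rw [Set.disjoint_left]
      rintro _ ⟨r, ⟨hr0, hr1⟩, rfl⟩ hmem
      rcases (h r hr0 hr1 hmem).1 with rfl | rfl
      · exact h0 (by simpa using hmem)
      · exact h1 (by simpa using hmem)
    obtain ⟨δ, hδ, hd⟩ := hK.exists_thickening_subset_open hcl.isOpen_compl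
      (Set.disjoint_left.1 hdis)
    refine ⟨δ, hδ, fun s t hs hs1 ht h1 _ hmem => ?_⟩
    have : (s + t * Complex.I : ℂ) ∈
        Metric.thickening δ ((fun r : ℝ => (r : ℂ)) '' Set.Icc 0 1) := by
      rw [Metric.mem_thickening_iff]
      refine ⟨s, ⟨s, ⟨hs.le, hs1.le⟩, rfl⟩, ?_⟩
      simp [dist_eq_norm, abs_of_pos ht]
      nlinarith
    exact hd this hmem
  obtain ⟨ε₀, hε₀, H⟩ := main
  filter_upwards [Ioo_mem_nhdsGT hε₀] with ε ⟨hε, hεε⟩ s t ht h1 h2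
  have hs : 0 < s := pos_of_mul_pos_right (ht.trans h1) hε.le
  have hs1 : 0 < 1 - s := pos_of_mul_pos_right (ht.trans h2) hε.le
  exact H s t hs (by linarith) ht (by nlinarith) (by nlinarith)

/-- A system of straight darts in the plane: two of them which do not lie on the same segment
meet only in common ends. -/
structure SegmentSystem (D : Type*) where
  tail : D → ℂ
  head : D → ℂ
  rev : D → D
  tail_rev : ∀ d, tail (rev d) = head d
  head_rev : ∀ d, head (rev d) = tail d
  rev_rev : ∀ d, rev (rev d) = d
  tail_ne_head : ∀ d, tail d ≠ head d
  noncrossing : ∀ d d' x, x ∈ segment ℝ (tail d) (head d) → x ∈ segment ℝ (tail d') (head d') →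
    d' = d ∨ d' = rev d ∨ ((x = tail d ∨ x = head d) ∧ (x = tail d' ∨ x = head d'))

namespace SegmentSystem

variable {D : Type*} (S : SegmentSystem D)

/-- The union of all segments. -/
def support : Set ℂ := ⋃ d, segment ℝ (S.tail d) (S.head d)

theorem isCompact_support [Finite D] : IsCompact S.support := by
  apply isCompact_iUnion
  intro d
  rw [segment_eq_image_lineMap]
  exact isCompact_Icc.image (by fun_prop)

theorem isOpen_compl_support [Finite D] : IsOpen S.supportᶜ :=
  S.isCompact_support.isClosed.isOpen_compl

theorem sub_ne_zero (d : D) : S.head d - S.tail d ≠ 0 := _root_.sub_ne_zero.2 (S.tail_ne_head d).symm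

/-- Passes to the affine coordinate in which `d` becomes the interval from 0 to 1. -/
theorem mem_segment_iff (d : D) (x y c : ℂ) :
    S.tail d + c * (S.head d - S.tail d) ∈ segment ℝ x y ↔
      c ∈ segment ℝ ((x - S.tail d) / (S.head d - S.tail d))
        ((y - S.tail d) / (S.head d - S.tail d)) := by
  have hne := S.sub_ne_zero d
  simp only [segment_eq_image, Set.mem_image, Complex.real_smul]
  refine exists_congr fun r => and_congr_right fun _ => ?_
  push_cast
  constructor
  · intro h
    field_simp
    linear_combination h
  · intro h
    field_simp at h
    linear_combination h

open Filter Topology in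
-- One slope works for all pairs of darts because there are finitely many. The triangles erected
-- with it lie on the left of each dart and miss the whole drawing.
theorem exists_width [Finite D] : ∃ ε : ℝ, 0 < ε ∧ ∀ d, ∀ s t : ℝ, 0 < t → t < ε * s →
    t < ε * (1 - s) → S.tail d + (s + t * Complex.I) * (S.head d - S.tail d) ∉ S.support := by
  have key : ∀ d d', ∀ᶠ ε : ℝ in 𝓝[>] 0, ∀ s t : ℝ, 0 < t → t < ε * s → t < ε * (1 - s) →
      S.tail d + (s + t * Complex.I) * (S.head d - S.tail d) ∉
        segment ℝ (S.tail d') (S.head d') := by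
    intro d d'
    have hne := S.sub_ne_zero d
    by_cases hd : d' = d ∨ d' = S.rev d
    · refine Eventually.of_forall fun ε s t ht _ _ hmem => ?_
      have hmem : S.tail d + (s + t * Complex.I) * (S.head d - S.tail d) ∈
          segment ℝ (S.tail d) (S.head d) := by
        rcases hd with rfl | rfl
        · exact hmem
        · rwa [S.tail_rev, S.head_rev, segment_symm] at hmem
      rw [S.mem_segment_iff d _ _ _, sub_self, zero_div, div_self hne, segment_eq_image] at hmem
      obtain ⟨r, -, hr⟩ := hmem
      have := congrArg Complex.im hr
      simp at this
      exact ht.ne this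
    · push Not at hd
      have := eventually_not_mem_segment_of_cone
        (c := (S.tail d' - S.tail d) / (S.head d - S.tail d))
        (e := (S.head d' - S.tail d) / (S.head d - S.tail d)) (fun r hr0 hr1 hr => by
          have h1 := (S.mem_segment_iff d _ _ _).2 hr
          have h2 : S.tail d + r * (S.head d - S.tail d) ∈ segment ℝ (S.tail d) (S.head d) := by
            rw [segment_eq_image']
            exact ⟨r, ⟨hr0, hr1⟩, by simp⟩
          rcases S.noncrossing d d' _ h2 h1 with h | h | ⟨h3, h4⟩
          · exact absurd h hd.1
          · exact absurd h hd.2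
          · constructor
            · rcases h3 with h3 | h3
              · left
                have : (r : ℂ) * (S.head d - S.tail d) = 0 := by linear_combination h3
                simpa [hne] using this
              · right
                have : ((r : ℂ) - 1) * (S.head d - S.tail d) = 0 := by linear_combination h3
                have := (mul_eq_zero.1 this).resolve_right hne
                exact_mod_cast sub_eq_zero.1 this
            · rcases h4 with h4 | h4
              · left; rw [eq_div_iff hne]; linear_combination h4
              · right; rw [eq_div_iff hne]; linear_combination h4)
      filter_upwards [this] with ε hε s t ht h1 h2 hmem
      exact hε s t ht h1 h2 ((S.mem_segment_iff d _ _ _).1 hmem)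
  have := eventually_all.2 fun d => eventually_all.2 fun d' => key d d'
  obtain ⟨ε, hε, hpos⟩ := (this.and self_mem_nhdsWithin).exists
  refine ⟨ε, hpos, fun d s t ht h1 h2 hmem => ?_⟩
  obtain ⟨d', hd'⟩ := Set.mem_iUnion.1 hmem
  exact hε d d' s t ht h1 h2 hd'

/-- The point of the side of `d` over the middle of the segment at relative height `t`. -/
noncomputable def midPoint (d : D) (t : ℝ) : ℂ :=
  S.tail d + ((1 / 2 : ℝ) + t * Complex.I) * (S.head d - S.tail d)

theorem midPoint_rev (d : D) (t : ℝ) : S.midPoint (S.rev d) t = S.midPoint d (-t) := by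
  simp only [midPoint, tail_rev, head_rev]
  push_cast
  ring

section

variable [Finite D]

/-- The height of the thin triangles erected over the segments. -/
noncomputable def width : ℝ := Classical.choose S.exists_width

theorem width_pos : 0 < S.width := (Classical.choose_spec S.exists_width).1

/-- The open thin triangle on the left of a dart. -/
def side (d : D) : Set ℂ :=
  (fun p : ℝ × ℝ => S.tail d + (p.1 + p.2 * Complex.I) * (S.head d - S.tail d)) ''
    {p | 0 < p.2 ∧ p.2 < S.width * p.1 ∧ p.2 < S.width * (1 - p.1)}

theorem side_subset (d : D) : S.side d ⊆ S.supportᶜ := by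
  rintro _ ⟨⟨s, t⟩, ⟨h1, h2, h3⟩, rfl⟩
  exact (Classical.choose_spec S.exists_width).2 d s t h1 h2 h3

theorem isPreconnected_side (d : D) : IsPreconnected (S.side d) := by
  apply IsPreconnected.image
  · apply Convex.isPreconnected
    rintro ⟨s, t⟩ ⟨h1, h2, h3⟩ ⟨s', t'⟩ ⟨h1', h2', h3'⟩ a b ha hb hab
    simp only [Set.mem_ofPred_eq, Prod.smul_mk, Prod.mk_add_mk, smul_eq_mul] at *
    obtain rfl : b = 1 - a := by linarith
    rcases eq_or_lt_of_le ha with rfl | ha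
    · simp_all
    · refine ⟨?_, ?_, ?_⟩ <;> nlinarith
  · fun_prop

theorem midPoint_mem {d : D} {t : ℝ} (h0 : 0 < t) (h1 : t < S.width / 2) :
    S.midPoint d t ∈ S.side d := by
  refine ⟨(1 / 2, t), ⟨h0, ?_, ?_⟩, rfl⟩ <;> simp <;> linarith

/-- The face on the left of a dart. -/
noncomputable def face (d : D) : Set ℂ :=
  connectedComponentIn S.supportᶜ (S.midPoint d (S.width / 4))

theorem base_mem (d : D) : S.midPoint d (S.width / 4) ∈ S.side d :=
  S.midPoint_mem (by linarith [S.width_pos]) (by linarith [S.width_pos])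

theorem side_subset_face (d : D) : S.side d ⊆ S.face d :=
  (S.isPreconnected_side d).subset_connectedComponentIn (S.base_mem d) (S.side_subset d)

theorem face_subset (d : D) : S.face d ⊆ S.supportᶜ := connectedComponentIn_subset _ _

theorem face_eq {d : D} {p : ℂ} (h : p ∈ S.face d) :
    S.face d = connectedComponentIn S.supportᶜ p := connectedComponentIn_eq h

theorem face_eq_face {d d' : D} {p : ℂ} (h : p ∈ S.face d) (h' : p ∈ S.face d') :
    S.face d = S.face d' := by rw [S.face_eq h, S.face_eq h']

theorem isOpen_face (d : D) : IsOpen (S.face d) :=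
  S.isOpen_compl_support.connectedComponentIn

theorem isPreconnected_face (d : D) : IsPreconnected (S.face d) :=
  isPreconnected_connectedComponentIn

/-- The end of a dart is visible from inside its face, which lets arcs through the face start there.
-/
theorem segment_base_subset (d : D) :
    segment ℝ (S.tail d) (S.midPoint d (S.width / 4)) ⊆ insert (S.tail d) (S.face d) := by
  rw [segment_eq_image']
  rintro _ ⟨r, ⟨hr0, hr1⟩, rfl⟩
  rcases eq_or_lt_of_le hr0 with rfl | hr0
  · simp
  · right
    apply S.side_subset_face
    have := S.width_pos
    refine ⟨(r / 2, r * (S.width / 4)), ⟨by positivity, ?_, ?_⟩, ?_⟩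
    · simp only; nlinarith [mul_pos hr0 this]
    · simp only; nlinarith [mul_pos hr0 this]
    · simp [midPoint]; ring

theorem segment_base_subset_head (d : D) :
    segment ℝ (S.midPoint d (S.width / 4)) (S.head d) ⊆ insert (S.head d) (S.face d) := by
  rw [segment_symm, segment_eq_image']
  rintro _ ⟨r, ⟨hr0, hr1⟩, rfl⟩
  rcases eq_or_lt_of_le hr0 with rfl | hr0
  · simp
  · right
    apply S.side_subset_face
    have := S.width_pos
    refine ⟨(1 - r / 2, r * (S.width / 4)), ⟨by positivity, ?_, ?_⟩, ?_⟩
    · simp only; nlinarith [mul_pos hr0 this]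
    · simp only; nlinarith [mul_pos hr0 this]
    · simp [midPoint]; ring

/-- In polar coordinates around the tail, small positive angles enter the left triangle and small
negative ones the right triangle. This links the triangles to the sectors between neighbouring
darts. -/
theorem exists_sector_side (d : D) : ∃ κ > 0, ∀ ρ τ : ℝ, 0 < ρ → ρ < κ → 0 < τ → τ < κ →
    S.tail d + ρ * Complex.exp (τ * Complex.I) * (S.head d - S.tail d) ∈ S.side d ∧
    S.tail d + ρ * Complex.exp (-τ * Complex.I) * (S.head d - S.tail d) ∈ S.side (S.rev d) := by
  have hw := S.width_pos
  refine ⟨min (1 / 2) (S.width / 4), by positivity, fun ρ τ h0 h1 h2 h3 => ?_⟩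
  have hρ : ρ < 1 / 2 := h1.trans_le (min_le_left _ _)
  have hτ : τ < 1 / 2 := h3.trans_le (min_le_left _ _)
  have hτ' : τ < S.width / 4 := h3.trans_le (min_le_right _ _)
  have hsin : Real.sin τ < τ := Real.sin_lt h2
  have hsin0 : 0 < Real.sin τ := Real.sin_pos_of_pos_of_lt_pi h2 (by linarith [Real.pi_gt_three])
  have hcos : 1 - τ ^ 2 / 2 ≤ Real.cos τ := Real.one_sub_sq_div_two_le_cos
  have hcos' : 1 / 2 < Real.cos τ := by nlinarith
  have hcos1 := Real.cos_le_one τ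
  have e1 : ρ * Real.sin τ < S.width * (ρ * Real.cos τ) := by
    have : Real.sin τ < S.width * Real.cos τ := by nlinarith
    nlinarith
  have e2 : ρ * Real.sin τ < S.width * (1 - ρ * Real.cos τ) := by
    have a1 : ρ * Real.cos τ < 1 / 2 := by nlinarith
    have a2 : ρ * Real.sin τ < S.width / 4 := by nlinarith
    nlinarith
  constructor
  · refine ⟨(ρ * Real.cos τ, ρ * Real.sin τ), ⟨by positivity, e1, e2⟩, ?_⟩
    simp only [Complex.exp_mul_I]
    push_cast
    ring
  · refine ⟨(1 - ρ * Real.cos τ, ρ * Real.sin τ), ⟨by positivity, e2, ?_⟩, ?_⟩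
    · simpa using e1
    · simp only [Complex.exp_mul_I, tail_rev, head_rev, Complex.cos_neg, Complex.sin_neg]
      push_cast
      ring

end

/-- The direction of a dart. -/
noncomputable def angle (d : D) : ℝ := Complex.arg (S.head d - S.tail d)

theorem head_sub_tail (d : D) :
    S.head d - S.tail d = ‖S.head d - S.tail d‖ * Complex.exp (S.angle d * Complex.I) :=
  (Complex.norm_mul_exp_arg_mul_I _).symm

end SegmentSystem

/-! ### Angles and the rotation at a point -/

/-- The angle by which `θ` has to be turned counterclockwise to reach `φ`, in `(0, 2π]`. -/
noncomputable def angleGap (θ φ : ℝ) : ℝ := toIocMod Real.two_pi_pos 0 (φ - θ)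

theorem angleGap_pos (θ φ : ℝ) : 0 < angleGap θ φ := (toIocMod_mem_Ioc Real.two_pi_pos 0 _).1

theorem angleGap_le (θ φ : ℝ) : angleGap θ φ ≤ 2 * Real.pi := by
  simpa [angleGap] using (toIocMod_mem_Ioc Real.two_pi_pos 0 (φ - θ)).2

theorem angleGap_eq_iff {θ φ r : ℝ} : angleGap θ φ = r ↔
    (0 < r ∧ r ≤ 2 * Real.pi) ∧ ∃ k : ℤ, φ - θ = r + k * (2 * Real.pi) := by
  rw [angleGap, toIocMod_eq_iff]
  simp

theorem angleGap_self (θ : ℝ) : angleGap θ θ = 2 * Real.pi :=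
  angleGap_eq_iff.2 ⟨⟨Real.two_pi_pos, le_rfl⟩, -1, by push_cast; ring⟩

theorem angleGap_add (a b c : ℝ) : angleGap a c = angleGap a b + angleGap b c ∨
    angleGap a c = angleGap a b + angleGap b c - 2 * Real.pi := by
  obtain ⟨⟨h1, h1'⟩, k, hk⟩ := angleGap_eq_iff.1 (rfl : angleGap a b = _)
  obtain ⟨⟨h2, h2'⟩, l, hl⟩ := angleGap_eq_iff.1 (rfl : angleGap b c = _)
  by_cases h : angleGap a b + angleGap b c ≤ 2 * Real.pi
  · left
    exact angleGap_eq_iff.2 ⟨⟨by linarith, h⟩, k + l, by push_cast; linarith⟩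
  · right
    exact angleGap_eq_iff.2 ⟨⟨by linarith, by linarith⟩, k + l + 1, by push_cast; linarith⟩

/-- Finitely many objects with distinct directions at each base point are permuted by turning
counterclockwise to the next direction, and this permutation is a single cycle on each fibre. -/
theorem exists_rotation {D V : Type*} [Finite D] (base : D → V) (ang : D → ℝ)
    (hinj : ∀ d d', base d = base d' → angleGap (ang d) (ang d') = 2 * Real.pi → d = d') :
    ∃ σ : Equiv.Perm D, (∀ d, base (σ d) = base d) ∧
      (∀ d d', base d' = base d →
        angleGap (ang d) (ang (σ d)) ≤ angleGap (ang d) (ang d')) ∧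
      ∀ d d', base d = base d' → σ.SameCycle d d' := by
  have hmin : ∀ d, ∃ e, base e = base d ∧ ∀ d', base d' = base d →
      angleGap (ang d) (ang e) ≤ angleGap (ang d) (ang d') := fun d =>
    (Set.toFinite {e | base e = base d}).exists_minimalFor
      (fun e => angleGap (ang d) (ang e)) _ ⟨d, rfl⟩ |>.imp fun e he =>
        ⟨he.1, fun d' hd' => (le_total _ _).elim id (he.2 hd')⟩
  choose f hf hfmin using hmin
  have finj : Function.Injective f := by
    intro b b' hbb
    by_contra hne
    have hbase : base b = base b' := by rw [← hf b, ← hf b', hbb]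
    have h1 := hfmin b b' hbase.symm
    have h2 := hfmin b' b hbase
    rw [← hbb] at h2
    have p1 := angleGap_pos (ang b) (ang (f b))
    have p2 := angleGap_pos (ang b') (ang (f b))
    have q1 := angleGap_le (ang b) (ang b')
    have q2 := angleGap_le (ang b') (ang b)
    have h3 := angleGap_add (ang b) (ang b') (ang b)
    -- By convention the gap from a direction to itself is a full turn, so the gaps from `b` to `b'`
    -- and back sum to 2π or 4π, and 4π is excluded by distinctness.
    rw [angleGap_self] at h3
    have q3 : angleGap (ang b) (ang b') ≠ 2 * Real.pi := fun h => hne (hinj _ _ hbase h)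
    have q3' := lt_of_le_of_ne q1 q3
    rcases angleGap_add (ang b) (ang b') (ang (f b)) with h4 | h4 <;>
      rcases h3 with h3 | h3 <;> linarith
  refine ⟨Equiv.ofBijective f (Finite.injective_iff_bijective.1 finj), hf, hfmin, ?_⟩
  set σ : Equiv.Perm D := Equiv.ofBijective f (Finite.injective_iff_bijective.1 finj) with hσ
  have hσf : ∀ d, σ d = f d := fun d => rfl
  intro d d' hdd
  -- Within the cycle of `d`, take the element with the least remaining gap to `d'`. Its successor
  -- cannot come closer, which forces the successor to be `d'`.
  obtain ⟨e, ⟨he, hbe⟩, hemin⟩ := (Set.toFinite {e | σ.SameCycle d e ∧ base e = base d}).exists_minimalFor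
      (fun e => angleGap (ang e) (ang d')) _ ⟨d, Equiv.Perm.SameCycle.refl _ _, rfl⟩
  have hse : σ.SameCycle d (σ e) := Equiv.Perm.sameCycle_apply_right.2 he
  have hbs : base (σ e) = base d := (hf e).trans hbe
  have hm : angleGap (ang e) (ang d') ≤ angleGap (ang (σ e)) (ang d') :=
    (le_total _ _).elim id (fun h => hemin ⟨hse, hbs⟩ h)
  have h2 := hfmin e d' (by rw [hbe, hdd])
  rw [← hσf] at h2
  have : σ e = d' := by
    apply hinj _ _ (hbs.trans hdd)
    have p := angleGap_pos (ang e) (ang (σ e))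
    have q := angleGap_le (ang (σ e)) (ang d')
    rcases angleGap_add (ang e) (ang (σ e)) (ang d') with h4 | h4 <;> linarith
  rwa [← this]

theorem exists_int_of_exp_eq {r r' a b : ℝ} (hr : 0 < r) (hr' : 0 < r')
    (h : (r : ℂ) * Complex.exp (a * Complex.I) = r' * Complex.exp (b * Complex.I)) :
    ∃ k : ℤ, a = b + k * (2 * Real.pi) := by
  have h1 := congrArg norm h
  simp only [norm_mul, Complex.norm_exp_ofReal_mul_I, Complex.norm_real, mul_one,
    Real.norm_of_nonneg hr.le, Real.norm_of_nonneg hr'.le] at h1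
  rw [h1] at h
  have h2 := mul_left_cancel₀ (by exact_mod_cast hr'.ne') h
  obtain ⟨k, hk⟩ := Complex.exp_eq_exp_iff_exists_int.1 h2
  refine ⟨k, ?_⟩
  have : (a : ℂ) * Complex.I = (b + k * (2 * Real.pi) : ℝ) * Complex.I := by
    push_cast; linear_combination hk
  exact_mod_cast mul_right_cancel₀ Complex.I_ne_zero this

/-! ### Sectors between neighbouring darts -/

namespace SegmentSystem

variable {D : Type*} (S : SegmentSystem D)

/-- Among the darts with the same tail, `d` is the first one met when turning counterclockwise
from the direction `θ`. -/
def IsNext (θ : ℝ) (d : D) : Prop :=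
  ∀ d', S.tail d' = S.tail d → angleGap θ (S.angle d) ≤ angleGap θ (S.angle d')

theorem exists_isNext [Finite D] (θ : ℝ) (d : D) :
    ∃ d', S.tail d' = S.tail d ∧ S.IsNext θ d' :=
  (Set.toFinite {e | S.tail e = S.tail d}).exists_minimalFor
      (fun e => angleGap θ (S.angle e)) _ ⟨d, rfl⟩ |>.imp fun _ he =>
        ⟨he.1, fun _ hd' => (le_total _ _).elim id (he.2 (hd'.trans he.1))⟩

/-- Two darts with the same tail and the same direction are equal. -/
theorem eq_of_angleGap_eq {d d' : D} (ht : S.tail d = S.tail d')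
    (h : angleGap (S.angle d) (S.angle d') = 2 * Real.pi) : d = d' := by
  obtain ⟨-, k, hk⟩ := angleGap_eq_iff.1 h
  have hexp : Complex.exp (S.angle d' * Complex.I) = Complex.exp (S.angle d * Complex.I) := by
    rw [show (S.angle d' : ℂ) = ((S.angle d + (1 + k) * (2 * Real.pi) : ℝ) : ℂ) by
      rw [Complex.ofReal_inj]; linarith]
    rw [Complex.exp_eq_exp_iff_exists_int]
    exact ⟨1 + k, by push_cast; ring⟩
  set u := Complex.exp (S.angle d * Complex.I) with hu
  have hu0 : u ≠ 0 := Complex.exp_ne_zero _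
  have h1 := S.head_sub_tail d
  have h2 := S.head_sub_tail d'
  rw [hexp] at h2
  rw [← hu] at h1
  set l := ‖S.head d - S.tail d‖ with hl
  set l' := ‖S.head d' - S.tail d'‖ with hl'
  have hlpos : 0 < l := norm_pos_iff.2 (S.sub_ne_zero d)
  have hlpos' : 0 < l' := norm_pos_iff.2 (S.sub_ne_zero d')
  -- At half the shorter length along the common direction both segments have a common inner point,
  -- against `noncrossing`.
  set m := min l l' / 2 with hm
  have hmpos : 0 < m := by positivity
  have hml : m < l := by
    have := min_le_left l l'; rw [hm]; linarith
  have hml' : m < l' := by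
    have := min_le_right l l'; rw [hm]; linarith
  have hx : S.tail d + m * u ∈ segment ℝ (S.tail d) (S.head d) := by
    rw [segment_eq_image']
    refine ⟨m / l, ⟨by positivity, (div_le_one hlpos).2 hml.le⟩, ?_⟩
    simp only [h1, Complex.real_smul]
    have : (l : ℂ) ≠ 0 := by exact_mod_cast hlpos.ne'
    push_cast
    field_simp
  have hx' : S.tail d + m * u ∈ segment ℝ (S.tail d') (S.head d') := by
    rw [segment_eq_image', ht]
    refine ⟨m / l', ⟨by positivity, (div_le_one hlpos').2 hml'.le⟩, ?_⟩
    simp only [h2, Complex.real_smul]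
    have : (l' : ℂ) ≠ 0 := by exact_mod_cast hlpos'.ne'
    push_cast
    field_simp
  rcases S.noncrossing d d' _ hx hx' with h | h | ⟨h, -⟩
  · exact h.symm
  · exfalso
    rw [h, S.tail_rev] at ht
    exact S.tail_ne_head d ht
  · exfalso
    rcases h with h | h
    · have : (m : ℂ) * u = 0 := by linear_combination h
      rcases mul_eq_zero.1 this with h' | h'
      · exact hmpos.ne' (by exact_mod_cast h')
      · exact hu0 h'
    · have : ((m : ℂ) - l) * u = 0 := by linear_combination h + h1
      rcases mul_eq_zero.1 this with h' | h'
      · have : m = l := by exact_mod_cast _root_.sub_eq_zero.1 h'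
        exact hml.ne this
      · exact hu0 h'

variable [Finite D]

open Filter Topology in
/-- The points of a small sector at the tail of `d`, from the direction `θ` to the next dart `d`,
lie in the face on the right of `d`. -/
theorem exists_sector_subset_face {θ : ℝ} {d : D} (h : S.IsNext θ d) :
    ∃ κ > 0, ∀ r t : ℝ, 0 < r → r < κ → 0 < t → t < angleGap θ (S.angle d) →
      S.tail d + r * Complex.exp ((θ + t : ℝ) * Complex.I) ∈ S.face (S.rev d) := by
  have free : ∃ κ > 0, ∀ r t : ℝ, 0 < r → r < κ → 0 < t → t < angleGap θ (S.angle d) →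
      S.tail d + r * Complex.exp ((θ + t : ℝ) * Complex.I) ∉ S.support := by
    have key : ∀ d', ∀ᶠ κ : ℝ in 𝓝[>] 0, ∀ r t : ℝ, 0 < r → r < κ → 0 < t →
        t < angleGap θ (S.angle d) → S.tail d + r * Complex.exp ((θ + t : ℝ) * Complex.I) ∉
          segment ℝ (S.tail d') (S.head d') := by
      intro d'
      by_cases hmem : S.tail d ∈ segment ℝ (S.tail d') (S.head d')
      · have hd : ∃ e, S.tail e = S.tail d ∧
            segment ℝ (S.tail d') (S.head d') = segment ℝ (S.tail e) (S.head e) := by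
          rcases S.noncrossing d d' _ (left_mem_segment _ _ _) hmem with rfl | rfl | ⟨-, h | h⟩
          · exact ⟨d', rfl, rfl⟩
          · exact ⟨d, rfl, by rw [S.tail_rev, S.head_rev, segment_symm]⟩
          · exact ⟨d', h.symm, rfl⟩
          · exact ⟨S.rev d', by rw [S.tail_rev, h], by
              rw [S.tail_rev, S.head_rev, segment_symm]⟩
        obtain ⟨e, hte, hse⟩ := hd
        refine Eventually.of_forall fun κ r t hr _ ht htg hx => ?_
        rw [hse, ← hte, segment_eq_image'] at hx
        obtain ⟨u, ⟨hu0, hu1⟩, hu⟩ := hx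
        have hu : (u * ‖S.head e - S.tail e‖ : ℝ) * Complex.exp (S.angle e * Complex.I) =
            r * Complex.exp ((θ + t : ℝ) * Complex.I) := by
          push_cast
          rw [mul_assoc, ← S.head_sub_tail e]
          simp only [Complex.real_smul] at hu
          push_cast at hu
          linear_combination hu
        have hu0 : 0 < u := by
          rcases eq_or_lt_of_le hu0 with rfl | h
          · exfalso
            simp only [zero_mul, Complex.ofReal_zero] at hu
            have := mul_eq_zero.1 hu.symm
            simp [Complex.exp_ne_zero, hr.ne'] at this
          · exact h
        obtain ⟨k, hk⟩ := exists_int_of_exp_eq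
          (mul_pos hu0 (norm_pos_iff.2 (S.sub_ne_zero e))) hr hu
        have hle := angleGap_le θ (S.angle d)
        -- A dart inside the open sector would be met before `d`.
        have : angleGap θ (S.angle e) = t :=
          angleGap_eq_iff.2 ⟨⟨ht, by linarith⟩, k, by linarith⟩
        have := h e hte
        linarith
      · have hcl : IsClosed (segment ℝ (S.tail d') (S.head d')) := by
          rw [segment_eq_image_lineMap]
          exact (isCompact_Icc.image (by fun_prop)).isClosed
        obtain ⟨κ, hκ, hb⟩ := Metric.isOpen_iff.1 hcl.isOpen_compl _ hmem
        filter_upwards [Ioo_mem_nhdsGT hκ] with κ' ⟨_, hκ'⟩ r t hr hrκ _ _ hx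
        apply hb _ hx
        rw [Metric.mem_ball, dist_eq_norm, add_sub_cancel_left, norm_mul,
          Complex.norm_exp_ofReal_mul_I, mul_one, Complex.norm_real, Real.norm_of_nonneg hr.le]
        linarith
    obtain ⟨κ, hκ, hpos⟩ := ((eventually_all.2 key).and self_mem_nhdsWithin).exists
    refine ⟨κ, hpos, fun r t h1 h2 h3 h4 hmem => ?_⟩
    obtain ⟨d', hd'⟩ := Set.mem_iUnion.1 hmem
    exact hκ d' r t h1 h2 h3 h4 hd'
  obtain ⟨κ, hκ, hfree⟩ := free
  refine ⟨κ, hκ, fun r t h1 h2 h3 h4 => ?_⟩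
  set g := angleGap θ (S.angle d) with hg
  have hgpos : 0 < g := angleGap_pos _ _
  obtain ⟨⟨-, -⟩, k, hk⟩ := angleGap_eq_iff.1 hg.symm
  set sector := (fun p : ℝ × ℝ => S.tail d + p.1 * Complex.exp ((θ + p.2 : ℝ) * Complex.I)) ''
    (Set.Ioo 0 κ ×ˢ Set.Ioo 0 g) with hsec
  have hpre : IsPreconnected sector :=
    (isPreconnected_Ioo.prod isPreconnected_Ioo).image _ (by fun_prop)
  have hsub : sector ⊆ S.supportᶜ := by
    rintro _ ⟨⟨r, t⟩, ⟨⟨h1, h2⟩, ⟨h3, h4⟩⟩, rfl⟩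
    exact hfree r t h1 h2 h3 h4
  obtain ⟨κ', hκ', hside⟩ := S.exists_sector_side d
  set l := ‖S.head d - S.tail d‖ with hl
  have hlpos : 0 < l := norm_pos_iff.2 (S.sub_ne_zero d)
  set τ := min κ' g / 2 with hτ
  -- With these `τ` and `ρ` the test point lies both in the sector and in the thin triangle on the
  -- right of `d`, so the connected sector is in that face.
  set ρ := min κ' (κ / l) / 2 with hρ
  have hτ0 : 0 < τ := by positivity
  have hρ0 : 0 < ρ := by positivity
  have hτκ : τ < κ' := by have := min_le_left κ' g; rw [hτ]; linarith
  have hτg : τ < g := by have := min_le_right κ' g; rw [hτ]; linarith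
  have hρκ : ρ < κ' := by have := min_le_left κ' (κ / l); rw [hρ]; linarith
  have hρl : ρ * l < κ := by
    have h1 := min_le_right κ' (κ / l)
    have h2 : 0 < κ / l := by positivity
    have : ρ < κ / l := by rw [hρ]; linarith
    rwa [lt_div_iff₀ hlpos] at this
  have hp := (hside ρ τ hρ0 hρκ hτ0 hτκ).2
  have hmem : S.tail d + ρ * Complex.exp (-τ * Complex.I) * (S.head d - S.tail d) ∈ sector := by
    refine ⟨(ρ * l, g - τ), ⟨⟨by positivity, hρl⟩, ⟨by simp only; linarith, by simp only; linarith⟩⟩, ?_⟩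
    have : Complex.exp ((θ + (g - τ) : ℝ) * Complex.I) =
        Complex.exp (-τ * Complex.I) * Complex.exp (S.angle d * Complex.I) := by
      rw [← Complex.exp_add, Complex.exp_eq_exp_iff_exists_int]
      refine ⟨-k, ?_⟩
      have hk' : (S.angle d : ℂ) - θ = g + k * (2 * Real.pi) := by exact_mod_cast hk
      push_cast
      linear_combination -Complex.I * hk'
    simp only [this]
    rw [S.head_sub_tail d]
    push_cast
    ring
  have := hpre.subset_connectedComponentIn hmem hsub
  rw [S.face_eq (S.side_subset_face _ hp)]
  exact this ⟨(r, t), ⟨⟨h1, h2⟩, ⟨h3, h4⟩⟩, rfl⟩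

/-- Turning from a dart to the next one at its tail does not leave the face. -/
theorem face_eq_face_rev_of_isNext {d d' : D} (ht : S.tail d' = S.tail d)
    (h : S.IsNext (S.angle d) d') : S.face d = S.face (S.rev d') := by
  obtain ⟨κ, hκ, hsec⟩ := S.exists_sector_subset_face h
  obtain ⟨κ', hκ', hside⟩ := S.exists_sector_side d
  set g := angleGap (S.angle d) (S.angle d') with hg
  have hgpos : 0 < g := angleGap_pos _ _
  set l := ‖S.head d - S.tail d‖ with hl
  have hlpos : 0 < l := norm_pos_iff.2 (S.sub_ne_zero d)
  set τ := min κ' g / 2 with hτ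
  set ρ := min κ' (κ / l) / 2 with hρ
  have hτ0 : 0 < τ := by positivity
  have hρ0 : 0 < ρ := by positivity
  have hτκ : τ < κ' := by have := min_le_left κ' g; rw [hτ]; linarith
  have hτg : τ < g := by have := min_le_right κ' g; rw [hτ]; linarith
  have hρκ : ρ < κ' := by have := min_le_left κ' (κ / l); rw [hρ]; linarith
  have hρl : ρ * l < κ := by
    have h1 := min_le_right κ' (κ / l)
    have h2 : 0 < κ / l := by positivity
    have : ρ < κ / l := by rw [hρ]; linarith
    rwa [lt_div_iff₀ hlpos] at this
  have hp := S.side_subset_face _ (hside ρ τ hρ0 hρκ hτ0 hτκ).1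
  have hq := hsec (ρ * l) τ (by positivity) hρl hτ0 hτg
  refine S.face_eq_face hp ?_
  convert hq using 1
  rw [ht]
  conv_lhs => rw [S.head_sub_tail d]
  push_cast
  rw [add_mul, Complex.exp_add]
  ring

end SegmentSystem

/-! ### Winding numbers and face potentials -/

namespace SegmentSystem

variable {D : Type*} (S : SegmentSystem D)

/-- If the ratio were -r with r ≥ 0, then p would be the convex combination of a and b in which b
has weight 1 / (1 + r). So off the segment the angle subtended at p is continuous. -/
theorem div_mem_slitPlane {a b p : ℂ} (h : p ∉ segment ℝ a b) :
    (b - p) / (a - p) ∈ Complex.slitPlane := by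
  have ha : a - p ≠ 0 := fun h' => h (by
    rw [← sub_eq_zero.1 h']; exact left_mem_segment _ _ _)
  rw [Complex.mem_slitPlane_iff]
  by_contra hcon
  push Not at hcon
  apply h
  obtain ⟨hre, him⟩ := hcon
  set r := -((b - p) / (a - p)).re with hr
  have hr0 : 0 ≤ r := by rw [hr]; linarith
  have hq : (b - p) / (a - p) = -(r : ℂ) := by
    apply Complex.ext <;> simp [hr, him]
  rw [div_eq_iff ha] at hq
  rw [segment_eq_image]
  refine ⟨1 / (1 + r), ⟨by positivity, (div_le_one (by positivity)).2 (by linarith)⟩, ?_⟩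
  have h1 : (1 + r : ℂ) ≠ 0 := by
    exact_mod_cast (by positivity : (1 + r : ℝ) ≠ 0)
  simp only [Complex.real_smul]
  push_cast
  field_simp
  linear_combination hq

theorem tail_mem_support (d : D) : S.tail d ∈ S.support :=
  Set.mem_iUnion.2 ⟨d, left_mem_segment _ _ _⟩

theorem head_mem_support (d : D) : S.head d ∈ S.support :=
  Set.mem_iUnion.2 ⟨d, right_mem_segment _ _ _⟩

theorem midPoint_notMem {d d' : D} (h1 : d' ≠ d) (h2 : d' ≠ S.rev d) :
    S.midPoint d 0 ∉ segment ℝ (S.tail d') (S.head d') := by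
  intro hmem
  have hm : S.midPoint d 0 ∈ segment ℝ (S.tail d) (S.head d) := by
    rw [segment_eq_image']
    exact ⟨1 / 2, ⟨by norm_num, by norm_num⟩, by simp [midPoint]⟩
  have hne := S.sub_ne_zero d
  rcases S.noncrossing d d' _ hm hmem with h | h | ⟨h | h, -⟩
  · exact h1 h
  · exact h2 h
  · simp [midPoint, hne] at h
  · have : (1 / 2 : ℂ) * (S.head d - S.tail d) = 0 := by
      simp [midPoint] at h
      linear_combination -h
    simp [hne] at this

open Filter Topology in
-- The identity holds modulo 2π; the difference of the sides is continuous in `q` and vanishes at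
-- `p`, so nearby it is exact. The change of the subtended angle thus splits into a head term and a
-- tail term.
theorem eventually_arg_eq (d : D) {p : ℂ} (hp : p ∉ S.support) :
    ∀ᶠ q in 𝓝 p, Complex.arg ((S.head d - q) / (S.tail d - q)) =
      Complex.arg ((S.head d - p) / (S.tail d - p)) +
        (Complex.arg ((S.head d - q) / (S.head d - p)) -
          Complex.arg ((S.tail d - q) / (S.tail d - p))) := by
  have hh : S.head d - p ≠ 0 := fun h => hp (by
    rw [← _root_.sub_eq_zero.1 h]; exact S.head_mem_support d)
  have ht : S.tail d - p ≠ 0 := fun h => hp (by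
    rw [← _root_.sub_eq_zero.1 h]; exact S.tail_mem_support d)
  have hslit : (S.head d - p) / (S.tail d - p) ∈ Complex.slitPlane :=
    div_mem_slitPlane fun h => hp (Set.mem_iUnion.2 ⟨d, h⟩)
  set F : ℂ → ℝ := fun q => Complex.arg ((S.head d - q) / (S.tail d - q)) -
      (Complex.arg ((S.head d - p) / (S.tail d - p)) +
        (Complex.arg ((S.head d - q) / (S.head d - p)) -
          Complex.arg ((S.tail d - q) / (S.tail d - p)))) with hF
  have hFp : F p = 0 := by simp [hF, div_self hh, div_self ht]
  have hcont : ContinuousAt F p := by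
    have c1 : ContinuousAt (fun q => (S.head d - q) / (S.tail d - q)) p := by
      fun_prop (disch := exact ht)
    have c2 : ContinuousAt (fun q => (S.head d - q) / (S.head d - p)) p := by fun_prop
    have c3 : ContinuousAt (fun q => (S.tail d - q) / (S.tail d - p)) p := by fun_prop
    have d1 := ContinuousAt.comp (g := Complex.arg)
      (f := fun q => (S.head d - q) / (S.tail d - q)) (Complex.continuousAt_arg hslit) c1
    have d2 := ContinuousAt.comp (g := Complex.arg)
      (f := fun q => (S.head d - q) / (S.head d - p))
      (Complex.continuousAt_arg (by simp [div_self hh])) c2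
    have d3 := ContinuousAt.comp (g := Complex.arg)
      (f := fun q => (S.tail d - q) / (S.tail d - p))
      (Complex.continuousAt_arg (by simp [div_self ht])) c3
    exact ContinuousAt.sub d1 (ContinuousAt.add continuousAt_const (ContinuousAt.sub d2 d3))
  have hsmall : ∀ᶠ q in 𝓝 p, |F q| < 2 * Real.pi := by
    refine hcont.abs.eventually (gt_mem_nhds ?_)
    simp only [hFp, abs_zero]
    exact Real.two_pi_pos
  have e1 : ∀ᶠ q in 𝓝 p, S.head d - q ≠ 0 :=
    ContinuousAt.eventually_ne (g := fun q => S.head d - q) (by fun_prop) hh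
  have e2 : ∀ᶠ q in 𝓝 p, S.tail d - q ≠ 0 :=
    ContinuousAt.eventually_ne (g := fun q => S.tail d - q) (by fun_prop) ht
  filter_upwards [hsmall, e1, e2] with q hq h1 h2
  have hang : (F q : Real.Angle) = 0 := by
    simp only [hF, Real.Angle.coe_sub, Real.Angle.coe_add, Complex.arg_div_coe_angle h1 h2,
      Complex.arg_div_coe_angle hh ht, Complex.arg_div_coe_angle h1 hh,
      Complex.arg_div_coe_angle h2 ht]
    abel
  obtain ⟨k, hk⟩ := Real.Angle.coe_eq_zero_iff.1 hang
  have hk0 : k = 0 := by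
    rw [← hk, zsmul_eq_mul, abs_mul, abs_of_pos Real.two_pi_pos] at hq
    have : |(k : ℝ)| < 1 := by
      by_contra hc
      push Not at hc
      nlinarith [Real.two_pi_pos]
    exact Int.abs_lt_one_iff.1 (by exact_mod_cast this)
  rw [hk0, zero_smul] at hk
  simp only [hF] at hk
  linarith

variable [Fintype D]

/-- The winding number (up to a factor) of a weighted sum of darts around `p`. -/
noncomputable def winding (z : D → ℝ) (p : ℂ) : ℝ :=
  ∑ d, z d * Complex.arg ((S.head d - p) / (S.tail d - p))

/-- Summation by parts: reversing darts turns head terms into tail terms, and the tail terms at each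
point are weighted by the divergence there. -/
theorem sum_mul_head_sub_tail {z : D → ℝ} (hz : ∀ d, z (S.rev d) = -z d)
    (hdiv : ∀ a, ∑ d with S.tail d = a, z d = 0) (f : ℂ → ℝ) :
    ∑ d, z d * (f (S.head d) - f (S.tail d)) = 0 := by
  classical
  have h1 : ∑ d, z d * f (S.tail d) = 0 := by
    rw [← Finset.sum_fiberwise_of_maps_to (g := S.tail) (t := Finset.univ.image S.tail)
      (fun d _ => Finset.mem_image_of_mem _ (Finset.mem_univ d))]
    refine Finset.sum_eq_zero fun a _ => ?_
    have : ∑ d with S.tail d = a, z d * f (S.tail d) = (∑ d with S.tail d = a, z d) * f a := by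
      rw [Finset.sum_mul]
      refine Finset.sum_congr rfl fun d hd => ?_
      rw [(Finset.mem_filter.1 hd).2]
    rw [this, ← zero_mul (f a)]
    congr 1
    convert hdiv a
  have h2 : ∑ d, z d * f (S.head d) = -∑ d, z d * f (S.tail d) := by
    rw [← Finset.sum_neg_distrib, ← Equiv.sum_comp (⟨S.rev, S.rev, S.rev_rev, S.rev_rev⟩ : D ≃ D)]
    refine Finset.sum_congr rfl fun d _ => ?_
    change z (S.rev d) * f (S.head (S.rev d)) = _
    rw [hz, S.head_rev, neg_mul]
  simp only [mul_sub, Finset.sum_sub_distrib, h2, h1]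
  simp

open Filter Topology in
theorem eventually_winding_eq {z : D → ℝ} (hz : ∀ d, z (S.rev d) = -z d)
    (hdiv : ∀ a, ∑ d with S.tail d = a, z d = 0) {p : ℂ} (hp : p ∉ S.support) :
    ∀ᶠ q in 𝓝 p, S.winding z q = S.winding z p := by
  filter_upwards [eventually_all.2 fun d => S.eventually_arg_eq d hp] with q hq
  simp only [winding]
  rw [Finset.sum_congr rfl fun d _ => by rw [hq d, mul_add], Finset.sum_add_distrib]
  suffices ∑ d, z d * (Complex.arg ((S.head d - q) / (S.head d - p)) -
          Complex.arg ((S.tail d - q) / (S.tail d - p))) = 0 by rw [this, add_zero]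
  exact S.sum_mul_head_sub_tail hz hdiv fun a => Complex.arg ((a - q) / (a - p))

open Filter Topology in
theorem winding_eq_of_mem_face {z : D → ℝ} (hz : ∀ d, z (S.rev d) = -z d)
    (hdiv : ∀ a, ∑ d with S.tail d = a, z d = 0) {d : D} {p q : ℂ} (hp : p ∈ S.face d)
    (hq : q ∈ S.face d) : S.winding z p = S.winding z q := by
  refine (S.isPreconnected_face d).induction₂ (fun p q => S.winding z p = S.winding z q)
    ?_ (fun _ _ _ _ _ _ h h' => h.trans h') (fun _ _ _ _ h => h.symm) hp hq
  intro x hx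
  exact nhdsWithin_le_nhds
    ((S.eventually_winding_eq hz hdiv (S.face_subset d hx)).mono fun _ h => h.symm)

open Filter Topology in
-- The two quotients tend to -1 from opposite sides of the branch cut, so their arguments tend to π
-- and -π.
theorem tendsto_arg_jump :
    Tendsto (fun ε : ℝ => Complex.arg (-((1 / 2 - ε * Complex.I) / (1 / 2 + ε * Complex.I))) -
      Complex.arg (-((1 / 2 + ε * Complex.I) / (1 / 2 - ε * Complex.I)))) (𝓝[>] 0)
      (𝓝 (2 * Real.pi)) := by
  have h1 : ∀ ε : ℝ, -((1 / 2 - ε * Complex.I) / (1 / 2 + ε * Complex.I)) =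
      (⟨(ε ^ 2 - 1 / 4) / (1 / 4 + ε ^ 2), ε / (1 / 4 + ε ^ 2)⟩ : ℂ) := by
    intro ε
    have hpos : (0 : ℝ) < 1 / 4 + ε ^ 2 := by positivity
    have hne : (1 / 2 + ε * Complex.I : ℂ) ≠ 0 := by
      intro h
      have := congrArg Complex.re h
      simp at this
    rw [← neg_div, div_eq_iff hne]
    apply Complex.ext <;> simp <;> field_simp <;> ring
  have h2 : ∀ ε : ℝ, -((1 / 2 + ε * Complex.I) / (1 / 2 - ε * Complex.I)) =
      (⟨(ε ^ 2 - 1 / 4) / (1 / 4 + ε ^ 2), -ε / (1 / 4 + ε ^ 2)⟩ : ℂ) := by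
    intro ε
    have := h1 (-ε)
    simpa [sub_eq_add_neg] using this
  have hpos : ∀ ε : ℝ, (0 : ℝ) < 1 / 4 + ε ^ 2 := fun ε => by positivity
  have t1 : Tendsto (fun ε : ℝ => -((1 / 2 - ε * Complex.I) / (1 / 2 + ε * Complex.I)))
      (𝓝[>] 0) (𝓝[{z : ℂ | 0 ≤ z.im}] (-1)) := by
    apply tendsto_nhdsWithin_of_tendsto_nhds_of_eventually_within
    · apply Tendsto.mono_left _ nhdsWithin_le_nhds
      have : ContinuousAt (fun ε : ℝ => -((1 / 2 - ε * Complex.I) / (1 / 2 + ε * Complex.I))) 0 := by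
        fun_prop (disch := simp)
      simpa using this.tendsto
    · filter_upwards [self_mem_nhdsWithin] with ε hε
      rw [h1]
      exact div_nonneg (le_of_lt hε) (hpos ε).le
  have t2 : Tendsto (fun ε : ℝ => -((1 / 2 + ε * Complex.I) / (1 / 2 - ε * Complex.I)))
      (𝓝[>] 0) (𝓝[{z : ℂ | z.im < 0}] (-1)) := by
    apply tendsto_nhdsWithin_of_tendsto_nhds_of_eventually_within
    · apply Tendsto.mono_left _ nhdsWithin_le_nhds
      have : ContinuousAt (fun ε : ℝ => -((1 / 2 + ε * Complex.I) / (1 / 2 - ε * Complex.I))) 0 := by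
        fun_prop (disch := simp)
      simpa using this.tendsto
    · filter_upwards [self_mem_nhdsWithin] with ε hε
      rw [h2]
      exact div_neg_of_neg_of_pos (neg_lt_zero.2 hε) (hpos ε)
  have a1 := (Complex.tendsto_arg_nhdsWithin_im_nonneg_of_re_neg_of_im_zero
    (z := -1) (by simp) (by simp)).comp t1
  have a2 := (Complex.tendsto_arg_nhdsWithin_im_neg_of_re_neg_of_im_zero
    (z := -1) (by simp) (by simp)).comp t2
  have := a1.sub a2
  rw [show 2 * Real.pi = Real.pi - -Real.pi by ring]
  exact this

open Filter Topology in
/-- Crossing a segment changes the winding number by the weight of the segment. -/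
theorem winding_sub_winding {z : D → ℝ} (hz : ∀ d, z (S.rev d) = -z d)
    (hdiv : ∀ a, ∑ d with S.tail d = a, z d = 0) (d : D) :
    S.winding z (S.midPoint d (S.width / 4)) -
      S.winding z (S.midPoint (S.rev d) (S.width / 4)) = 4 * Real.pi * z d := by
  classical
  have hw := S.width_pos
  have hne := S.sub_ne_zero d
  have hdr : S.rev d ≠ d := fun h => S.tail_ne_head d (by rw [← S.tail_rev, h])
  set q : D → ℝ → ℝ := fun d' ε => Complex.arg
    ((S.head d' - S.midPoint d ε) / (S.tail d' - S.midPoint d ε)) with hq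
  have hlim : ∀ d', Tendsto (fun ε => z d' * (q d' ε - q d' (-ε))) (𝓝[>] 0)
      (𝓝 (if d' = d ∨ d' = S.rev d then 2 * Real.pi * z d else 0)) := by
    intro d'
    have e1 : ∀ ε : ℝ, (S.head d - S.midPoint d ε) / (S.tail d - S.midPoint d ε) =
        -((1 / 2 - ε * Complex.I) / (1 / 2 + ε * Complex.I)) := by
      intro ε
      have : (1 / 2 + ε * Complex.I : ℂ) ≠ 0 := by
        intro h
        have := congrArg Complex.re h
        simp at this
      rw [show S.head d - S.midPoint d ε = (1 / 2 - ε * Complex.I) * (S.head d - S.tail d) by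
          simp [midPoint]; ring,
        show S.tail d - S.midPoint d ε = -(1 / 2 + ε * Complex.I) * (S.head d - S.tail d) by
          simp [midPoint]; ring, mul_div_mul_right _ _ hne, div_neg]
    have e2 : ∀ ε : ℝ, (S.tail d - S.midPoint d ε) / (S.head d - S.midPoint d ε) =
        -((1 / 2 + ε * Complex.I) / (1 / 2 - ε * Complex.I)) := by
      intro ε
      rw [← inv_div, e1, inv_neg, inv_div]
    by_cases h1 : d' = d
    · subst h1
      rw [if_pos (Or.inl rfl)]
      have := tendsto_arg_jump.const_mul (z d')
      simp only [hq, e1]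
      convert this using 2
      · simp [sub_eq_add_neg]
      · ring
    by_cases h2 : d' = S.rev d
    · subst h2
      rw [if_pos (Or.inr rfl)]
      have := tendsto_arg_jump.const_mul (z d)
      simp only [hq, S.head_rev, S.tail_rev, e2, hz]
      convert this using 2
      · simp [sub_eq_add_neg]; ring
      · ring
    · rw [if_neg (by tauto)]
      have hnot := S.midPoint_notMem h1 h2
      have hslit := div_mem_slitPlane hnot
      have ht : S.tail d' - S.midPoint d 0 ≠ 0 := fun h => hnot (by
        rw [← _root_.sub_eq_zero.1 h]; exact left_mem_segment _ _ _)
      have hc : ContinuousAt (q d') 0 := by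
        have hcm : Continuous (S.midPoint d) := by unfold midPoint; fun_prop
        have : ContinuousAt (fun ε => (S.head d' - S.midPoint d ε) /
            (S.tail d' - S.midPoint d ε)) 0 :=
          (by fun_prop : Continuous fun ε => S.head d' - S.midPoint d ε).continuousAt.div
            (by fun_prop : Continuous fun ε => S.tail d' - S.midPoint d ε).continuousAt ht
        exact ContinuousAt.comp (g := Complex.arg) (Complex.continuousAt_arg hslit) this
      have hneg : Tendsto (fun ε : ℝ => q d' (-ε)) (𝓝 0) (𝓝 (q d' 0)) := by
        apply hc.tendsto.comp
        have := continuous_neg.tendsto (0 : ℝ)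
        simpa using this
      have := ((hc.tendsto.sub hneg).const_mul (z d')).mono_left
        (nhdsWithin_le_nhds (s := Set.Ioi (0 : ℝ)))
      simpa using this
  have hsum := tendsto_finsetSum Finset.univ fun d' _ => hlim d'
  -- Only `d` and its reverse jump at the midpoint. Both sign changes for the reverse cancel, so
  -- each contributes 2π times the weight.
  have hval : ∑ d', (if d' = d ∨ d' = S.rev d then 2 * Real.pi * z d else 0) =
      4 * Real.pi * z d := by
    rw [← Finset.sum_filter, Finset.sum_const]
    have : (Finset.univ.filter fun d' => d' = d ∨ d' = S.rev d) = {d, S.rev d} := by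
      ext; simp
    rw [this, Finset.card_pair hdr.symm]
    simp; ring
  rw [hval] at hsum
  refine tendsto_nhds_unique (Tendsto.congr' ?_ tendsto_const_nhds) hsum
  filter_upwards [Ioo_mem_nhdsGT (show (0 : ℝ) < S.width / 2 by linarith)] with ε ⟨h0, h1⟩
  rw [S.winding_eq_of_mem_face hz hdiv (S.side_subset_face _ (S.base_mem d))
      (S.side_subset_face _ (S.midPoint_mem h0 h1)),
    S.winding_eq_of_mem_face hz hdiv (S.side_subset_face _ (S.base_mem (S.rev d)))
      (S.side_subset_face _ (S.midPoint_mem h0 h1)), S.midPoint_rev]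
  simp only [winding, hq, ← Finset.sum_sub_distrib, mul_sub]

/-- Every circulation on a plane system of segments is the difference of a potential on the
faces. -/
theorem exists_face_potential {z : D → ℝ} (hz : ∀ d, z (S.rev d) = -z d)
    (hdiv : ∀ a, ∑ d with S.tail d = a, z d = 0) :
    ∃ w : D → ℝ, (∀ d d', S.face d = S.face d' → w d = w d') ∧
      ∀ d, w d - w (S.rev d) = z d := by
  refine ⟨fun d => S.winding z (S.midPoint d (S.width / 4)) / (4 * Real.pi), ?_, ?_⟩
  · intro d d' h
    have h1 := S.side_subset_face _ (S.base_mem d)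
    have h2 := S.side_subset_face _ (S.base_mem d')
    rw [← h] at h2
    simp only [S.winding_eq_of_mem_face hz hdiv h1 h2]
  · intro d
    rw [← sub_div, S.winding_sub_winding hz hdiv d]
    field_simp

end SegmentSystem

/-! ### Cutting a plane drawing into segments -/

/-- The corners of a simple polygonal chain with `n` segments. -/
structure IsSimpleChain (n : ℕ) (p : ℕ → ℝ × ℝ) : Prop where
  pos : 0 < n
  ne : ∀ i, i < n → p i ≠ p (i + 1)
  consecutive : ∀ i, i + 1 < n →
    segment ℝ (p i) (p (i + 1)) ∩ segment ℝ (p (i + 1)) (p (i + 2)) = {p (i + 1)}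
  disjoint : ∀ i j, i + 1 < j → j < n →
    Disjoint (segment ℝ (p i) (p (i + 1))) (segment ℝ (p j) (p (j + 1)))

theorem isPolygonalArc_iff {x y : ℝ × ℝ} {A : Set (ℝ × ℝ)} :
    IsPolygonalArc x y A ↔ ∃ n p, IsSimpleChain n p ∧ p 0 = x ∧ p n = y ∧
      A = ⋃ i ∈ Set.Iio n, segment ℝ (p i) (p (i + 1)) :=
  ⟨fun ⟨n, p, h, h0, hn, h1, h2, h3, h4⟩ => ⟨n, p, ⟨h, h1, h2, h3⟩, h0, hn, h4⟩,
    fun ⟨n, p, ⟨h, h1, h2, h3⟩, h0, hn, h4⟩ => ⟨n, p, h, h0, hn, h1, h2, h3, h4⟩⟩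

namespace IsSimpleChain

variable {n : ℕ} {p : ℕ → ℝ × ℝ}

theorem segment_reverse {i : ℕ} (hi : i < n) :
    segment ℝ (p (n - i)) (p (n - (i + 1))) =
      segment ℝ (p (n - 1 - i)) (p (n - 1 - i + 1)) := by
  rw [segment_symm]
  congr 2 <;> omega

theorem reverse (h : IsSimpleChain n p) : IsSimpleChain n (fun i => p (n - i)) where
  pos := h.pos
  ne i hi := by
    have := h.ne (n - 1 - i) (by omega)
    rw [show n - 1 - i + 1 = n - i by omega] at this
    simpa [show n - (i + 1) = n - 1 - i by omega] using this.symm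
  consecutive i hi := by
    have := h.consecutive (n - 2 - i) (by omega)
    have e1 : n - 2 - i + 1 = n - (i + 1) := by omega
    have e2 : n - 2 - i + 2 = n - i := by omega
    have e3 : n - 2 - i = n - (i + 2) := by omega
    rw [e1, e2, e3] at this
    rw [Set.inter_comm, segment_symm ℝ (p (n - (i + 1))), segment_symm ℝ (p (n - i))]
    exact this
  disjoint i j hij hj := by
    rw [segment_reverse (by omega), segment_reverse hj]
    exact (h.disjoint _ _ (by omega) (by omega)).symm

theorem iUnion_reverse : (⋃ i ∈ Set.Iio n, segment ℝ (p (n - i)) (p (n - (i + 1)))) =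
    ⋃ i ∈ Set.Iio n, segment ℝ (p i) (p (i + 1)) := by
  ext x
  simp only [Set.mem_iUnion, Set.mem_Iio, exists_prop]
  constructor
  · rintro ⟨i, hi, hx⟩
    exact ⟨n - 1 - i, by omega, by rwa [segment_reverse hi] at hx⟩
  · rintro ⟨i, hi, hx⟩
    refine ⟨n - 1 - i, by omega, ?_⟩
    rw [segment_reverse (by omega)]
    rwa [show n - 1 - (n - 1 - i) = i by omega]

theorem mem_inter (h : IsSimpleChain n p) {i j : ℕ} (hi : i < n) (hj : j < n) {x : ℝ × ℝ}
    (hxi : x ∈ segment ℝ (p i) (p (i + 1))) (hxj : x ∈ segment ℝ (p j) (p (j + 1))) :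
    i = j ∨ (j = i + 1 ∧ x = p (i + 1)) ∨ (i = j + 1 ∧ x = p (j + 1)) := by
  have key : ∀ i j, i < j → j < n → x ∈ segment ℝ (p i) (p (i + 1)) →
      x ∈ segment ℝ (p j) (p (j + 1)) → j = i + 1 ∧ x = p (i + 1) := by
    intro i j hij hj hxi hxj
    by_cases hc : i + 1 < j
    · exact absurd hxj (Set.disjoint_left.1 (h.disjoint i j hc hj) hxi)
    · obtain rfl : j = i + 1 := by omega
      have : x ∈ ({p (i + 1)} : Set (ℝ × ℝ)) := by
        rw [← h.consecutive i hj]; exact ⟨hxi, hxj⟩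
      exact ⟨rfl, this⟩
  rcases lt_trichotomy i j with hij | hij | hij
  · exact Or.inr (Or.inl (key i j hij hj hxi hxj))
  · exact Or.inl hij
  · exact Or.inr (Or.inr (key j i hij hi hxj hxi))

theorem injective (h : IsSimpleChain n p) {i j : ℕ} (hi : i ≤ n) (hj : j ≤ n)
    (hij : p i = p j) : i = j := by
  have key : ∀ i j, i < j → j ≤ n → p i ≠ p j := by
    intro i j hij hj he
    have h1 : p i ∈ segment ℝ (p i) (p (i + 1)) := left_mem_segment _ _ _
    have h2 : p i ∈ segment ℝ (p (j - 1)) (p (j - 1 + 1)) := by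
      rw [he, show j - 1 + 1 = j by omega]; exact right_mem_segment _ _ _
    rcases h.mem_inter (by omega) (by omega) h1 h2 with h3 | ⟨-, h3⟩ | ⟨h3, -⟩
    · apply h.ne i (by omega)
      rw [he]
      congr 1
      omega
    · exact h.ne i (by omega) h3
    · omega
  rcases lt_trichotomy i j with h1 | h1 | h1
  · exact absurd hij (key i j h1 hj)
  · exact h1
  · exact absurd hij.symm (key j i h1 hi)

theorem eq_end_of_mem (h : IsSimpleChain n p) {i : ℕ} (hi : i < n) {x : ℝ × ℝ}
    (hx : x ∈ segment ℝ (p i) (p (i + 1))) (he : x = p 0 ∨ x = p n) :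
    x = p i ∨ x = p (i + 1) := by
  have hn := h.pos
  rcases he with rfl | rfl
  · rcases h.mem_inter hi hn hx (left_mem_segment _ _ _) with rfl | ⟨h1, -⟩ | ⟨-, h1⟩
    · exact Or.inl rfl
    · omega
    · exact absurd h1 (h.ne 0 hn)
  · rcases h.mem_inter hi (j := n - 1) (by omega) hx (by
      rw [show n - 1 + 1 = n by omega]; exact right_mem_segment _ _ _) with h1 | ⟨-, h1⟩ | ⟨h1, -⟩
    · right; congr 1; omega
    · exact Or.inr h1
    · omega

end IsSimpleChain

theorem IsPolygonalArc.symm {x y : ℝ × ℝ} {A : Set (ℝ × ℝ)} (h : IsPolygonalArc x y A) :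
    IsPolygonalArc y x A := by
  obtain ⟨n, p, h1, h2, h3, rfl⟩ := isPolygonalArc_iff.1 h
  exact isPolygonalArc_iff.2 ⟨n, _, h1.reverse, by simpa using h3, by simpa using h2,
    IsSimpleChain.iUnion_reverse.symm⟩

namespace PlaneEmbedding

variable {V : Type*} {G : SimpleGraph V} (E : PlaneEmbedding G)

/-- An arc that avoids the drawing except for its ends can be added as an edge. -/
theorem isPlanar_sup_edge {u v : V} {A : Set (ℝ × ℝ)}
    (hA : IsPolygonalArc (E.point u) (E.point v) A)
    (hvert : ∀ w, E.point w ∈ A → w = u ∨ w = v)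
    (hedge : ∀ e ∈ G.edgeSet, A ∩ E.edge e ⊆ {E.point u, E.point v}) :
    IsPlanar (G ⊔ SimpleGraph.edge u v) := by
  classical
  have hmem : ∀ e ∈ (G ⊔ SimpleGraph.edge u v).edgeSet, e ≠ s(u, v) → e ∈ G.edgeSet := by
    intro e he hne
    induction e with
    | _ x y =>
      rw [SimpleGraph.mem_edgeSet, SimpleGraph.sup_adj, SimpleGraph.edge_adj] at he
      rcases he with he | ⟨he | he, -⟩
      · exact he
      · exact absurd (by rw [he.1, he.2]) hne
      · exact absurd (by rw [he.1, he.2, Sym2.eq_swap]) hne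
  have hnew : ∀ e ∈ G.edgeSet, A ∩ E.edge e ⊆ E.point '' {w | w ∈ s(u, v) ∧ w ∈ e} := by
    intro e he x hx
    rcases hedge e he hx with rfl | rfl
    · exact ⟨u, ⟨by simp, E.vertex_on_edge e he u hx.2⟩, rfl⟩
    · exact ⟨v, ⟨by simp, E.vertex_on_edge e he v hx.2⟩, rfl⟩
  refine ⟨⟨E.point, fun e => if e = s(u, v) then A else E.edge e, E.point_injective, ?_, ?_, ?_⟩⟩
  · intro x y hxy
    by_cases h : s(x, y) = s(u, v)
    · rw [if_pos h]
      rcases Sym2.eq_iff.1 h with ⟨rfl, rfl⟩ | ⟨rfl, rfl⟩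
      · exact hA
      · exact hA.symm
    · rw [if_neg h]
      exact E.isArc x y (hmem _ hxy h)
  · intro e he w hw
    by_cases h : e = s(u, v)
    · rw [if_pos h] at hw
      simpa [h] using hvert w hw
    · rw [if_neg h] at hw
      exact E.vertex_on_edge e (hmem e he h) w hw
  · intro e he e' he' hne
    by_cases h : e = s(u, v)
    · have h' : e' ≠ s(u, v) := fun h' => hne (h.trans h'.symm)
      rw [if_pos h, if_neg h', h]
      exact hnew e' (hmem e' he' h')
    · by_cases h' : e' = s(u, v)
      · rw [if_neg h, if_pos h', h', Set.inter_comm]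
        refine (hnew e (hmem e he h)).trans (Set.image_mono ?_)
        rintro w ⟨h1, h2⟩
        exact ⟨h2, h1⟩
      · rw [if_neg h, if_neg h']
        exact E.edge_inter_edge e (hmem e he h) e' (hmem e' he' h') hne

/-- A choice of corners for all edges, compatible with reversing the edges. -/
structure Corners where
  num : G.Dart → ℕ
  corner : G.Dart → ℕ → ℝ × ℝ
  chain : ∀ d, IsSimpleChain (num d) (corner d)
  corner_zero : ∀ d, corner d 0 = E.point d.fst
  corner_num : ∀ d, corner d (num d) = E.point d.snd
  edge_eq : ∀ d : G.Dart,
    E.edge d.edge = ⋃ i ∈ Set.Iio (num d), segment ℝ (corner d i) (corner d (i + 1))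
  num_symm : ∀ d, num d.symm = num d
  corner_symm : ∀ d i, i ≤ num d → corner d.symm i = corner d (num d - i)

theorem nonempty_corners : Nonempty E.Corners := by
  classical
  -- An arbitrary order selects one dart of each edge; its chain is chosen freely and reversed for
  -- the other dart.
  let _ : LinearOrder V := linearOrderOfSTO (WellOrderingRel : V → V → Prop)
  have h := fun d : G.Dart => isPolygonalArc_iff.1 (E.isArc d.fst d.snd d.adj)
  choose n p hp h0 hn hA using h
  have hlt : ∀ d : G.Dart, ¬ d.fst < d.snd → d.symm.fst < d.symm.snd := fun d hd =>
    lt_of_le_of_ne (not_lt.1 hd) d.adj.ne'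
  have hlt' : ∀ d : G.Dart, d.fst < d.snd → ¬ d.symm.fst < d.symm.snd := fun d hd =>
    not_lt.2 hd.le
  refine ⟨⟨fun d => if d.fst < d.snd then n d else n d.symm,
    fun d i => if d.fst < d.snd then p d i else p d.symm (n d.symm - i), ?_, ?_, ?_, ?_, ?_, ?_⟩⟩
  · intro d
    by_cases hd : d.fst < d.snd
    · simpa only [if_pos hd] using hp d
    · simpa only [if_neg hd] using (hp d.symm).reverse
  · intro d
    by_cases hd : d.fst < d.snd
    · simpa only [if_pos hd] using h0 d
    · simp only [if_neg hd]
      exact hn d.symm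
  · intro d
    by_cases hd : d.fst < d.snd
    · simpa only [if_pos hd] using hn d
    · simp only [if_neg hd, Nat.sub_self]
      exact h0 d.symm
  · intro d
    by_cases hd : d.fst < d.snd
    · simp only [if_pos hd]
      exact hA d
    · simp only [if_neg hd]
      rw [IsSimpleChain.iUnion_reverse, ← hA d.symm]
      exact congrArg E.edge d.edge_symm.symm
  · intro d
    by_cases hd : d.fst < d.snd
    · simp only [if_pos hd, if_neg (hlt' d hd), SimpleGraph.Dart.symm_symm]
    · simp only [if_neg hd, if_pos (hlt d hd)]
  · intro d i hi
    by_cases hd : d.fst < d.snd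
    · simp only [if_pos hd, if_neg (hlt' d hd), SimpleGraph.Dart.symm_symm]
    · simp only [if_neg hd] at hi
      simp only [if_neg hd, if_pos (hlt d hd)]
      congr 1
      omega

namespace Corners

variable {E} (c : E.Corners)

/-- The darts of the subdivided graph. -/
abbrev Idx := {x : G.Dart × ℕ // x.2 < c.num x.1}

instance [Finite V] : Finite c.Idx := by
  have : Finite G.Dart := Finite.of_injective _ SimpleGraph.Dart.toProd_injective
  have : Set.Finite (⋃ d : G.Dart, (fun i => (d, i)) '' Set.Iio (c.num d)) :=
    Set.finite_iUnion fun d => (Set.finite_Iio _).image _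
  refine (this.subset ?_ : Set.Finite {x : G.Dart × ℕ | x.2 < c.num x.1})
  rintro ⟨d, i⟩ h
  exact Set.mem_iUnion.2 ⟨d, i, h, rfl⟩

theorem segment_subset_edge {d : G.Dart} {i : ℕ} (hi : i < c.num d) :
    segment ℝ (c.corner d i) (c.corner d (i + 1)) ⊆ E.edge d.edge := by
  rw [c.edge_eq]
  exact Set.subset_biUnion_of_mem (u := fun i => segment ℝ (c.corner d i) (c.corner d (i + 1))) hi

theorem corner_mem_edge {d : G.Dart} {i : ℕ} (hi : i < c.num d) :
    c.corner d i ∈ E.edge d.edge :=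
  c.segment_subset_edge hi (left_mem_segment _ _ _)

/-- A common point of two different edges is an end of both. -/
theorem exists_end_of_mem {d d' : G.Dart} (hne : d.edge ≠ d'.edge) {x : ℝ × ℝ}
    (hx : x ∈ E.edge d.edge) (hx' : x ∈ E.edge d'.edge) :
    ∃ w, x = E.point w ∧ (w = d.fst ∨ w = d.snd) ∧ (w = d'.fst ∨ w = d'.snd) := by
  obtain ⟨w, ⟨h1, h2⟩, rfl⟩ := E.edge_inter_edge _ d.edge_mem _ d'.edge_mem hne ⟨hx, hx'⟩
  exact ⟨w, rfl, Sym2.mem_iff.1 h1, Sym2.mem_iff.1 h2⟩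

theorem point_eq_end {d : G.Dart} {w : V} (h : w = d.fst ∨ w = d.snd) :
    E.point w = c.corner d 0 ∨ E.point w = c.corner d (c.num d) := by
  rw [c.corner_zero, c.corner_num]
  rcases h with rfl | rfl <;> simp

theorem mem_segment_symm (a b : ℝ × ℝ) (x : ℂ) :
    x ∈ segment ℝ (Complex.equivRealProdCLM.symm a) (Complex.equivRealProdCLM.symm b) ↔
      Complex.equivRealProdCLM x ∈ segment ℝ a b := by
  have := image_segment ℝ (Complex.equivRealProdCLM.toLinearEquiv.toLinearMap.toAffineMap)
    (Complex.equivRealProdCLM.symm a) (Complex.equivRealProdCLM.symm b)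
  simp only [LinearMap.coe_toAffineMap, LinearEquiv.coe_coe,
    ContinuousLinearEquiv.coe_toLinearEquiv, ContinuousLinearEquiv.apply_symm_apply] at this
  rw [← this, Complex.equivRealProdCLM.injective.mem_set_image]

/-- The system of segments of a plane drawing. -/
noncomputable def system : SegmentSystem c.Idx where
  tail x := Complex.equivRealProdCLM.symm (c.corner x.1.1 x.1.2)
  head x := Complex.equivRealProdCLM.symm (c.corner x.1.1 (x.1.2 + 1))
  rev x := ⟨(x.1.1.symm, c.num x.1.1 - 1 - x.1.2), by
    have := x.2; simp only [c.num_symm]; omega⟩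
  tail_rev x := by
    have := x.2
    simp only
    rw [c.corner_symm _ _ (by omega)]
    congr 2
    omega
  head_rev x := by
    have := x.2
    simp only
    rw [c.corner_symm _ _ (by omega)]
    congr 2
    omega
  rev_rev x := by
    have := x.2
    apply Subtype.ext
    apply Prod.ext
    · simp
    · simp only [c.num_symm]; omega
  tail_ne_head x h := (c.chain x.1.1).ne _ x.2 (Complex.equivRealProdCLM.symm.injective h)
  noncrossing := by
    have key : ∀ (d : G.Dart) (i j : ℕ) (hi : i < c.num d) (hj : j < c.num d) (x : ℝ × ℝ),
        x ∈ segment ℝ (c.corner d i) (c.corner d (i + 1)) →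
        x ∈ segment ℝ (c.corner d j) (c.corner d (j + 1)) →
        j = i ∨ ((x = c.corner d i ∨ x = c.corner d (i + 1)) ∧
          (x = c.corner d j ∨ x = c.corner d (j + 1))) := by
      intro d i j hi hj x hx hx'
      rcases (c.chain d).mem_inter hi hj hx hx' with h | ⟨rfl, h⟩ | ⟨rfl, h⟩
      · exact Or.inl h.symm
      · exact Or.inr ⟨Or.inr h, Or.inl h⟩
      · exact Or.inr ⟨Or.inl h, Or.inr h⟩
    rintro ⟨⟨d, i⟩, hi⟩ ⟨⟨d', j⟩, hj⟩ x hx hx'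
    simp only at hi hj
    simp only [mem_segment_symm] at hx hx'
    have hsym : ∀ a, x = Complex.equivRealProdCLM.symm a ↔ Complex.equivRealProdCLM x = a :=
      fun a => ContinuousLinearEquiv.eq_symm_apply _
    simp only [hsym]
    by_cases hd : d.edge = d'.edge
    · rcases (SimpleGraph.dart_edge_eq_iff _ _).1 hd with rfl | rfl
      · rcases key d i j hi hj _ hx hx' with rfl | h
        · exact Or.inl rfl
        · exact Or.inr (Or.inr h)
      -- Both darts run along the same edge in opposite directions: segment `j` of one is segment
      -- `num - 1 - j` of the other.
      · have hj' : j < c.num d'.symm := by rwa [c.num_symm]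
        have e1 : c.corner d'.symm (c.num d' - 1 - j) = c.corner d' (j + 1) := by
          rw [c.corner_symm _ _ (by omega)]; congr 1; omega
        have e2 : c.corner d'.symm (c.num d' - 1 - j + 1) = c.corner d' j := by
          rw [c.corner_symm _ _ (by omega)]; congr 1; omega
        rcases key d'.symm i (c.num d' - 1 - j) hi (by rw [c.num_symm] at *; omega) _ hx
          (by rw [e1, e2, segment_symm]; exact hx') with h | h
        · right; left
          apply Subtype.ext
          apply Prod.ext
          · simp
          · simp only [c.num_symm]; omega
        · right; right
          rw [e1, e2] at h
          exact ⟨h.1, h.2.symm⟩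
    · right; right
      obtain ⟨w, hw, h1, h2⟩ := exists_end_of_mem hd (c.segment_subset_edge hi hx)
        (c.segment_subset_edge hj hx')
      rw [hw] at hx hx' ⊢
      exact ⟨(c.chain d).eq_end_of_mem hi hx (c.point_eq_end h1),
        (c.chain d').eq_end_of_mem hj hx' (c.point_eq_end h2)⟩

end Corners

end PlaneEmbedding

/-! ### Rays leaving the drawing -/

namespace SegmentSystem

variable {D : Type*} (S : SegmentSystem D) [Finite D]

open Filter Topology in
/-- A ray leaving the drawing at a point starts in the face of a dart through this point. -/
theorem exists_face_of_ray {e : D} {p u : ℂ} (hp : p ∈ segment ℝ (S.tail e) (S.head e))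
    (hu : ∀ t : ℝ, 0 < t → t < 1 → p + t * u ∉ S.support) :
    ∃ d, p ∈ segment ℝ (S.tail d) (S.head d) ∧ p + (1 / 2 : ℝ) * u ∈ S.face d := by
  suffices h : ∃ d, p ∈ segment ℝ (S.tail d) (S.head d) ∧
      ∃ t : ℝ, 0 < t ∧ t < 1 ∧ p + t * u ∈ S.face d by
    obtain ⟨d, hd, t, h0, h1, ht⟩ := h
    refine ⟨d, hd, ?_⟩
    have hpre : IsPreconnected ((fun t : ℝ => p + t * u) '' Set.Ioo 0 1) :=
      isPreconnected_Ioo.image _ (by fun_prop)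
    have := hpre.subset_connectedComponentIn (F := S.supportᶜ) ⟨t, ⟨h0, h1⟩, rfl⟩ (by
      rintro _ ⟨t, ⟨h0, h1⟩, rfl⟩
      exact hu t h0 h1)
    rw [S.face_eq ht]
    exact this ⟨1 / 2, ⟨by norm_num, by norm_num⟩, rfl⟩
  have hend : ∀ e, p = S.tail e → ∃ d, p ∈ segment ℝ (S.tail d) (S.head d) ∧
      ∃ t : ℝ, 0 < t ∧ t < 1 ∧ p + t * u ∈ S.face d := by
    rintro e rfl
    -- The sector from the direction of the ray to the next dart is in one face. The ray is only its
    -- boundary, but being off the drawing, it lies in the same component as nearby sector points.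
    obtain ⟨d, hd, hnext⟩ := S.exists_isNext u.arg e
    refine ⟨S.rev d, by rw [S.tail_rev, S.head_rev, hd]; exact right_mem_segment _ _ _, ?_⟩
    have hu0 : u ≠ 0 := fun h => hu (1 / 2) (by norm_num) (by norm_num) (by
      rw [h, mul_zero, add_zero]
      exact S.tail_mem_support e)
    have hl : 0 < ‖u‖ := norm_pos_iff.2 hu0
    obtain ⟨κ, hκ, hsec⟩ := S.exists_sector_subset_face hnext
    obtain ⟨t, ht0, ht⟩ := exists_between (show 0 < min 1 (κ / ‖u‖) by positivity)
    have ht1 : t < 1 := ht.trans_le (min_le_left _ _)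
    have htκ : t * ‖u‖ < κ := (lt_div_iff₀ hl).1 (ht.trans_le (min_le_right _ _))
    refine ⟨t, ht0, ht1, ?_⟩
    set x := S.tail e + t * u with hx
    have hxS : x ∈ S.supportᶜ := hu t ht0 ht1
    have hcont : Tendsto (fun s : ℝ => S.tail e + (t * ‖u‖ : ℝ) *
        Complex.exp ((u.arg + s : ℝ) * Complex.I)) (𝓝[>] 0) (𝓝 x) := by
      have hc : Continuous (fun s : ℝ => S.tail e + (t * ‖u‖ : ℝ) *
        Complex.exp ((u.arg + s : ℝ) * Complex.I)) := by fun_prop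
      have := (hc.tendsto 0).mono_left (nhdsWithin_le_nhds (s := Set.Ioi (0 : ℝ)))
      convert this using 2
      rw [add_zero]
      push_cast
      rw [mul_assoc, Complex.norm_mul_exp_arg_mul_I]
    have hopen : connectedComponentIn S.supportᶜ x ∈ 𝓝 x :=
      (S.isOpen_compl_support.connectedComponentIn).mem_nhds (mem_connectedComponentIn hxS)
    obtain ⟨s, hs, hs0, hs1⟩ := ((hcont.eventually hopen).and
      (Ioo_mem_nhdsGT (angleGap_pos u.arg (S.angle d)))).exists
    have hq := hsec (t * ‖u‖) s (by positivity) htκ hs0 hs1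
    rw [hd] at hq
    rw [S.face_eq hq, ← connectedComponentIn_eq hs]
    exact mem_connectedComponentIn hxS
  have hside : ∀ (e : D) (s : ℝ) (c : ℂ), 0 < s → s < 1 → 0 < c.im →
      p = S.tail e + s * (S.head e - S.tail e) → u = c * (S.head e - S.tail e) →
      ∃ t : ℝ, 0 < t ∧ t < 1 ∧ p + t * u ∈ S.face e := by
    intro e s c hs0 hs1 hc hps huc
    have hw := S.width_pos
    have h1 : ∀ᶠ t : ℝ in 𝓝 0, t * c.im < S.width * (s + t * c.re) :=
      Tendsto.eventually_lt (f := fun t : ℝ => t * c.im) (g := fun t => S.width * (s + t * c.re))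
        (Continuous.tendsto (by fun_prop) _) (Continuous.tendsto (by fun_prop) _)
        (by simp; positivity)
    have h2 : ∀ᶠ t : ℝ in 𝓝 0, t * c.im < S.width * (1 - (s + t * c.re)) :=
      Tendsto.eventually_lt (f := fun t : ℝ => t * c.im)
        (g := fun t => S.width * (1 - (s + t * c.re)))
        (Continuous.tendsto (by fun_prop) _) (Continuous.tendsto (by fun_prop) _)
        (by simp; exact mul_pos hw (by linarith))
    obtain ⟨t, ⟨h1, h2⟩, ht0, ht1⟩ := (((h1.and h2).filter_mono
      (nhdsWithin_le_nhds (s := Set.Ioi (0 : ℝ)))).and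
        (Ioo_mem_nhdsGT (zero_lt_one (α := ℝ)))).exists
    refine ⟨t, ht0, ht1, S.side_subset_face _ ⟨(s + t * c.re, t * c.im), ⟨by positivity, h1, h2⟩, ?_⟩⟩
    simp only
    rw [hps, huc]
    conv_rhs => rw [← Complex.re_add_im c]
    push_cast
    ring
  have hne := S.sub_ne_zero e
  have hp' := hp
  rw [segment_eq_image'] at hp'
  obtain ⟨s, ⟨hs0, hs1⟩, hps⟩ := hp'
  simp only [Complex.real_smul] at hps
  rcases eq_or_lt_of_le hs0 with rfl | hs0
  · exact hend e (by rw [← hps]; simp)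
  rcases eq_or_lt_of_le hs1 with rfl | hs1
  · exact hend (S.rev e) (by rw [← hps, S.tail_rev]; simp)
  have huc : u = u / (S.head e - S.tail e) * (S.head e - S.tail e) := (div_mul_cancel₀ _ hne).symm
  set c := u / (S.head e - S.tail e) with hc
  -- In the coordinate where `e` is [0, 1], the ray from an inner point goes to the right, along the
  -- segment (impossible, as it avoids the drawing), or to the left.
  rcases lt_trichotomy c.im 0 with h | h | h
  · refine ⟨S.rev e, by rwa [S.tail_rev, S.head_rev, segment_symm], ?_⟩
    refine hside (S.rev e) (1 - s) (-c) (by linarith) (by linarith) (by simpa using h) ?_ ?_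
    · rw [S.tail_rev, S.head_rev, ← hps]; push_cast; ring
    · rw [S.tail_rev, S.head_rev]; linear_combination huc
  · exfalso
    have h1 : ∀ᶠ t : ℝ in 𝓝 0, 0 < s + t * c.re :=
      Tendsto.eventually_lt (f := fun _ : ℝ => (0 : ℝ)) (g := fun t => s + t * c.re)
        tendsto_const_nhds (Continuous.tendsto (by fun_prop) _) (by simpa using hs0)
    have h2 : ∀ᶠ t : ℝ in 𝓝 0, s + t * c.re < 1 :=
      Tendsto.eventually_lt (f := fun t => s + t * c.re) (g := fun _ : ℝ => (1 : ℝ))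
        (Continuous.tendsto (by fun_prop) _) tendsto_const_nhds (by simpa using hs1)
    obtain ⟨t, ⟨h1, h2⟩, ht0, ht1⟩ := (((h1.and h2).filter_mono
      (nhdsWithin_le_nhds (s := Set.Ioi (0 : ℝ)))).and
        (Ioo_mem_nhdsGT (zero_lt_one (α := ℝ)))).exists
    apply hu t ht0 ht1
    refine Set.mem_iUnion.2 ⟨e, ?_⟩
    rw [segment_eq_image']
    refine ⟨s + t * c.re, ⟨h1.le, h2.le⟩, ?_⟩
    simp only [Complex.real_smul]
    rw [← hps, huc]
    conv_rhs => rw [← Complex.re_add_im c, h]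
    push_cast
    ring
  · exact ⟨e, hp, hside e s c hs0 hs1 h hps.symm huc⟩

end SegmentSystem

/-! ### Faces of a plane drawing -/

namespace PlaneEmbedding.Corners

variable {V : Type*} {G : SimpleGraph V} {E : PlaneEmbedding G} (c : E.Corners)

/-- The first segment of a dart. -/
def first (d : G.Dart) : c.Idx := ⟨(d, 0), (c.chain d).pos⟩

/-- The last segment of a dart. -/
def last (d : G.Dart) : c.Idx :=
  ⟨(d, c.num d - 1), Nat.sub_lt (c.chain d).pos one_pos⟩

theorem rev_first (d : G.Dart) : c.system.rev (c.first d) = c.last d.symm := by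
  apply Subtype.ext
  simp [system, last, first, c.num_symm]

theorem tail_first (d : G.Dart) :
    c.system.tail (c.first d) = Complex.equivRealProdCLM.symm (E.point d.fst) := by
  simp [system, first, c.corner_zero]

theorem head_last (d : G.Dart) :
    c.system.head (c.last d) = Complex.equivRealProdCLM.symm (E.point d.snd) := by
  have := (c.chain d).pos
  simp only [system, last]
  rw [show c.num d - 1 + 1 = c.num d by omega, c.corner_num]

/-- A vertex lies only on edges at it, and corners of a chain are distinct; the final corner of a
chain is never the tail of one of its segments. -/
theorem eq_first_of_tail_eq {x : c.Idx} {v : V}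
    (h : c.system.tail x = Complex.equivRealProdCLM.symm (E.point v)) :
    x.1.1.fst = v ∧ x = c.first x.1.1 := by
  obtain ⟨⟨d, i⟩, hi⟩ := x
  simp only at hi
  have h : c.corner d i = E.point v := Complex.equivRealProdCLM.symm.injective h
  have hv : v ∈ d.edge := E.vertex_on_edge _ d.edge_mem _ (h ▸ c.corner_mem_edge hi)
  rcases Sym2.mem_iff.1 hv with h' | h'
  · have : i = 0 := (c.chain d).injective hi.le (Nat.zero_le _) (by rw [h, c.corner_zero, h'])
    subst this
    exact ⟨h'.symm, rfl⟩
  · have : i = c.num d := (c.chain d).injective hi.le le_rfl (by rw [h, c.corner_num, h'])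
    omega

/-- Different edges meet only in vertices, so an inner corner has just two outgoing segments: onward
and backward. -/
theorem eq_or_eq_of_tail_eq {d : G.Dart} {i : ℕ} (hi : i + 1 < c.num d) {x : c.Idx}
    (h : c.system.tail x = c.system.tail ⟨(d, i + 1), hi⟩) :
    x = ⟨(d, i + 1), hi⟩ ∨ x = c.system.rev ⟨(d, i), by simp only; omega⟩ := by
  obtain ⟨⟨d', j⟩, hj⟩ := x
  simp only at hj
  have h : c.corner d' j = c.corner d (i + 1) := Complex.equivRealProdCLM.symm.injective h
  by_cases hd : d.edge = d'.edge
  · rcases (SimpleGraph.dart_edge_eq_iff _ _).1 hd with rfl | rfl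
    · left
      have := (c.chain d).injective hj.le hi.le h
      subst this
      rfl
    · right
      rw [c.num_symm] at hi
      rw [c.corner_symm _ _ (by omega)] at h
      have := (c.chain d').injective hj.le (by omega) h
      apply Subtype.ext
      apply Prod.ext
      · simp [system]
      · simp only [system, c.num_symm]; omega
  · exfalso
    obtain ⟨w, hw, h1, -⟩ := exists_end_of_mem hd (c.corner_mem_edge hi)
      (h ▸ c.corner_mem_edge hj)
    rcases c.point_eq_end h1 with h2 | h2
    · have := (c.chain d).injective hi.le (Nat.zero_le _) (hw.trans h2)
      omega
    · have := (c.chain d).injective hi.le le_rfl (hw.trans h2)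
      omega

theorem isNext_inner {d : G.Dart} {i : ℕ} (hi : i + 1 < c.num d) :
    c.system.IsNext (c.system.angle ⟨(d, i + 1), hi⟩)
      (c.system.rev ⟨(d, i), by simp only; omega⟩) := by
  intro x hx
  have ht : c.system.tail (c.system.rev ⟨(d, i), by simp only; omega⟩) =
      c.system.tail ⟨(d, i + 1), hi⟩ := c.system.tail_rev _
  rcases c.eq_or_eq_of_tail_eq hi (hx.trans ht) with h | h
  · rw [h, angleGap_self]
    exact angleGap_le _ _
  · rw [h]

theorem support_eq : c.system.support =
    Complex.equivRealProdCLM ⁻¹' ⋃ e ∈ G.edgeSet, E.edge e := by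
  ext x
  simp only [SegmentSystem.support, Set.mem_iUnion, Set.mem_preimage, exists_prop]
  constructor
  · rintro ⟨⟨⟨d, i⟩, hi⟩, hx⟩
    simp only [system, mem_segment_symm] at hx
    exact ⟨d.edge, d.edge_mem, c.segment_subset_edge hi hx⟩
  · rintro ⟨e, he, hx⟩
    induction e with
    | _ u v =>
      have : E.edge s(u, v) = E.edge (⟨(u, v), he⟩ : G.Dart).edge := rfl
      rw [this, c.edge_eq] at hx
      simp only [Set.mem_iUnion, Set.mem_Iio, exists_prop] at hx
      obtain ⟨i, hi, hx⟩ := hx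
      refine ⟨⟨(_, i), hi⟩, ?_⟩
      simp only [system, mem_segment_symm]
      exact hx

variable [Finite V]

/-- At each inner corner, turning from the onward segment leads to the backward one, so the face on
the left is unchanged along an edge. -/
theorem face_eq_face_first (x : c.Idx) : c.system.face x = c.system.face (c.first x.1.1) := by
  obtain ⟨⟨d, i⟩, hi⟩ := x
  induction i with
  | zero => rfl
  | succ i ih =>
    have hi' : i < c.num d := by simp only at hi; omega
    rw [← ih hi', c.system.face_eq_face_rev_of_isNext (c.system.tail_rev _) (c.isNext_inner hi),
      c.system.rev_rev]

/-- The face on the left of a dart of the graph. -/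
noncomputable def faceOf (d : G.Dart) : Set ℂ := c.system.face (c.first d)

theorem face_last (d : G.Dart) : c.system.face (c.last d) = c.faceOf d :=
  c.face_eq_face_first (c.last d)

/-- Vertices on the boundary of the same face can be joined by an arc. -/
theorem exists_arc_of_faceOf_eq {d d' : G.Dart} (hf : c.faceOf d = c.faceOf d') {v v' : V}
    (hv : v = d.fst ∨ v = d.snd) (hv' : v' = d'.fst ∨ v' = d'.snd) (hne : v ≠ v') :
    ∃ A, IsPolygonalArc (E.point v) (E.point v') A ∧
      ∀ e ∈ G.edgeSet, A ∩ E.edge e ⊆ {E.point v, E.point v'} := by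
  set ψ := Complex.equivRealProdCLM with hψ
  have himg : ∀ (F : Set ℂ) (a b x : ℂ), segment ℝ a b ⊆ insert x F →
      segment ℝ (ψ a) (ψ b) ⊆ insert (ψ x) (ψ '' F) := by
    intro F a b x h
    have := image_segment ℝ (ψ.toLinearEquiv.toLinearMap.toAffineMap) a b
    simp only [LinearMap.coe_toAffineMap, LinearEquiv.coe_coe,
      ContinuousLinearEquiv.coe_toLinearEquiv] at this
    rw [← this, ← Set.image_insert_eq]
    exact Set.image_mono h
  have hvis : ∀ (d : G.Dart) (v : V), (v = d.fst ∨ v = d.snd) →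
      ∃ p ∈ c.faceOf d, segment ℝ (ψ.symm (E.point v)) p ⊆
        insert (ψ.symm (E.point v)) (c.faceOf d) := by
    rintro d v (rfl | rfl)
    · refine ⟨_, c.system.side_subset_face _ (c.system.base_mem (c.first d)), ?_⟩
      have := c.system.segment_base_subset (c.first d)
      rwa [c.tail_first] at this
    · refine ⟨_, c.face_last d ▸ c.system.side_subset_face _ (c.system.base_mem (c.last d)), ?_⟩
      have := c.system.segment_base_subset_head (c.last d)
      rwa [c.head_last, c.face_last, segment_symm] at this
  have hout : ∀ v (d : G.Dart), (v = d.fst ∨ v = d.snd) →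
      ψ.symm (E.point v) ∈ c.system.support := by
    rintro v d (rfl | rfl)
    · rw [← c.tail_first]; exact c.system.tail_mem_support _
    · rw [← c.head_last]; exact c.system.head_mem_support _
  obtain ⟨p, hp, hvp⟩ := hvis d v hv
  obtain ⟨q, hq, hvq⟩ := hvis d' v' hv'
  rw [← hf] at hq hvq
  have h1 := himg _ _ _ _ hvp
  have h2 := himg _ _ _ _ hvq
  rw [ψ.apply_symm_apply] at h1 h2
  rw [segment_symm] at h2
  have hsub : c.faceOf d ⊆ c.system.supportᶜ := c.system.face_subset _
  obtain ⟨A, hA, hAsub⟩ := exists_isPolygonalArc_of_isPreconnected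
    (U := ψ '' c.faceOf d) (ψ.toHomeomorph.isOpenMap _ (c.system.isOpen_face _))
    ((c.system.isPreconnected_face _).image _ ψ.continuous.continuousOn)
    (x := E.point v) (y := E.point v') (by
      rintro ⟨x, hx, hxv⟩
      apply hsub hx
      rw [← ψ.symm_apply_apply x, hxv]
      exact hout v d hv) (fun h => hne (E.point_injective h))
    ⟨p, hp, rfl⟩ ⟨q, hq, rfl⟩ h1 h2
  refine ⟨A, hA, fun e he x ⟨hxA, hxe⟩ => ?_⟩
  rcases hAsub hxA with h | h | ⟨y, hy, rfl⟩
  · exact Or.inl h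
  · exact Or.inr h
  · exfalso
    apply hsub hy
    rw [c.support_eq]
    exact Set.mem_biUnion he hxe

end PlaneEmbedding.Corners

/-! ### From drawings to rotation systems -/

/-- A rotation system on the darts of a graph in which every circulation is the difference of a
potential on the faces, i.e. a rotation system of a drawing in the sphere.  The face to the left of
`d` is also to the left of `(next d).symm`. -/
structure PlaneRotation {V : Type*} [Fintype V] [DecidableEq V] (G : SimpleGraph V)
    [DecidableRel G.Adj] where
  next : Equiv.Perm G.Dart
  fst_next : ∀ d, (next d).fst = d.fst
  sameCycle : ∀ d d', d.fst = d'.fst → next.SameCycle d d'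
  exists_potential : ∀ z : G.Dart → ℝ, (∀ d, z d.symm = -z d) →
    (∀ v, ∑ d with d.fst = v, z d = 0) →
    ∃ w : G.Dart → ℝ, (∀ d, w d = w (next d).symm) ∧ ∀ d, w d - w d.symm = z d

namespace PlaneEmbedding.Corners

variable {V : Type*} [Fintype V] [DecidableEq V] {G : SimpleGraph V} [DecidableRel G.Adj]
  {E : PlaneEmbedding G} (c : E.Corners)

/-- Copying the weight of a dart to all its segments preserves circulations: at a vertex the sum is
the given one, and at an inner corner the two opposite contributions cancel. -/
theorem sum_tail_eq_zero [Fintype c.Idx] [DecidableEq ℂ] {z : G.Dart → ℝ}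
    (hz : ∀ d, z d.symm = -z d)
    (hdiv : ∀ v, ∑ d with d.fst = v, z d = 0) (a : ℂ) :
    ∑ x : c.Idx with c.system.tail x = a, z x.1.1 = 0 := by
  classical
  by_cases h : ∃ x, c.system.tail x = a
  · obtain ⟨⟨⟨d, i⟩, hi⟩, rfl⟩ := h
    cases i with
    | zero =>
      change ∑ x : c.Idx with c.system.tail x = c.system.tail (c.first d), z x.1.1 = 0
      rw [c.tail_first, ← hdiv d.fst]
      refine Finset.sum_bij' (fun x _ => x.1.1) (fun d _ => c.first d) ?_ ?_ ?_ ?_ ?_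
      · intro x hx
        simp only [Finset.mem_filter, Finset.mem_univ, true_and] at hx ⊢
        exact (c.eq_first_of_tail_eq hx).1
      · intro x hx
        simp only [Finset.mem_filter, Finset.mem_univ, true_and] at hx ⊢
        rw [c.tail_first, hx]
      · intro x hx
        simp only [Finset.mem_filter, Finset.mem_univ, true_and] at hx
        exact (c.eq_first_of_tail_eq hx).2.symm
      · intro x _; rfl
      · intro x _; rfl
    | succ i =>
      have hi' : i < c.num d := by simp only at hi; omega
      have hne : (⟨(d, i + 1), hi⟩ : c.Idx) ≠ c.system.rev ⟨(d, i), hi'⟩ := by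
        intro h
        have := congrArg (fun x : c.Idx => x.1.1) h
        exact d.symm_ne this.symm
      have : (Finset.univ.filter fun x : c.Idx =>
          c.system.tail x = c.system.tail ⟨(d, i + 1), hi⟩) =
          {⟨(d, i + 1), hi⟩, c.system.rev ⟨(d, i), hi'⟩} := by
        ext x
        simp only [Finset.mem_filter, Finset.mem_univ, true_and, Finset.mem_insert,
          Finset.mem_singleton]
        constructor
        · exact c.eq_or_eq_of_tail_eq hi
        · rintro (h | h)
          · rw [h]
          · rw [h]; exact c.system.tail_rev _
      rw [this, Finset.sum_pair hne]
      change z d + z d.symm = 0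
      rw [hz, add_neg_cancel]
  · rw [Finset.filter_false_of_mem, Finset.sum_empty]
    intro x _ hx
    exact h ⟨x, hx⟩

theorem exists_planeRotation : ∃ R : PlaneRotation G,
    ∀ d, c.faceOf d = c.faceOf (R.next d).symm := by
  classical
  obtain ⟨σ, hfst, hmin, hcyc⟩ := exists_rotation (fun d : G.Dart => d.fst)
    (fun d => c.system.angle (c.first d)) (fun d d' hd h => by
      have := c.system.eq_of_angleGap_eq (d := c.first d) (d' := c.first d')
        (by rw [c.tail_first, c.tail_first, hd]) h
      exact congrArg (fun x : c.Idx => x.1.1) this)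
  have hface : ∀ d, c.faceOf d = c.faceOf (σ d).symm := by
    intro d
    have ht : c.system.tail (c.first (σ d)) = c.system.tail (c.first d) := by
      rw [c.tail_first, c.tail_first, hfst]
    rw [faceOf, c.system.face_eq_face_rev_of_isNext ht, c.rev_first, c.face_last]
    intro x hx
    rw [c.tail_first] at hx
    obtain ⟨h1, h2⟩ := c.eq_first_of_tail_eq hx
    rw [h2]
    exact hmin d _ (by rw [h1, hfst])
  refine ⟨⟨σ, hfst, hcyc, fun z hz hdiv => ?_⟩, hface⟩
  let _ : Fintype c.Idx := Fintype.ofFinite _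
  obtain ⟨w, hw1, hw2⟩ := c.system.exists_face_potential (z := fun x => z x.1.1)
    (fun x => hz x.1.1) (fun a => by convert c.sum_tail_eq_zero hz hdiv a)
  refine ⟨fun d => w (c.first d), fun d => hw1 _ _ (hface d), fun d => ?_⟩
  have := hw2 (c.first d)
  rwa [c.rev_first, hw1 _ _ (c.face_last d.symm)] at this

omit [DecidableEq V] [DecidableRel G.Adj] in
/-- If the graph is disconnected then some face touches different parts. -/
theorem exists_faceOf_eq {K : Set V} (hK : ∀ u ∈ K, ∀ v, G.Adj u v → v ∈ K) {d₁ d₂ : G.Dart}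
    (h₁ : d₁.fst ∈ K) (h₂ : d₂.fst ∉ K) :
    ∃ d d' : G.Dart, d.fst ∈ K ∧ d'.fst ∉ K ∧ c.faceOf d = c.faceOf d' := by
  have hseg : ∀ x : c.Idx, IsCompact (segment ℝ (c.system.tail x) (c.system.head x)) := by
    intro x
    rw [segment_eq_image_lineMap]
    exact isCompact_Icc.image (by fun_prop)
  set X := fun P : V → Prop => ⋃ x ∈ {x : c.Idx | P x.1.1.fst},
    segment ℝ (c.system.tail x) (c.system.head x) with hX
  have hcomp : ∀ P, IsCompact (X P) := fun P =>
    (Set.toFinite _).isCompact_biUnion fun x _ => hseg x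
  have hne : ∀ (P : V → Prop) (d : G.Dart), P d.fst → (X P).Nonempty := fun P d hd =>
    ⟨_, Set.mem_biUnion (show c.first d ∈ {x : c.Idx | P x.1.1.fst} from hd)
      (left_mem_segment _ _ _)⟩
  have hcover : c.system.support ⊆ X (· ∈ K) ∪ X (· ∉ K) := by
    intro x hx
    obtain ⟨y, hy⟩ := Set.mem_iUnion.1 hx
    by_cases h : y.1.1.fst ∈ K
    · exact Or.inl (Set.mem_biUnion (show y ∈ {x : c.Idx | x.1.1.fst ∈ K} from h) hy)
    · exact Or.inr (Set.mem_biUnion (show y ∈ {x : c.Idx | x.1.1.fst ∉ K} from h) hy)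
  have hdisj : ∀ x y : c.Idx, x.1.1.fst ∈ K → y.1.1.fst ∉ K → ∀ p,
      p ∈ segment ℝ (c.system.tail x) (c.system.head x) →
      p ∉ segment ℝ (c.system.tail y) (c.system.head y) := by
    intro x y hx hy p hpx hpy
    simp only [system, mem_segment_symm] at hpx hpy
    have hy' : y.1.1.snd ∉ K := fun h => hy (hK _ h _ y.1.1.adj.symm)
    have hx' : x.1.1.snd ∈ K := hK _ hx _ x.1.1.adj
    have hmem : ∀ w, (w = x.1.1.fst ∨ w = x.1.1.snd) → (w = y.1.1.fst ∨ w = y.1.1.snd) → False := by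
      rintro w (rfl | rfl) (h | h)
      · exact hy (h ▸ hx)
      · exact hy' (h ▸ hx)
      · exact hy (h ▸ hx')
      · exact hy' (h ▸ hx')
    by_cases hd : x.1.1.edge = y.1.1.edge
    · rcases (SimpleGraph.dart_edge_eq_iff _ _).1 hd with h | h
      · exact hmem _ (Or.inl rfl) (Or.inl (by rw [h]))
      · exact hmem _ (Or.inl rfl) (Or.inr (by rw [h]; rfl))
    · obtain ⟨w, -, h1, h2⟩ := exists_end_of_mem hd (c.segment_subset_edge x.2 hpx)
        (c.segment_subset_edge y.2 hpy)
      exact hmem w h1 h2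
  -- The open segment between closest points of the two disjoint compact pieces misses the drawing,
  -- so it stays in one face, which touches both pieces.
  obtain ⟨⟨p, q⟩, ⟨hp, hq⟩, hmin⟩ := ((hcomp (· ∈ K)).prod (hcomp (· ∉ K))).exists_isMinOn
    ((hne (· ∈ K) d₁ h₁).prod (hne (· ∉ K) d₂ h₂)) (f := fun x : ℂ × ℂ => dist x.1 x.2)
    (by fun_prop)
  simp only at hp hq
  have hmin' : ∀ p' ∈ X (· ∈ K), ∀ q' ∈ X (· ∉ K), dist p q ≤ dist p' q' := fun p' hp' q' hq' =>
    hmin (show (p', q') ∈ X (· ∈ K) ×ˢ X (· ∉ K) from ⟨hp', hq'⟩)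
  obtain ⟨x, hx, hpx⟩ := Set.mem_iUnion₂.1 hp
  obtain ⟨y, hy, hqy⟩ := Set.mem_iUnion₂.1 hq
  have hpq : p ≠ q := fun h => hdisj x y hx hy p hpx (h ▸ hqy)
  have hfree : ∀ t : ℝ, 0 < t → t < 1 → p + t * (q - p) ∉ c.system.support := by
    intro t h0 h1 hmem
    have hpos : 0 < dist p q := dist_pos.2 hpq
    rcases hcover hmem with h | h
    · have := hmin' _ h _ hq
      rw [dist_eq_norm, dist_eq_norm,
        show p + t * (q - p) - q = (1 - t : ℝ) * (p - q) by push_cast; ring, norm_mul,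
        Complex.norm_real, Real.norm_of_nonneg (by linarith), ← dist_eq_norm] at this
      nlinarith
    · have := hmin' _ hp _ h
      rw [dist_eq_norm, dist_eq_norm,
        show p - (p + t * (q - p)) = (t : ℝ) * (p - q) by ring, norm_mul,
        Complex.norm_real, Real.norm_of_nonneg h0.le, ← dist_eq_norm] at this
      nlinarith
  obtain ⟨x', hx', hfx⟩ := c.system.exists_face_of_ray hpx hfree
  obtain ⟨y', hy', hfy⟩ := c.system.exists_face_of_ray (u := p - q) hqy (by
    intro t h0 h1
    have := hfree (1 - t) (by linarith) (by linarith)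
    rwa [show p + (1 - t : ℝ) * (q - p) = q + t * (p - q) by push_cast; ring] at this)
  refine ⟨x'.1.1, y'.1.1, ?_, ?_, ?_⟩
  · by_contra h
    exact hdisj x x' hx h p hpx hx'
  · intro h
    exact hdisj y' y h hy q hy' hqy
  · rw [faceOf, faceOf, ← c.face_eq_face_first, ← c.face_eq_face_first]
    refine c.system.face_eq_face hfx ?_
    convert hfy using 1
    push_cast
    ring

end PlaneEmbedding.Corners

/-! ### Adjacency and connectedness from maximality -/

section MaximalPlanar

variable {V : Type*} [Fintype V] [DecidableEq V] {G : SimpleGraph V} [DecidableRel G.Adj]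

omit [Fintype V] [DecidableEq V] [DecidableRel G.Adj] in
-- The arc can be added as an edge, so maximality says that the edge is already there. Without
-- isolated vertices, avoiding the edges includes avoiding the vertices.
theorem IsMaximalPlanar.adj_of_arc (hG : IsMaximalPlanar G) (hiso : ∀ v, ∃ u, G.Adj v u)
    (E : PlaneEmbedding G) {u v : V} (huv : u ≠ v) {A : Set (ℝ × ℝ)}
    (hA : IsPolygonalArc (E.point u) (E.point v) A)
    (hedge : ∀ e ∈ G.edgeSet, A ∩ E.edge e ⊆ {E.point u, E.point v}) : G.Adj u v := by
  have hvert : ∀ w, E.point w ∈ A → w = u ∨ w = v := by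
    intro w hw
    obtain ⟨x, hx⟩ := hiso w
    have hwe : E.point w ∈ E.edge s(x, w) := (E.isArc x w hx.symm).right_mem
    rcases hedge s(x, w) hx.symm ⟨hw, hwe⟩ with h | h
    · exact Or.inl (E.point_injective h)
    · exact Or.inr (E.point_injective h)
  have := hG.2 (E.isPlanar_sup_edge hA hvert hedge) le_sup_left
  exact this (Or.inr (by rw [SimpleGraph.edge_adj]; exact ⟨Or.inl ⟨rfl, rfl⟩, huv⟩))

theorem IsPlanar.nonempty_planeRotation (hG : IsPlanar G) : Nonempty (PlaneRotation G) := by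
  obtain ⟨E⟩ := hG
  obtain ⟨c⟩ := E.nonempty_corners
  exact ⟨c.exists_planeRotation.choose⟩

/-- In a maximal planar graph, consecutive neighbours of a vertex are adjacent. -/
theorem IsMaximalPlanar.exists_planeRotation (hG : IsMaximalPlanar G)
    (hiso : ∀ v, ∃ u, G.Adj v u) :
    ∃ R : PlaneRotation G, ∀ d, (R.next d).snd ≠ d.snd → G.Adj d.snd (R.next d).snd := by
  obtain ⟨E⟩ := hG.1
  obtain ⟨c⟩ := E.nonempty_corners
  obtain ⟨R, hR⟩ := c.exists_planeRotation
  refine ⟨R, fun d hd => ?_⟩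
  obtain ⟨A, hA, hedge⟩ := c.exists_arc_of_faceOf_eq (hR d) (Or.inr rfl) (Or.inl rfl) hd.symm
  exact hG.adj_of_arc hiso E hd.symm hA hedge

omit [DecidableEq V] [DecidableRel G.Adj] in
/-- A maximal planar graph without isolated vertices is connected. -/
theorem IsMaximalPlanar.eq_univ_of_adj_closed (hG : IsMaximalPlanar G)
    (hiso : ∀ v, ∃ u, G.Adj v u) {K : Set V} (hne : K.Nonempty)
    (hK : ∀ u ∈ K, ∀ v, G.Adj u v → v ∈ K) : K = Set.univ := by
  by_contra hcon
  obtain ⟨v₂, h₂⟩ := (Set.ne_univ_iff_exists_notMem K).1 hcon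
  obtain ⟨v₁, h₁⟩ := hne
  obtain ⟨u₁, hu₁⟩ := hiso v₁
  obtain ⟨u₂, hu₂⟩ := hiso v₂
  obtain ⟨E⟩ := hG.1
  obtain ⟨c⟩ := E.nonempty_corners
  obtain ⟨d, d', hd, hd', hf⟩ := c.exists_faceOf_eq hK (d₁ := ⟨(v₁, u₁), hu₁⟩)
    (d₂ := ⟨(v₂, u₂), hu₂⟩) h₁ h₂
  have hne : d.fst ≠ d'.fst := fun h => hd' (h ▸ hd)
  obtain ⟨A, hA, hedge⟩ := c.exists_arc_of_faceOf_eq hf (Or.inl rfl) (Or.inl rfl) hne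
  exact hd' (hK _ hd _ (hG.adj_of_arc hiso E hne hA hedge))

end MaximalPlanar

/-! ### Triangular faces -/

theorem Equiv.Perm.SameCycle.induction {α : Type*} [Finite α] {f : Equiv.Perm α} {P : α → Prop}
    {x y : α} (h : f.SameCycle x y) (hx : P x) (hf : ∀ z, P z → P (f z)) : P y := by
  classical
  have := Fintype.ofFinite α
  obtain ⟨i, -, rfl⟩ := h.exists_pow_eq'
  induction i with
  | zero => exact hx
  | succ i ih =>
    rw [pow_succ', Equiv.Perm.mul_apply]
    exact hf _ (ih ((Equiv.Perm.sameCycle_pow_right).2 (Equiv.Perm.SameCycle.refl _ _)))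

namespace PlaneRotation

variable {V : Type*} [Fintype V] [DecidableEq V] {G : SimpleGraph V} [DecidableRel G.Adj]
  (R : PlaneRotation G)

/-- The next dart along the boundary of the face on the left. -/
def faceNext : Equiv.Perm G.Dart where
  toFun d := R.next.symm d.symm
  invFun d := (R.next d).symm
  left_inv d := by simp
  right_inv d := by simp

theorem next_faceNext (d : G.Dart) : R.next (R.faceNext d) = d.symm := by simp [faceNext]

theorem fst_faceNext (d : G.Dart) : (R.faceNext d).fst = d.snd := by
  rw [← R.fst_next, next_faceNext]; rfl

theorem eq_faceNext {α : Type*} {w : G.Dart → α} (hw : ∀ d, w d = w (R.next d).symm) (d : G.Dart) :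
    w (R.faceNext d) = w d := by
  rw [hw, next_faceNext, SimpleGraph.Dart.symm_symm]

theorem eq_add_of_potential {z w : G.Dart → ℝ} (hw : ∀ d, w d = w (R.next d).symm)
    (hz : ∀ d, w d - w d.symm = z d) (d : G.Dart) : w (R.next d) = w d + z (R.next d) := by
  rw [← hz, ← hw]; ring

/-- The unit circulation along a closed walk of length three. -/
def triangleFlow (d₁ d₂ d₃ x : G.Dart) : ℝ :=
  ((if x = d₁ then 1 else 0) - (if x = d₁.symm then 1 else 0)) +
  ((if x = d₂ then 1 else 0) - (if x = d₂.symm then 1 else 0)) +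
  ((if x = d₃ then 1 else 0) - (if x = d₃.symm then 1 else 0))

omit [Fintype V] [DecidableRel G.Adj] in
theorem triangleFlow_symm (d₁ d₂ d₃ x : G.Dart) :
    triangleFlow d₁ d₂ d₃ x.symm = -triangleFlow d₁ d₂ d₃ x := by
  have h : ∀ y : G.Dart, (x.symm = y ↔ x = y.symm) := fun y =>
    ⟨fun h => by rw [← h, SimpleGraph.Dart.symm_symm],
      fun h => by rw [h, SimpleGraph.Dart.symm_symm]⟩
  simp only [triangleFlow, h, SimpleGraph.Dart.symm_symm]
  ring

theorem sum_triangleFlow {d₁ d₂ d₃ : G.Dart} (h₁ : d₁.snd = d₂.fst) (h₂ : d₂.snd = d₃.fst)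
    (h₃ : d₃.snd = d₁.fst) (v : V) : ∑ x with x.fst = v, triangleFlow d₁ d₂ d₃ x = 0 := by
  have hs : ∀ d : G.Dart, d.symm.fst = d.snd := fun _ => rfl
  simp only [triangleFlow, Finset.sum_add_distrib, Finset.sum_sub_distrib, Finset.sum_ite_eq',
    Finset.mem_filter, Finset.mem_univ, true_and, hs, h₁, h₂, h₃]
  ring

/-- If consecutive neighbours are adjacent and there are no vertices of degree one, then all faces
are triangles. -/
theorem faceNext_faceNext_snd (hadj : ∀ d, (R.next d).snd ≠ d.snd → G.Adj d.snd (R.next d).snd)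
    (hdeg : ∀ d, R.next d ≠ d) (d : G.Dart) : (R.faceNext (R.faceNext d)).snd = d.fst := by
  by_contra hne
  set d₁ := R.faceNext d with hd₁
  set d₂ := R.faceNext d₁ with hd₂
  have n₁ : R.next d₁ = d.symm := R.next_faceNext d
  have n₂ : R.next d₂ = d₁.symm := R.next_faceNext d₁
  have f₁ : d₁.fst = d.snd := R.fst_faceNext d
  have f₂ : d₂.fst = d₁.snd := R.fst_faceNext d₁
  have eqsymm : ∀ x y : G.Dart, x.fst = y.snd → x.snd = y.fst → x = y.symm := fun x y h h' =>
    SimpleGraph.Dart.ext _ _ (Prod.ext h h')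
  have hac : d.fst ≠ d₁.snd := fun h =>
    hdeg d₁ (by rw [n₁]; exact (eqsymm d₁ d f₁ h.symm).symm)
  have hbe : d₂.snd ≠ d₁.fst := fun h =>
    hdeg d₂ (by rw [n₂]; exact (eqsymm d₂ d₁ f₂ h).symm)
  have adj₁ : G.Adj d₁.snd d.fst := by
    have := hadj d₁
    rw [n₁] at this
    exact this hac
  have adj₂ : G.Adj d₁.fst d₂.snd := by
    have := hadj d₂
    rw [n₂] at this
    exact (this hbe.symm).symm
  have hab : d.fst ≠ d.snd := d.adj.ne
  have hbc : d₁.fst ≠ d₁.snd := d₁.adj.ne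
  have hce : d₂.fst ≠ d₂.snd := d₂.adj.ne
  set d₃ : G.Dart := ⟨(d₁.snd, d.fst), adj₁⟩ with hd₃
  set y : G.Dart := ⟨(d₁.fst, d₂.snd), adj₂⟩ with hy
  -- Suppose the face runs a, b, c, e with e ≠ a. Then abc is a triangle and b is adjacent to e. The
  -- potential of the flow along abc tells its two sides apart; ce leaves c on one side and be
  -- leaves b on the other, yet they meet at e, off the triangle.
  obtain ⟨w, hw, hz⟩ := R.exists_potential (triangleFlow d d₁ d₃) (triangleFlow_symm d d₁ d₃)
    (sum_triangleFlow f₁.symm rfl rfl)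
  have zero : ∀ x : G.Dart, (x.fst ≠ d.fst ∨ x.snd ≠ d.snd) → (x.fst ≠ d.snd ∨ x.snd ≠ d.fst) →
      (x.fst ≠ d.snd ∨ x.snd ≠ d₁.snd) → (x.fst ≠ d₁.snd ∨ x.snd ≠ d.snd) →
      (x.fst ≠ d₁.snd ∨ x.snd ≠ d.fst) → (x.fst ≠ d.fst ∨ x.snd ≠ d₁.snd) →
      triangleFlow d d₁ d₃ x = 0 := by
    intro x h1 h2 h3 h4 h5 h6
    have k : ∀ y : G.Dart, (x.fst ≠ y.fst ∨ x.snd ≠ y.snd) → x ≠ y := by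
      rintro y h rfl; simp at h
    rw [triangleFlow, if_neg (k _ h1), if_neg (k _ h2), if_neg (k d₁ (by rwa [f₁])),
      if_neg (k d₁.symm (by change _ ∨ x.snd ≠ d₁.fst; rwa [f₁])), if_neg (k d₃ h5),
      if_neg (k d₃.symm h6)]
    ring
  have hstep := R.eq_add_of_potential hw hz
  have hwd₂ : w d₂ = w d₁ := R.eq_faceNext hw d₁
  have hflow : triangleFlow d d₁ d₃ d.symm = -1 := by
    have k : ∀ x y : G.Dart, (x.fst ≠ y.fst ∨ x.snd ≠ y.snd) → x ≠ y := by
      rintro x y h rfl; simp at h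
    rw [triangleFlow, if_neg (k d.symm d (Or.inl hab.symm)), if_pos rfl,
      if_neg (k d.symm d₁ (Or.inr hac)), if_neg (k d.symm d₁.symm (Or.inl (by
        change d.snd ≠ d₁.snd; rwa [← f₁]))),
      if_neg (k d.symm d₃ (Or.inl (by change d.snd ≠ d₁.snd; rwa [← f₁]))),
      if_neg (k d.symm d₃.symm (Or.inl hab.symm))]
    ring
  -- Rotating at b from bc, the very next dart is ba, where the potential drops by one; it stays
  -- there until bc is reached again.
  have hb : w y = w d₁ - 1 := by
    have := (R.sameCycle d₁ y rfl).induction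
      (P := fun x => x.fst = d₁.fst ∧ (x = d₁ ∨ w x = w d₁ - 1)) ⟨rfl, Or.inl rfl⟩ (by
        rintro x ⟨hx, h⟩
        refine ⟨(R.fst_next x).trans hx, ?_⟩
        by_cases hxd : x = d₁
        · right
          rw [hstep, hxd, n₁, hflow]; ring
        · have h := h.resolve_left hxd
          by_cases hn : R.next x = d₁
          · exact Or.inl hn
          · right
            have hfst : (R.next x).fst = d.snd := by rw [R.fst_next, hx, f₁]
            rw [hstep, h, zero]
            · ring
            · left; rw [hfst]; exact hab.symm
            · right
              intro hs
              apply hxd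
              apply R.next.injective
              rw [n₁]
              exact eqsymm _ _ hfst hs
            · right
              intro hs
              exact hn (SimpleGraph.Dart.ext _ _ (Prod.ext (hfst.trans f₁.symm) hs))
            · left; rw [hfst, ← f₁]; exact hbc
            · left; rw [hfst, ← f₁]; exact hbc
            · left; rw [hfst]; exact hab.symm)
    refine this.2.resolve_left fun h => ?_
    have hs : y.snd = d₁.snd := by rw [h]
    have : d₂.snd = d₁.snd := hs
    rw [← f₂] at this
    exact hce this.symm
  have hyz : triangleFlow d d₁ d₃ y = 0 := by
    apply zero
    · left; change d₁.fst ≠ _; rw [f₁]; exact hab.symm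
    · right; exact hne
    · right; change d₂.snd ≠ _; rw [← f₂]; exact hce.symm
    · left; exact hbc
    · left; exact hbc
    · left; change d₁.fst ≠ _; rw [f₁]; exact hab.symm
  have hd₂z : triangleFlow d d₁ d₃ d₂ = 0 := by
    have h1 : d₂.fst ≠ d.fst := by rw [f₂]; exact hac.symm
    have h2 : d₂.fst ≠ d.snd := by rw [f₂, ← f₁]; exact hbc.symm
    have h3 : d₂.snd ≠ d.snd := by rw [← f₁]; exact hbe
    exact zero _ (Or.inl h1) (Or.inl h2) (Or.inl h2) (Or.inr h3) (Or.inr hne) (Or.inl h1)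
  -- No edge of the triangle ends at e, so the potential is constant around e.
  have he : w y.symm = w d₂.symm := by
    have := (R.sameCycle d₂.symm y.symm rfl).induction
      (P := fun x => x.fst = d₂.snd ∧ w x = w d₂.symm) ⟨rfl, rfl⟩ (by
        rintro x ⟨hx, h⟩
        have hfst : (R.next x).fst = d₂.snd := (R.fst_next x).trans hx
        refine ⟨hfst, ?_⟩
        have h1 : (R.next x).fst ≠ d.fst := by rw [hfst]; exact hne
        have h2 : (R.next x).fst ≠ d.snd := by rw [hfst, ← f₁]; exact hbe
        have h3 : (R.next x).fst ≠ d₁.snd := by rw [hfst, ← f₂]; exact hce.symm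
        rw [hstep, h, zero _ (Or.inl h1) (Or.inl h2) (Or.inl h2) (Or.inl h3) (Or.inl h3)
          (Or.inl h1), add_zero])
    exact this.2
  have e1 := hz y
  have e2 := hz d₂
  rw [hyz] at e1
  rw [hd₂z] at e2
  linarith

theorem faceNext_cube (hadj : ∀ d, (R.next d).snd ≠ d.snd → G.Adj d.snd (R.next d).snd)
    (hdeg : ∀ d, R.next d ≠ d) (d : G.Dart) : R.faceNext (R.faceNext (R.faceNext d)) = d := by
  apply SimpleGraph.Dart.ext
  apply Prod.ext
  · exact (R.fst_faceNext _).trans (R.faceNext_faceNext_snd hadj hdeg d)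
  · exact (R.faceNext_faceNext_snd hadj hdeg (R.faceNext d)).trans (R.fst_faceNext d)

/-- The faces of a rotation system. -/
abbrev Face := Quotient (Equiv.Perm.SameCycle.setoid R.faceNext)

/-- Every face is an orbit of at most three darts. -/
theorem card_dart_le (h : ∀ d, R.faceNext (R.faceNext (R.faceNext d)) = d) [Fintype R.Face] :
    Fintype.card G.Dart ≤ 3 * Fintype.card R.Face := by
  classical
  have := Finset.card_le_mul_card_image (s := (Finset.univ : Finset G.Dart))
    (f := fun d => (Quotient.mk _ d : R.Face)) 3 ?_
  · refine this.trans (Nat.mul_le_mul_left _ (Finset.card_le_univ _))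
  · intro q _
    induction q using Quotient.inductionOn with
    | _ d =>
      refine (Finset.card_le_card (t := {d, R.faceNext d, R.faceNext (R.faceNext d)}) ?_).trans
        Finset.card_le_three
      intro x hx
      rw [Finset.mem_filter] at hx
      have hs : R.faceNext.SameCycle d x := (Quotient.exact hx.2).symm
      refine hs.induction (P := fun x => x ∈ ({d, R.faceNext d, R.faceNext (R.faceNext d)} :
        Finset G.Dart)) (by simp) ?_
      intro z hz
      simp only [Finset.mem_insert, Finset.mem_singleton] at hz ⊢
      rcases hz with rfl | rfl | rfl
      · simp
      · simp
      · simp [h]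

/-- A face orbit of length one would be a loop, and one of length two would give a vertex of degree
one. -/
theorem three_mul_card_face_le (hdeg : ∀ d, R.next d ≠ d) [Fintype R.Face] :
    3 * Fintype.card R.Face ≤ Fintype.card G.Dart := by
  classical
  have h1 : ∀ d, R.faceNext d ≠ d := fun d h => by
    have := R.fst_faceNext d
    rw [h] at this
    exact d.adj.ne this
  have h2 : ∀ d, R.faceNext (R.faceNext d) ≠ d := fun d h => by
    have e1 := R.fst_faceNext (R.faceNext d)
    rw [h] at e1
    have e2 := R.fst_faceNext d
    have : R.faceNext d = d.symm := SimpleGraph.Dart.ext _ _ (Prod.ext e2 e1.symm)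
    have h3 := R.next_faceNext d
    rw [this] at h3
    exact hdeg _ h3
  rw [← Finset.card_univ (α := G.Dart), Finset.card_eq_sum_card_fiberwise
    (f := fun d => (Quotient.mk _ d : R.Face)) (t := Finset.univ) (fun _ _ => Finset.mem_univ _),
    mul_comm, ← Finset.card_univ, ← smul_eq_mul, ← Finset.sum_const]
  refine Finset.sum_le_sum fun q _ => ?_
  induction q using Quotient.inductionOn with
  | _ d =>
    have hc : ({d, R.faceNext d, R.faceNext (R.faceNext d)} : Finset G.Dart).card = 3 :=
      Finset.card_eq_three.2 ⟨_, _, _, (h1 d).symm, (h2 d).symm, (h1 _).symm, rfl⟩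
    rw [← hc]
    apply Finset.card_le_card
    intro x hx
    rw [Finset.mem_filter]
    refine ⟨Finset.mem_univ _, Quotient.sound ?_⟩
    change R.faceNext.SameCycle x d
    simp only [Finset.mem_insert, Finset.mem_singleton] at hx
    rcases hx with rfl | rfl | rfl
    · exact Equiv.Perm.SameCycle.refl _ _
    · exact Equiv.Perm.sameCycle_apply_left.2 (Equiv.Perm.SameCycle.refl _ _)
    · exact Equiv.Perm.sameCycle_apply_left.2
        (Equiv.Perm.sameCycle_apply_left.2 (Equiv.Perm.SameCycle.refl _ _))

end PlaneRotation

/-! ### Euler's formula by linear algebra -/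

/-- Half of the darts orient all edges. -/
theorem SimpleGraph.exists_orientation {V : Type*} [Fintype V] [DecidableEq V]
    (G : SimpleGraph V) [DecidableRel G.Adj] :
    ∃ P : Finset G.Dart, (∀ d, d.symm ∈ P ↔ d ∉ P) ∧ 2 * P.card = Fintype.card G.Dart := by
  classical
  let _ : LinearOrder V := linearOrderOfSTO (WellOrderingRel : V → V → Prop)
  have key : ∃ P : Finset G.Dart, ∀ d, d.symm ∈ P ↔ d ∉ P := by
    refine ⟨Finset.univ.filter fun d => d.fst < d.snd, fun d => ?_⟩
    simp only [Finset.mem_filter, Finset.mem_univ, true_and]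
    change d.snd < d.fst ↔ _
    rw [not_lt]
    exact ⟨le_of_lt, fun h => lt_of_le_of_ne h d.adj.ne'⟩
  obtain ⟨P, hP⟩ := key
  refine ⟨P, hP, ?_⟩
  rw [two_mul, ← Finset.card_add_card_compl P]
  congr 1
  refine Finset.card_bij (fun d _ => d.symm) ?_ ?_ ?_
  · intro d hd
    rw [Finset.mem_compl, hP]
    exact fun h => h hd
  · intro d _ d' _ h
    rw [← d.symm_symm, h, d'.symm_symm]
  · intro d hd
    exact ⟨d.symm, (hP d).2 (Finset.mem_compl.1 hd), d.symm_symm⟩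

namespace PlaneRotation

variable {V : Type*} [Fintype V] [DecidableEq V] {G : SimpleGraph V} [DecidableRel G.Adj]
  (R : PlaneRotation G)

/-- The difference, across each edge, of a function on the faces. -/
def faceDiff (P : Finset G.Dart) : (R.Face → ℝ) →ₗ[ℝ] (P → ℝ) where
  toFun w d := w (Quotient.mk _ d.1) - w (Quotient.mk _ d.1.symm)
  map_add' w w' := by ext d; simp; ring
  map_smul' a w := by ext d; simp; ring

/-- The extension of a function on an orientation to an antisymmetric function on all darts. -/
def antisymmExtend (P : Finset G.Dart) (y : P → ℝ) (d : G.Dart) : ℝ :=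
  if h : d ∈ P then y ⟨d, h⟩ else if h : d.symm ∈ P then -y ⟨d.symm, h⟩ else 0

omit [Fintype V] [DecidableRel G.Adj] in
theorem antisymmExtend_symm {P : Finset G.Dart} (hP : ∀ d, d.symm ∈ P ↔ d ∉ P) (y : P → ℝ)
    (d : G.Dart) : antisymmExtend P y d.symm = -antisymmExtend P y d := by
  by_cases h : d ∈ P
  · have h' : d.symm ∉ P := fun h' => (hP d).1 h' h
    simp [antisymmExtend, h, h']
  · have h' : d.symm ∈ P := (hP d).2 h
    simp [antisymmExtend, h, h']

/-- The divergence of a flow. -/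
def divergence (P : Finset G.Dart) : (P → ℝ) →ₗ[ℝ] (V → ℝ) where
  toFun y v := ∑ d with d.fst = v, antisymmExtend P y d
  map_add' y y' := by
    ext v
    simp only [Pi.add_apply, ← Finset.sum_add_distrib]
    refine Finset.sum_congr rfl fun d _ => ?_
    simp only [antisymmExtend]
    split_ifs <;> simp; ring
  map_smul' a y := by
    ext v
    simp only [Pi.smul_apply, smul_eq_mul, Finset.mul_sum, RingHom.id_apply]
    refine Finset.sum_congr rfl fun d _ => ?_
    simp only [antisymmExtend]
    split_ifs <;> simp

/-- The gradient of a function on the vertices. -/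
def gradient (P : Finset G.Dart) : (V → ℝ) →ₗ[ℝ] (P → ℝ) where
  toFun g d := g d.1.snd - g d.1.fst
  map_add' w w' := by ext d; simp; ring
  map_smul' a w := by ext d; simp; ring

theorem ker_divergence_le {P : Finset G.Dart} (hP : ∀ d, d.symm ∈ P ↔ d ∉ P) :
    LinearMap.ker (divergence P) ≤ LinearMap.range (R.faceDiff P) := by
  intro y hy
  obtain ⟨w, hw, hz⟩ := R.exists_potential (antisymmExtend P y) (antisymmExtend_symm hP y)
    (fun v => congrFun (LinearMap.mem_ker.1 hy) v)
  refine ⟨Quotient.lift w ?_, ?_⟩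
  · intro d d' (hdd : R.faceNext.SameCycle d d')
    exact hdd.induction (P := fun x => w d = w x) rfl fun z h => h.trans (R.eq_faceNext hw z).symm
  · ext d
    change w d.1 - w d.1.symm = y d
    rw [hz, antisymmExtend, dif_pos d.2]

omit [DecidableRel G.Adj] in
-- The two darts of an edge cancel in the total divergence, so the constant function 1 is not a
-- divergence.
theorem range_divergence_lt [DecidableRel G.Adj] [Nonempty V] {P : Finset G.Dart}
    (hP : ∀ d, d.symm ∈ P ↔ d ∉ P) :
    Module.finrank ℝ (LinearMap.range (divergence P)) < Fintype.card V := by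
  rw [← Module.finrank_fintype_fun_eq_card (R := ℝ) (η := V)]
  apply Submodule.finrank_lt
  intro htop
  obtain ⟨y, hy⟩ : (fun _ => 1 : V → ℝ) ∈ LinearMap.range (divergence P) := by rw [htop]; trivial
  have h1 : ∑ v, divergence P y v = 0 := by
    change ∑ v, ∑ d with d.fst = v, antisymmExtend P y d = 0
    rw [Finset.sum_fiberwise]
    have : ∑ d, antisymmExtend P y d = -∑ d, antisymmExtend P y d := by
      rw [← Finset.sum_neg_distrib, ← Equiv.sum_comp (⟨SimpleGraph.Dart.symm,
        SimpleGraph.Dart.symm, SimpleGraph.Dart.symm_symm, SimpleGraph.Dart.symm_symm⟩ :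
          G.Dart ≃ G.Dart)]
      exact Finset.sum_congr rfl fun d _ => antisymmExtend_symm hP y d
    linarith
  rw [hy] at h1
  simp at h1

/-- Euler's inequality for plane rotation systems. -/
theorem card_dart_add_le [Nonempty G.Dart] (hdeg : ∀ d, R.next d ≠ d) :
    Fintype.card G.Dart + 12 ≤ 6 * Fintype.card V := by
  classical
  obtain ⟨P, hP, hcard⟩ := G.exists_orientation
  have : Nonempty V := ⟨(Classical.arbitrary G.Dart).fst⟩
  have h1 := Submodule.finrank_mono (R.ker_divergence_le hP)
  have h2 := range_divergence_lt hP
  have h3 := LinearMap.finrank_range_add_finrank_ker (divergence P)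
  have h4 := LinearMap.finrank_range_add_finrank_ker (R.faceDiff P)
  rw [Module.finrank_fintype_fun_eq_card, Fintype.card_coe] at h3
  rw [Module.finrank_fintype_fun_eq_card] at h4
  have h5 : 0 < Module.finrank ℝ (LinearMap.ker (R.faceDiff P)) := by
    apply Module.finrank_pos_iff_exists_ne_zero.2
    refine ⟨⟨fun _ => 1, ?_⟩, ?_⟩
    · rw [LinearMap.mem_ker]; ext d; simp [faceDiff]
    · intro h
      have := congrFun (congrArg Subtype.val h) (Quotient.mk _ (Classical.arbitrary G.Dart))
      simp at this
  have h6 := R.three_mul_card_face_le hdeg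
  -- The dimensions give e - v + 1 ≤ f - 1; combine with 3f ≤ 2e.
  omega

theorem face_next_symm (d : G.Dart) :
    (Quotient.mk _ (R.next d).symm : R.Face) = Quotient.mk _ d := by
  refine Quotient.sound (?_ : R.faceNext.SameCycle (R.next d).symm d)
  have h : R.faceNext (R.next d).symm = d := R.faceNext.apply_symm_apply d
  have := Equiv.Perm.sameCycle_apply_right.2
    (Equiv.Perm.SameCycle.refl R.faceNext (R.next d).symm)
  rwa [h] at this

/-- Gradients are orthogonal to face differences. Written over all darts, the head terms become tail
terms after reversing and then rotating each dart, since the face on the left of `d` is also on the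
left of `(next d).symm`. -/
theorem sum_gradient_mul_faceDiff {P : Finset G.Dart} (hP : ∀ d, d.symm ∈ P ↔ d ∉ P)
    (g : V → ℝ) (w : R.Face → ℝ) : ∑ d, gradient P g d * R.faceDiff P w d = 0 := by
  set q : G.Dart → ℝ := fun d => w (Quotient.mk _ d) with hq
  have hqn : ∀ d, q (R.next d).symm = q d := fun d => congrArg w (R.face_next_symm d)
  let e : G.Dart ≃ G.Dart := ⟨SimpleGraph.Dart.symm, SimpleGraph.Dart.symm,
    SimpleGraph.Dart.symm_symm, SimpleGraph.Dart.symm_symm⟩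
  have h1 : ∑ d, gradient P g d * R.faceDiff P w d = ∑ d, (g d.snd - g d.fst) * q d := by
    have h2 : ∑ d, gradient P g d * R.faceDiff P w d =
        ∑ d ∈ P, (g d.snd - g d.fst) * (q d - q d.symm) :=
      Finset.sum_coe_sort P fun d => (g d.snd - g d.fst) * (q d - q d.symm)
    have h3 : ∑ d ∈ Pᶜ, (g d.snd - g d.fst) * q d = ∑ d ∈ P, (g d.fst - g d.snd) * q d.symm := by
      symm
      refine Finset.sum_bij (fun d _ => d.symm) ?_ ?_ ?_ ?_
      · intro d hd
        rw [Finset.mem_compl, hP]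
        exact fun h => h hd
      · intro d _ d' _ h
        rw [← d.symm_symm, h, d'.symm_symm]
      · intro d hd
        exact ⟨d.symm, (hP d).2 (Finset.mem_compl.1 hd), d.symm_symm⟩
      · intro d _; rfl
    rw [h2, ← Finset.sum_add_sum_compl P, h3, ← Finset.sum_add_distrib]
    refine Finset.sum_congr rfl fun d _ => ?_
    ring
  rw [h1]
  simp only [sub_mul, Finset.sum_sub_distrib]
  rw [sub_eq_zero, ← Equiv.sum_comp e, ← Equiv.sum_comp R.next]
  refine Finset.sum_congr rfl fun d _ => ?_
  change g (R.next d).fst * q (R.next d).symm = _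
  rw [R.fst_next, hqn]

theorem _root_.LinearMap.finrank_ker_le_one {ι M : Type*} [Nonempty ι] [AddCommGroup M]
    [Module ℝ M] (f : (ι → ℝ) →ₗ[ℝ] M) (h : ∀ x, f x = 0 → ∀ i j, x i = x j) :
    Module.finrank ℝ (LinearMap.ker f) ≤ 1 := by
  let i : ι := Classical.arbitrary ι
  rw [← Module.finrank_self ℝ]
  refine LinearMap.finrank_le_finrank_of_injective
    (f := (LinearMap.proj i).comp (LinearMap.ker f).subtype) ?_
  rw [← LinearMap.ker_eq_bot, LinearMap.ker_eq_bot']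
  rintro ⟨x, hx⟩ (h0 : x i = 0)
  apply Subtype.ext
  funext j
  change x j = 0
  rw [h x (LinearMap.mem_ker.1 hx) j i, h0]

/-- The reverse of Euler's inequality for connected rotation systems with triangular faces. -/
theorem le_card_dart_add [Nonempty G.Dart]
    (h : ∀ d, R.faceNext (R.faceNext (R.faceNext d)) = d)
    (hconn : ∀ K : Set V, K.Nonempty → (∀ u ∈ K, ∀ v, G.Adj u v → v ∈ K) → K = Set.univ) :
    6 * Fintype.card V ≤ Fintype.card G.Dart + 12 := by
  classical
  obtain ⟨P, hP, hcard⟩ := G.exists_orientation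
  let d₀ : G.Dart := Classical.arbitrary G.Dart
  have : Nonempty V := ⟨d₀.fst⟩
  have : Nonempty R.Face := ⟨Quotient.mk _ d₀⟩
  have h1 := R.card_dart_le h
  have h2 := LinearMap.finrank_range_add_finrank_ker (gradient P)
  have h3 := LinearMap.finrank_range_add_finrank_ker (R.faceDiff P)
  rw [Module.finrank_fintype_fun_eq_card] at h2 h3
  have h4 : Module.finrank ℝ (LinearMap.ker (gradient P)) ≤ 1 := by
    refine (gradient P).finrank_ker_le_one fun g hg u v => ?_
    have hadj : ∀ d : G.Dart, g d.snd = g d.fst := by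
      have hmem : ∀ d ∈ P, g d.snd = g d.fst := fun d hd =>
        sub_eq_zero.1 (congrFun hg ⟨d, hd⟩)
      intro d
      by_cases hd : d ∈ P
      · exact hmem d hd
      · exact (hmem d.symm ((hP d).2 hd)).symm
    have huniv := hconn {x | g x = g v} ⟨v, rfl⟩ fun x hx y hxy =>
      (hadj ⟨(x, y), hxy⟩).trans hx
    have hu : u ∈ {x | g x = g v} := huniv ▸ Set.mem_univ u
    exact hu
  have h5 : Module.finrank ℝ (LinearMap.ker (R.faceDiff P)) ≤ 1 := by
    refine (R.faceDiff P).finrank_ker_le_one fun w hw => ?_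
    set q : G.Dart → ℝ := fun d => w (Quotient.mk _ d) with hq
    have hsymm : ∀ d, q d.symm = q d := by
      have hmem : ∀ d ∈ P, q d.symm = q d := fun d hd =>
        (sub_eq_zero.1 (congrFun hw ⟨d, hd⟩)).symm
      intro d
      by_cases hd : d ∈ P
      · exact hmem d hd
      · rw [← hmem d.symm ((hP d).2 hd), SimpleGraph.Dart.symm_symm]
    have hnext : ∀ d, q (R.next d) = q d := by
      intro d
      rw [← hsymm]
      exact congrArg w (R.face_next_symm d)
    have hfst : ∀ d d' : G.Dart, d.fst = d'.fst → q d' = q d := fun d d' hdd =>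
      (R.sameCycle d d' hdd).induction (P := fun x => q x = q d) rfl
        fun z hz => (hnext z).trans hz
    have huniv := hconn {v | ∀ d : G.Dart, d.fst = v → q d = q d₀}
      ⟨d₀.fst, fun d hd => hfst d₀ d hd.symm⟩ (by
        intro u hu v huv d hd
        rw [hfst (⟨(u, v), huv⟩ : G.Dart).symm d hd.symm, hsymm]
        exact hu _ rfl)
    have hall : ∀ d, q d = q d₀ := by
      intro d
      have hd : d.fst ∈ {v | ∀ d : G.Dart, d.fst = v → q d = q d₀} := huniv ▸ Set.mem_univ _
      exact hd d rfl
    intro i j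
    induction i using Quotient.inductionOn with
    | _ d =>
      induction j using Quotient.inductionOn with
      | _ d' => exact (hall d).trans (hall d').symm
  have h6 : Disjoint (LinearMap.range (gradient P)) (LinearMap.range (R.faceDiff P)) := by
    rw [Submodule.disjoint_def]
    rintro y ⟨g, hg⟩ ⟨w, hw⟩
    have hsum := R.sum_gradient_mul_faceDiff hP g w
    rw [hg, hw] at hsum
    funext d
    exact mul_self_eq_zero.1
      ((Finset.sum_eq_zero_iff_of_nonneg fun d _ => mul_self_nonneg (y d)).1 hsum d
        (Finset.mem_univ d))
  have h7 := Submodule.finrank_add_finrank_le_of_disjoint h6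
  rw [Module.finrank_fintype_fun_eq_card, Fintype.card_coe] at h7
  -- Orthogonality gives (v - 1) + (f - 1) ≤ e; combine with 2e ≤ 3f.
  omega

end PlaneRotation

/-! ### Counting edges in planar and maximal planar graphs -/

/-- Induced subgraphs of planar graphs are planar. -/
theorem IsPlanar.induce {V : Type*} {G : SimpleGraph V} (hG : IsPlanar G) (S : Set V) :
    IsPlanar (G.induce S) := by
  obtain ⟨E⟩ := hG
  have hmap : ∀ e ∈ (G.induce S).edgeSet, e.map Subtype.val ∈ G.edgeSet := by
    intro e he
    induction e with
    | _ x y => exact he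
  refine ⟨⟨fun v => E.point v, fun e => E.edge (e.map Subtype.val), ?_, ?_, ?_, ?_⟩⟩
  · exact E.point_injective.comp Subtype.val_injective
  · intro u v huv
    exact E.isArc u v huv
  · intro e he w hw
    have := E.vertex_on_edge _ (hmap e he) w hw
    obtain ⟨w', hw', h⟩ := Sym2.mem_map.1 this
    rwa [← Subtype.val_injective h]
  · intro e he e' he' hne x hx
    obtain ⟨w, ⟨h1, h2⟩, rfl⟩ := E.edge_inter_edge _ (hmap e he) _ (hmap e' he')
      (fun h => hne (Sym2.map.injective Subtype.val_injective h)) hx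
    obtain ⟨w₁, hw₁, rfl⟩ := Sym2.mem_map.1 h1
    obtain ⟨w₂, hw₂, h⟩ := Sym2.mem_map.1 h2
    obtain rfl := Subtype.val_injective h
    exact ⟨w₂, ⟨hw₁, hw₂⟩, rfl⟩

namespace SimpleGraph

variable {V : Type*} [DecidableEq V] (G : SimpleGraph V) [DecidableRel G.Adj]

/-- The number of darts with both ends in `S`. -/
def dartCount (S : Finset V) : ℕ := ((S ×ˢ S).filter fun p => G.Adj p.1 p.2).card

/-- Inclusion and exclusion: with no edge between A \ B and B \ A, each dart in the union lies in A
or in B. -/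
theorem dartCount_union_add_inter {A B : Finset V}
    (h : ∀ x ∈ A, x ∉ B → ∀ y ∈ B, y ∉ A → ¬ G.Adj x y) :
    G.dartCount (A ∪ B) + G.dartCount (A ∩ B) = G.dartCount A + G.dartCount B := by
  have key := Finset.card_union_add_card_inter
    ((A ×ˢ A).filter fun p => G.Adj p.1 p.2) ((B ×ˢ B).filter fun p => G.Adj p.1 p.2)
  rw [dartCount, dartCount, dartCount, dartCount, ← key]
  congr 2
  · ext ⟨x, y⟩
    simp only [Finset.mem_filter, Finset.mem_product, Finset.mem_union]
    have h1 := h x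
    have h2 := fun a b c d (e : G.Adj x y) => h y a b x c d e.symm
    have h3 := fun a b c d => h x a b y c d
    tauto
  · ext ⟨x, y⟩
    simp only [Finset.mem_filter, Finset.mem_product, Finset.mem_inter]
    tauto

omit [DecidableEq V] in
theorem dartCount_le (S : Finset V) : G.dartCount S ≤ S.card * S.card - S.card := by
  classical
  rw [← Finset.offDiag_card]
  apply Finset.card_le_card
  rintro ⟨x, y⟩ hxy
  simp only [Finset.mem_filter, Finset.mem_product, Finset.mem_offDiag] at hxy ⊢
  exact ⟨hxy.1.1, hxy.1.2, hxy.2.ne⟩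

omit [DecidableEq V] in
theorem dartCount_of_isClique {S : Finset V} (h : G.IsClique S) :
    G.dartCount S = S.card * S.card - S.card := by
  classical
  rw [← Finset.offDiag_card, dartCount]
  congr 1
  ext ⟨x, y⟩
  simp only [Finset.mem_filter, Finset.mem_product, Finset.mem_offDiag]
  exact ⟨fun hxy => ⟨hxy.1.1, hxy.1.2, hxy.2.ne⟩,
    fun hxy => ⟨⟨hxy.1, hxy.2.1⟩, h hxy.1 hxy.2.1 hxy.2.2⟩⟩

omit [DecidableEq V] in
theorem card_dart_eq_dartCount [Fintype V] : Fintype.card G.Dart = G.dartCount Finset.univ := by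
  rw [← Finset.card_univ]
  refine Finset.card_bij (fun d _ => (d.fst, d.snd)) ?_ ?_ ?_
  · intro d _
    simp [d.adj]
  · intro d _ d' _ h
    exact Dart.ext _ _ h
  · rintro ⟨x, y⟩ hxy
    exact ⟨⟨(x, y), (Finset.mem_filter.1 hxy).2⟩, Finset.mem_univ _, rfl⟩

omit [DecidableEq V] in
theorem dartCount_induce (S : Finset V) [DecidableRel (G.induce (S : Set V)).Adj] :
    (G.induce (S : Set V)).dartCount Finset.univ = G.dartCount S := by
  refine Finset.card_bij (fun p _ => (p.1.1, p.2.1)) ?_ ?_ ?_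
  · rintro ⟨x, y⟩ h
    have := (Finset.mem_filter.1 h).2
    exact Finset.mem_filter.2 ⟨Finset.mem_product.2 ⟨x.2, y.2⟩, this⟩
  · rintro ⟨x, y⟩ _ ⟨x', y'⟩ _ h
    simp only [Prod.mk.injEq] at h
    exact Prod.ext (Subtype.ext h.1) (Subtype.ext h.2)
  · rintro ⟨x, y⟩ h
    obtain ⟨h1, h2⟩ := Finset.mem_filter.1 h
    obtain ⟨hx, hy⟩ := Finset.mem_product.1 h1
    exact ⟨(⟨x, hx⟩, ⟨y, hy⟩), Finset.mem_filter.2 ⟨Finset.mem_univ _, h2⟩, rfl⟩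

theorem dartCount_erase_le {S : Finset V} (v : V) :
    G.dartCount S ≤ G.dartCount (S.erase v) + 2 * (S.filter (G.Adj v)).card := by
  have h : ((S ×ˢ S).filter fun p => G.Adj p.1 p.2) ⊆
      (((S.erase v) ×ˢ (S.erase v)).filter fun p => G.Adj p.1 p.2) ∪
        ((S.filter (G.Adj v)).image (fun x => (v, x)) ∪
          (S.filter (G.Adj v)).image (fun x => (x, v))) := by
    rintro ⟨x, y⟩ hxy
    simp only [Finset.mem_filter, Finset.mem_product, Finset.mem_union, Finset.mem_image,
      Finset.mem_erase, Prod.mk.injEq] at hxy ⊢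
    obtain ⟨⟨hx, hy⟩, hadj⟩ := hxy
    by_cases h1 : x = v
    · subst h1
      exact Or.inr (Or.inl ⟨y, ⟨hy, hadj⟩, rfl, rfl⟩)
    · by_cases h2 : y = v
      · subst h2
        exact Or.inr (Or.inr ⟨x, ⟨hx, hadj.symm⟩, rfl, rfl⟩)
      · exact Or.inl ⟨⟨⟨h1, hx⟩, ⟨h2, hy⟩⟩, hadj⟩
  refine (Finset.card_le_card h).trans ((Finset.card_union_le _ _).trans ?_)
  refine Nat.add_le_add_left ((Finset.card_union_le _ _).trans ?_) _
  rw [two_mul]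
  exact Nat.add_le_add Finset.card_image_le Finset.card_image_le

end SimpleGraph

section

variable {V : Type*} [DecidableEq V] {G : SimpleGraph V} [DecidableRel G.Adj]

theorem PlaneRotation.next_ne [Fintype V] (R : PlaneRotation G)
    (h : ∀ v u, G.Adj v u → ∃ u', G.Adj v u' ∧ u' ≠ u) (d : G.Dart) : R.next d ≠ d := by
  intro hd
  obtain ⟨u', hu', hne⟩ := h _ _ d.adj
  have := (R.sameCycle d ⟨(d.fst, u'), hu'⟩ rfl).induction (P := fun x => x = d) rfl
    (by rintro _ rfl; exact hd)
  exact hne (congrArg (fun x : G.Dart => x.snd) this)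

/-- A planar graph with `n ≥ 3` vertices has at most `3n - 6` edges. -/
theorem IsPlanar.dartCount_add_le (hG : IsPlanar G) (S : Finset V) (hS : 3 ≤ S.card) :
    G.dartCount S + 12 ≤ 6 * S.card := by
  classical
  induction hn : S.card using Nat.strong_induction_on generalizing S with
  | _ n ih =>
  subst hn
  rcases Nat.eq_or_lt_of_le hS with h3 | h4
  · have := G.dartCount_le S
    rw [← h3] at this ⊢
    omega
  -- Deleting a vertex of degree at most three loses at most six darts, as the bound allows.
  -- Otherwise no vertex has degree one, and Euler's inequality applies to the induced graph.
  by_cases hv : ∃ v ∈ S, (S.filter (G.Adj v)).card ≤ 3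
  · obtain ⟨v, hvS, hv⟩ := hv
    have hc := Finset.card_erase_of_mem hvS
    have h1 := ih (S.erase v).card (by omega) (S.erase v) (by omega) rfl
    have h2 := G.dartCount_erase_le (S := S) v
    omega
  · push Not at hv
    have hpl := hG.induce (S : Set V)
    obtain ⟨R⟩ := hpl.nonempty_planeRotation
    have hnbr : ∀ v ∈ S, ∀ u, ∃ u' ∈ S, G.Adj v u' ∧ u' ≠ u := by
      intro v hvS u
      obtain ⟨u', hu', hne⟩ := Finset.exists_mem_ne
        (s := S.filter (G.Adj v)) (by have := hv v hvS; omega) u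
      exact ⟨u', (Finset.mem_filter.1 hu').1, (Finset.mem_filter.1 hu').2, hne⟩
    obtain ⟨v, hvS⟩ : S.Nonempty := Finset.card_pos.1 (by omega)
    obtain ⟨u, huS, hvu, -⟩ := hnbr v hvS v
    have : Nonempty (G.induce (S : Set V)).Dart := ⟨⟨(⟨v, hvS⟩, ⟨u, huS⟩), hvu⟩⟩
    have h1 := R.card_dart_add_le (R.next_ne (fun v u _ => by
      obtain ⟨u', hu', h1, h2⟩ := hnbr v v.2 u
      exact ⟨⟨u', hu'⟩, h1, fun h => h2 (congrArg Subtype.val h)⟩))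
    rw [SimpleGraph.card_dart_eq_dartCount, G.dartCount_induce S] at h1
    simpa using h1

variable [Fintype V]

omit [DecidableRel G.Adj] [Fintype V] in
theorem exists_adj_ne_of_mem_clique (hK : ∀ v, ∃ k, G.IsNClique 3 k ∧ v ∈ k) (v u : V) :
    ∃ u', G.Adj v u' ∧ u' ≠ u := by
  obtain ⟨k, hk, hv⟩ := hK v
  obtain ⟨u', hu', hne⟩ := Finset.exists_mem_ne (s := k.erase v)
    (by rw [Finset.card_erase_of_mem hv, hk.card_eq]; norm_num) u
  obtain ⟨h1, h2⟩ := Finset.mem_erase.1 hu'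
  exact ⟨u', hk.isClique hv h2 h1.symm, hne⟩

/-- A maximal planar graph all of whose vertices lie in triangles has at least `3n - 6` edges. -/
theorem IsMaximalPlanar.le_dartCount_add [Nonempty V] (hG : IsMaximalPlanar G)
    (hK : ∀ v, ∃ k, G.IsNClique 3 k ∧ v ∈ k) :
    6 * Fintype.card V ≤ G.dartCount Finset.univ + 12 := by
  have hnbr := exists_adj_ne_of_mem_clique hK
  have hiso : ∀ v, ∃ u, G.Adj v u := fun v => (hnbr v v).imp fun _ h => h.1
  obtain ⟨R, hR⟩ := hG.exists_planeRotation hiso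
  have hdeg := R.next_ne fun v u _ => hnbr v u
  obtain ⟨u, hu⟩ := hiso (Classical.arbitrary V)
  have : Nonempty G.Dart := ⟨⟨(_, u), hu⟩⟩
  rw [← G.card_dart_eq_dartCount]
  exact R.le_card_dart_add (R.faceNext_cube hR hdeg) fun K hne hc =>
    hG.eq_univ_of_adj_closed hiso hne hc

end

/-! ### Parts of the graph left by a triangle -/

/-- `U` is a union of components of the graph with `k` removed. -/
structure IsPart {V : Type*} (G : SimpleGraph V) (k : Finset V) (U : Set V) : Prop where
  notMem : ∀ u ∈ U, u ∉ k
  closed : ∀ u ∈ U, ∀ v, G.Adj u v → v ∉ k → v ∈ U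

namespace IsPart

variable {V : Type*} {G : SimpleGraph V} {k : Finset V} {U W : Set V}

theorem inter (hU : IsPart G k U) (hW : IsPart G k W) : IsPart G k (U ∩ W) :=
  ⟨fun u hu => hU.notMem u hu.1, fun u hu v huv hv =>
    ⟨hU.closed u hu.1 v huv hv, hW.closed u hu.2 v huv hv⟩⟩

theorem diff (hU : IsPart G k U) (hW : IsPart G k W) : IsPart G k (U \ W) :=
  ⟨fun u hu => hU.notMem u hu.1, fun u hu v huv hv =>
    ⟨hU.closed u hu.1 v huv hv, fun h => hu.2 (hW.closed v h u huv.symm (hU.notMem u hu.1))⟩⟩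

theorem dividesInto (hU : IsPart G k U) : DividesInto G (k : Set V) U (Uᶜ \ k) where
  union_eq := by
    ext v
    have := hU.notMem v
    simp only [Set.mem_union, Set.mem_sdiff, Set.mem_compl_iff, Finset.mem_coe]
    tauto
  disjoint := Set.disjoint_left.2 fun v hv h => h.1 hv
  meets := by
    intro i hi j hj p
    by_contra hcon
    push Not at hcon
    have : ∀ {i j : V} (p : G.Walk i j), i ∈ U → (∀ v ∈ p.support, v ∉ (k : Set V)) → j ∈ U := by
      intro i j p
      induction p with
      | nil => exact fun h _ => h
      | cons h p ih =>
        intro hi hp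
        simp only [SimpleGraph.Walk.support_cons, List.mem_cons] at hp
        exact ih (hU.closed _ hi _ h (hp _ (Or.inr p.start_mem_support)))
          fun v hv => hp v (Or.inr hv)
    exact hj.1 (this p hi hcon)

end IsPart

/-- Walks consisting of one edge suffice. -/
theorem DividesInto.isPart {V : Type*} {G : SimpleGraph V} {k : Finset V} {S T : Set V}
    (h : DividesInto G (k : Set V) S T) : IsPart G k S where
  notMem u hu := by
    have : u ∈ (k : Set V)ᶜ := h.union_eq ▸ Or.inl hu
    exact this
  closed u hu v huv hv := by
    have : v ∈ S ∪ T := h.union_eq ▸ hv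
    refine this.resolve_right fun hvT => ?_
    obtain ⟨x, hx, hxk⟩ := h.meets u hu v hvT huv.toWalk
    have hu' : u ∈ (k : Set V)ᶜ := h.union_eq ▸ Or.inl hu
    simp only [SimpleGraph.Adj.toWalk, SimpleGraph.Walk.support_cons, SimpleGraph.Walk.support_nil,
      List.mem_cons, List.not_mem_nil, or_false] at hx
    rcases hx with rfl | rfl
    · exact hu' hxk
    · exact hv hxk

theorem DividesInto.symm {V : Type*} {G : SimpleGraph V} {C S T : Set V}
    (h : DividesInto G C S T) : DividesInto G C T S where
  union_eq := by rw [Set.union_comm, h.union_eq]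
  disjoint := h.disjoint.symm
  meets i hi j hj p := by
    obtain ⟨v, hv, hvC⟩ := h.meets j hj i hi p.reverse
    exact ⟨v, by simpa using hv, hvC⟩

section

variable {V : Type*} [Fintype V] {G : SimpleGraph V}

/-- In a maximal planar graph, every vertex of a triangle is adjacent to every part. -/
theorem IsMaximalPlanar.exists_adj_of_isPart [Nonempty V] (hG : IsMaximalPlanar G)
    (hK : ∀ v, ∃ k, G.IsNClique 3 k ∧ v ∈ k) {k : Finset V} (hk : G.IsNClique 3 k) {U : Set V}
    (hU : IsPart G k U) (hne : U.Nonempty) {a : V} (ha : a ∈ k) : ∃ u ∈ U, G.Adj a u := by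
  classical
  by_contra hcon
  push Not at hcon
  set U' := U.toFinset with hU'
  have hmem : ∀ x, x ∈ U' ↔ x ∈ U := fun x => Set.mem_toFinset
  have hpos : 0 < U'.card := Finset.card_pos.2 (hne.imp fun x hx => (hmem x).2 hx)
  have hke : (k.erase a).card = 2 := by rw [Finset.card_erase_of_mem ha, hk.card_eq]
  have hdisj : Disjoint U' (k.erase a) := Finset.disjoint_left.2 fun x hx hxk =>
    hU.notMem x ((hmem x).1 hx) (Finset.mem_of_mem_erase hxk)
  have hA : (U' ∪ k.erase a).card = U'.card + 2 := by rw [Finset.card_union_of_disjoint hdisj, hke]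
  have hkB : k ⊆ U'ᶜ := fun x hx => Finset.mem_compl.2 fun h => hU.notMem x ((hmem x).1 h) hx
  have hB := Finset.card_le_card hkB
  rw [hk.card_eq] at hB
  have hBc := Finset.card_add_card_compl U'
  have h1 := hG.1.dartCount_add_le (U' ∪ k.erase a) (by omega)
  have h2 := hG.1.dartCount_add_le U'ᶜ hB
  have h3 := hG.le_dartCount_add hK
  -- The two sets overlap in the edge opposite `a`, which has two darts. The planar bounds then
  -- leave at most 6n - 14 darts in G, but it has at least 6n - 12.
  have h4 := G.dartCount_union_add_inter (A := U' ∪ k.erase a) (B := U'ᶜ) (by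
    intro x hx hxB y hy hyA hxy
    rw [Finset.mem_compl, not_not, hmem] at hxB
    rw [Finset.mem_union, not_or] at hyA
    have hyk : y ∈ k := by
      by_contra hyk
      exact hyA.1 ((hmem y).2 (hU.closed x hxB y hxy hyk))
    have hya : y = a := by
      by_contra hya
      exact hyA.2 (Finset.mem_erase.2 ⟨hya, hyk⟩)
    subst hya
    exact hcon x hxB hxy.symm)
  have h5 : (U' ∪ k.erase a) ∪ U'ᶜ = Finset.univ := by
    ext x
    simp only [Finset.mem_union, Finset.mem_compl, Finset.mem_univ, iff_true]
    tauto
  have h6 : (U' ∪ k.erase a) ∩ U'ᶜ = k.erase a := by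
    ext x
    have : x ∈ U' → x ∉ k.erase a := fun h => Finset.disjoint_left.1 hdisj h
    simp only [Finset.mem_inter, Finset.mem_union, Finset.mem_compl]
    tauto
  rw [h5, h6, G.dartCount_of_isClique (hk.isClique.subset (Finset.coe_subset.2
    (Finset.erase_subset a k))), hke] at h4
  omega

/-- In a maximal planar graph, removing a triangle leaves at most two components. -/
theorem IsMaximalPlanar.not_three_parts [Nonempty V] (hG : IsMaximalPlanar G)
    (hK : ∀ v, ∃ k, G.IsNClique 3 k ∧ v ∈ k) {k : Finset V} (hk : G.IsNClique 3 k)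
    {U₁ U₂ U₃ : Set V} (h₁ : IsPart G k U₁) (h₂ : IsPart G k U₂) (h₃ : IsPart G k U₃)
    (n₁ : U₁.Nonempty) (n₂ : U₂.Nonempty) (n₃ : U₃.Nonempty) (d₁₂ : Disjoint U₁ U₂)
    (d₁₃ : Disjoint U₁ U₃) (d₂₃ : Disjoint U₂ U₃) : False := by
  classical
  have hiso : ∀ v, ∃ u, G.Adj v u := fun v =>
    (exists_adj_ne_of_mem_clique hK v v).imp fun _ h => h.1
  obtain ⟨R, hR⟩ := hG.exists_planeRotation hiso
  obtain ⟨a, b, c, hab, hac, hbc, rfl⟩ := SimpleGraph.is3Clique_iff.1 hk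
  set p : G.Dart := ⟨(a, b), hab⟩ with hp
  set q : G.Dart := ⟨(a, c), hac⟩ with hq
  -- Rotating at `a` from a neighbour in `U`, the neighbours stay in `U` until `b` or `c` comes
  -- next. So each part contains one of two fixed vertices.
  have key : ∀ U, IsPart G {a, b, c} U → U.Nonempty →
      (R.next.symm p).snd ∈ U ∨ (R.next.symm q).snd ∈ U := by
    intro U hU hne
    obtain ⟨u, hu, hau⟩ := hG.exists_adj_of_isPart hK hk hU hne (a := a) (by simp)
    by_contra hcon
    push Not at hcon
    have := (R.sameCycle ⟨(a, u), hau⟩ p rfl).induction (P := fun x => x.fst = a ∧ x.snd ∈ U)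
      ⟨rfl, hu⟩ (by
        rintro x ⟨hx, hxU⟩
        have hfst : (R.next x).fst = a := (R.fst_next x).trans hx
        refine ⟨hfst, ?_⟩
        by_cases hs : (R.next x).snd = x.snd
        · rwa [hs]
        refine hU.closed _ hxU _ (hR x hs) ?_
        simp only [Finset.mem_insert, Finset.mem_singleton, not_or]
        refine ⟨fun h => (R.next x).adj.ne (hfst.trans h.symm), fun h => ?_, fun h => ?_⟩
        · apply hcon.1
          rw [← (SimpleGraph.Dart.ext _ _ (Prod.ext hfst h) : R.next x = p),
            Equiv.symm_apply_apply]
          exact hxU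
        · apply hcon.2
          rw [← (SimpleGraph.Dart.ext _ _ (Prod.ext hfst h) : R.next x = q),
            Equiv.symm_apply_apply]
          exact hxU)
    exact hU.notMem _ this.2 (by simp [hp])
  have e₁ := key U₁ h₁ n₁
  have e₂ := key U₂ h₂ n₂
  have e₃ := key U₃ h₃ n₃
  have f₁₂ : ∀ x, x ∈ U₁ → x ∉ U₂ := fun x hx => Set.disjoint_left.1 d₁₂ hx
  have f₁₃ : ∀ x, x ∈ U₁ → x ∉ U₃ := fun x hx => Set.disjoint_left.1 d₁₃ hx
  have f₂₃ : ∀ x, x ∈ U₂ → x ∉ U₃ := fun x hx => Set.disjoint_left.1 d₂₃ hx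
  rcases e₁ with e₁ | e₁ <;> rcases e₂ with e₂ | e₂ <;> rcases e₃ with e₃ | e₃
  all_goals first
    | exact f₁₂ _ e₁ e₂
    | exact f₁₃ _ e₁ e₃
    | exact f₂₃ _ e₂ e₃

end

/-! ### Interiors, exteriors and the union of maximal triangles -/

theorem SimpleGraph.dartCount_induce_of_coe_eq {V : Type*} [DecidableEq V] (G : SimpleGraph V)
    [DecidableRel G.Adj] {S : Set V} [Fintype S] [DecidableEq S] [DecidableRel (G.induce S).Adj]
    {B : Finset V} (h : (B : Set V) = S) :
    (G.induce S).dartCount Finset.univ = G.dartCount B := by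
  subst h
  convert G.dartCount_induce B

namespace CliqueOrientation

variable {V : Type*} [Fintype V] [Nonempty V] {G : SimpleGraph V} (o : CliqueOrientation G)

omit [Fintype V] [Nonempty V] in
theorem mem_interior_or_mem_exterior {k : Finset V} (hk : G.IsNClique 3 k) {v : V} (hv : v ∉ k) :
    v ∈ o.interior k ∨ v ∈ o.exterior k := by
  have : v ∈ o.interior k ∪ o.exterior k := (o.divides k hk).union_eq ▸ hv
  exact this

omit [Fintype V] [Nonempty V] in
theorem isPart_interior {k : Finset V} (hk : G.IsNClique 3 k) : IsPart G k (o.interior k) :=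
  (o.divides k hk).isPart

omit [Fintype V] [Nonempty V] in
theorem isPart_exterior {k : Finset V} (hk : G.IsNClique 3 k) : IsPart G k (o.exterior k) :=
  (o.divides k hk).symm.isPart

omit [Fintype V] [Nonempty V] in
theorem notMem_exterior {k : Finset V} (hk : G.IsNClique 3 k) {v : V} (hv : v ∈ o.interior k) :
    v ∉ o.exterior k := Set.disjoint_left.1 (o.divides k hk).disjoint hv

omit [Nonempty V] in
theorem exterior_nonempty {k : Finset V} (hk : G.IsNClique 3 k) (h : (o.interior k).Nonempty) :
    (o.exterior k).Nonempty := by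
  rw [← Set.ncard_pos] at h ⊢
  exact h.trans_le (o.card_le k hk)

variable (hG : IsMaximalPlanar G) (hK : ∀ v, ∃ k, G.IsNClique 3 k ∧ v ∈ k)

include hG hK

/-- The exterior of a triangle is connected. -/
theorem exterior_subset_of_isPart {k : Finset V} (hk : G.IsNClique 3 k) {U : Set V}
    (hU : IsPart G k U) (hne : (o.exterior k ∩ U).Nonempty) : o.exterior k ⊆ U := by
  by_contra hcon
  have hext := o.isPart_exterior hk
  have hdiff : (o.exterior k \ U).Nonempty := Set.sdiff_nonempty.2 hcon
  have hd : Disjoint (o.exterior k ∩ U) (o.exterior k \ U) :=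
    Set.disjoint_left.2 fun x hx hx' => hx'.2 hx.2
  -- A split exterior makes `k` separating, so its chosen interior is not empty and is a third part.
  have hint : (o.interior k).Nonempty := by
    refine (o.nonempty k hk ⟨_, _, hne, ?_, (hext.inter hU).dividesInto⟩).1
    obtain ⟨x, hx⟩ := hdiff
    exact ⟨x, fun h => hx.2 h.2, hext.notMem x hx.1⟩
  refine hG.not_three_parts hK hk (o.isPart_interior hk) (hext.inter hU) (hext.diff hU) hint hne
    hdiff ?_ ?_ hd
  · exact Set.disjoint_left.2 fun x hx hx' => o.notMem_exterior hk hx hx'.1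
  · exact Set.disjoint_left.2 fun x hx hx' => o.notMem_exterior hk hx hx'.1

/-- A triangle inside the closed interior of `k` has its interior inside the interior of `k`. -/
theorem cliqueLE_of_subset {k k' : Finset V} (hk : G.IsNClique 3 k) (hk' : G.IsNClique 3 k')
    (h : (k' : Set V) ⊆ (k : Set V) ∪ o.interior k) : o.CliqueLE k' k := by
  refine Set.union_subset h ?_
  by_cases heq : k' = k
  · rw [heq]; exact Set.subset_union_right
  have hnot : ∀ {a b : Finset V}, G.IsNClique 3 a → G.IsNClique 3 b → a ≠ b → ∃ x ∈ a, x ∉ b := by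
    intro a b ha hb hab
    by_contra hcon
    push Not at hcon
    exact hab (Finset.eq_of_subset_of_card_le hcon (by rw [ha.card_eq, hb.card_eq]))
  obtain ⟨x, hx, hxk⟩ := hnot hk' hk heq
  have hint : (o.interior k).Nonempty := ⟨x, (h hx).resolve_left hxk⟩
  have hextne := o.exterior_nonempty hk hint
  have hk'ext : ∀ y ∈ o.exterior k, y ∉ k' := by
    intro y hy hyk
    rcases h hyk with h | h
    · exact (o.isPart_exterior hk).notMem y hy h
    · exact o.notMem_exterior hk h hy
  intro v hv
  by_contra hvk
  have hvk' : v ∈ k ∨ v ∈ o.exterior k := by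
    by_contra hcon
    push Not at hcon
    rcases o.mem_interior_or_mem_exterior hk hcon.1 with h | h
    · exact hvk (Or.inr h)
    · exact hcon.2 h
  have hint' := o.isPart_interior hk'
  -- An interior of `k'` that leaves the closed interior of `k` reaches the exterior of `k`, since
  -- every vertex of `k` has a neighbour there. The exterior is connected and avoids `k'`, so it is
  -- swallowed whole, together with a vertex of `k`.
  have hmeet : ∃ y ∈ o.exterior k, y ∈ o.interior k' := by
    rcases hvk' with hvk' | hvk'
    · obtain ⟨y, hy, hvy⟩ := hG.exists_adj_of_isPart hK hk (o.isPart_exterior hk) hextne hvk'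
      exact ⟨y, hy, hint'.closed v hv y hvy (hk'ext y hy)⟩
    · exact ⟨v, hvk', hv⟩
  have hpart : IsPart G k (o.exterior k ∩ o.interior k') := by
    refine ⟨fun u hu => (o.isPart_exterior hk).notMem u hu.1, fun u hu w huw hw => ?_⟩
    have hwe := (o.isPart_exterior hk).closed u hu.1 w huw hw
    exact ⟨hwe, hint'.closed u hu.2 w huw (hk'ext w hwe)⟩
  obtain ⟨y, hy, hy'⟩ := hmeet
  have hsub : o.exterior k ⊆ o.interior k' :=
    (o.exterior_subset_of_isPart hG hK hk hpart ⟨y, hy, hy, hy'⟩).trans Set.inter_subset_right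
  obtain ⟨z, hz, hzk'⟩ := hnot hk hk' (Ne.symm heq)
  have hz' : z ∈ o.interior k' := by
    obtain ⟨y, hy, hzy⟩ := hG.exists_adj_of_isPart hK hk (o.isPart_exterior hk) hextne hz
    exact hint'.closed y (hsub hy) z hzy.symm hzk'
  have hlt : (o.exterior k).ncard < (o.interior k').ncard :=
    Set.ncard_lt_ncard ⟨hsub, fun hs => (o.isPart_exterior hk).notMem z (hs hz') hz⟩
  have hcard : ∀ {t : Finset V}, G.IsNClique 3 t →
      (o.interior t).ncard + (o.exterior t).ncard = ((Set.univ : Set V).ncard - 3) := by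
    intro t ht
    rw [← Set.ncard_union_eq (o.divides t ht).disjoint, (o.divides t ht).union_eq,
      Set.ncard_compl, Set.ncard_coe_finset, ht.card_eq, Set.ncard_univ]
  -- Each interior has at most half of the n - 3 vertices off its triangle and each exterior at
  -- least half, so int k' cannot be larger than ext k.
  have h1 := hcard hk
  have h2 := hcard hk'
  have h3 := o.card_le k hk
  have h4 := o.card_le k' hk'
  omega

/-- The vertices of maximal triangles lie in no interior. -/
theorem notMem_interior_of_isMaximalClique {k t : Finset V} (hk : o.IsMaximalClique k)
    (ht : G.IsNClique 3 t) {v : V} (hv : v ∈ k) : v ∉ o.interior t := by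
  intro hvt
  have hint := o.isPart_interior ht
  have hle : o.CliqueLE k t := by
    refine o.cliqueLE_of_subset hG hK ht hk.1 fun u hu => ?_
    by_cases huv : u = v
    · exact Or.inr (huv ▸ hvt)
    · by_cases hut : u ∈ t
      · exact Or.inl hut
      · exact Or.inr (hint.closed v hvt u (hk.1.isClique hv hu (Ne.symm huv)) hut)
  have hge := hk.2 t ht hle
  have hext : o.exterior t ⊆ o.exterior k := by
    intro x hx
    have hxt : x ∉ (t : Set V) ∪ o.interior t := by
      rintro (h | h)
      · exact (o.isPart_exterior ht).notMem x hx h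
      · exact o.notMem_exterior ht h hx
    have hxk : x ∉ (k : Set V) ∪ o.interior k := fun h => hxt (hle h)
    exact (o.mem_interior_or_mem_exterior hk.1 (fun h => hxk (Or.inl h))).resolve_left
      fun h => hxk (Or.inr h)
  have hext' : o.exterior k ⊆ o.exterior t := by
    intro x hx
    have hxk : x ∉ (k : Set V) ∪ o.interior k := by
      rintro (h | h)
      · exact (o.isPart_exterior hk.1).notMem x hx h
      · exact o.notMem_exterior hk.1 h hx
    have hxt : x ∉ (t : Set V) ∪ o.interior t := fun h => hxk (hge h)
    exact (o.mem_interior_or_mem_exterior ht (fun h => hxt (Or.inl h))).resolve_left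
      fun h => hxt (Or.inr h)
  -- By maximality `k` and `t` have the same exterior. As a vertex of `k`, `v` has a neighbour
  -- there; as an interior vertex of `t`, it has none.
  obtain ⟨y, hy, hvy⟩ := hG.exists_adj_of_isPart hK hk.1 (o.isPart_exterior hk.1)
    ((o.exterior_nonempty ht ⟨v, hvt⟩).mono hext) hv
  have hyt := hext' hy
  exact o.notMem_exterior ht
    (hint.closed v hvt y hvy ((o.isPart_exterior ht).notMem y hyt)) hyt

omit [Nonempty V] hG in
theorem exists_isMaximalClique (v : V) :
    ∃ k, o.IsMaximalClique k ∧ v ∈ (k : Set V) ∪ o.interior k := by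
  obtain ⟨t, ht, hvt⟩ := hK v
  obtain ⟨k, ⟨hk, hvk⟩, hmax⟩ :=
    (Set.toFinite {k : Finset V | G.IsNClique 3 k ∧ v ∈ (k : Set V) ∪ o.interior k}).exists_maximalFor
      (fun k : Finset V => (k : Set V) ∪ o.interior k) _ ⟨t, ht, Or.inl hvt⟩
  exact ⟨k, ⟨hk, fun k' hk' hle => hmax ⟨hk', hle hvk⟩ hle⟩, hvk⟩

/-- Outside `t`, all vertices of the union lie in the exterior of `t` in G, which is connected. A
separation in the union therefore only has to be extended to a part of G. -/
theorem maximalUnion_not_isSeparating {t : Finset o.maximalUnionVerts}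
    (ht : o.maximalUnion.IsNClique 3 t) :
    ¬ IsSeparating o.maximalUnion (t : Set o.maximalUnionVerts) := by
  rintro ⟨S, T, ⟨s, hs⟩, ⟨u, hu⟩, hdiv⟩
  have hS := hdiv.isPart
  set t' : Finset V := t.map (Function.Embedding.subtype _) with ht'
  have hmem : ∀ x : o.maximalUnionVerts, (x : V) ∈ t' ↔ x ∈ t := by
    intro x
    simp [ht', x.2]
  have htc : G.IsNClique 3 t' := by
    refine ⟨?_, by rw [ht', Finset.card_map, ht.card_eq]⟩
    intro x hx y hy hxy
    obtain ⟨x', hx', rfl⟩ := Finset.mem_map.1 hx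
    obtain ⟨y', hy', rfl⟩ := Finset.mem_map.1 hy
    exact ht.isClique hx' hy' (fun h => hxy (by rw [h]))
  have hB : ∀ {k x}, o.IsMaximalClique k → x ∈ k → x ∈ o.maximalUnionVerts := fun hk hx => ⟨_, hk, hx⟩
  have hnot : ∀ {k} {x : V}, o.IsMaximalClique k → x ∈ o.maximalUnionVerts →
      x ∈ (k : Set V) ∪ o.interior k → x ∈ k := by
    rintro k x hk ⟨k', hk', hx⟩ h
    exact h.resolve_right (o.notMem_interior_of_isMaximalClique hG hK hk' hk.1 hx)
  set S' : Set V := Subtype.val '' S with hS'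
  have hclosed : ∀ x ∈ S', ∀ y ∈ o.maximalUnionVerts, y ∉ t' → (y = x ∨ G.Adj x y) → y ∈ S' := by
    rintro _ ⟨x, hx, rfl⟩ y hy hyt (h | h)
    · exact h ▸ ⟨x, hx, rfl⟩
    · exact ⟨⟨y, hy⟩, hS.closed x hx ⟨y, hy⟩ h (fun h' => hyt ((hmem ⟨y, hy⟩).2 h')), rfl⟩
  have hclique : ∀ {k} {x y : V}, o.IsMaximalClique k → x ∈ k → y ∈ k → y = x ∨ G.Adj x y := by
    intro k x y hk hx hy
    by_cases h : y = x
    · exact Or.inl h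
    · exact Or.inr (hk.1.isClique hx hy (Ne.symm h))
  -- Deleted vertices follow the maximal triangles that enclose them. The vertices of such a
  -- triangle outside `t'` are mutually adjacent, so they lie on one side of the separation.
  set U : Set V := {v | v ∉ t' ∧ ∀ k, o.IsMaximalClique k → v ∈ (k : Set V) ∪ o.interior k →
    ∀ x ∈ k, x ∉ t' → x ∈ S'} with hU
  have hpart : IsPart G t' U := by
    refine ⟨fun v hv => hv.1, ?_⟩
    rintro v ⟨hvt, hv⟩ v' hadj hvt'
    refine ⟨hvt', fun k hk hv'k x hx hxt => ?_⟩
    by_cases hvk : v ∈ (k : Set V) ∪ o.interior k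
    · exact hv k hk hvk x hx hxt
    have hv'k : v' ∈ k := by
      refine hv'k.resolve_right fun h => hvk ?_
      by_cases hvk' : v ∈ k
      · exact Or.inl hvk'
      · exact Or.inr ((o.isPart_interior hk.1).closed v' h v hadj.symm hvk')
    have hv'B := hB hk hv'k
    obtain ⟨k₂, hk₂, hvk₂⟩ := o.exists_isMaximalClique hK v
    have hv'S : v' ∈ S' := by
      rcases hvk₂ with h | h
      · have hvS : v ∈ S' := hv k₂ hk₂ (Or.inl h) v h hvt
        exact hclosed v hvS v' hv'B hvt' (Or.inr hadj)
      · have hv'k₂ : v' ∈ k₂ := by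
          by_contra hcon
          exact hcon (hnot hk₂ hv'B
            (Or.inr ((o.isPart_interior hk₂.1).closed v h v' hadj hcon)))
        exact hv k₂ hk₂ (Or.inr h) v' hv'k₂ hvt'
    exact hclosed v' hv'S x (hB hk hx) hxt (hclique hk hv'k hx)
  have hext : ∀ x : o.maximalUnionVerts, x ∉ t → (x : V) ∈ o.exterior t' := by
    intro x hx
    obtain ⟨k, hk, hxk⟩ := x.2
    exact (o.mem_interior_or_mem_exterior htc (fun h => hx ((hmem x).1 h))).resolve_left
      (o.notMem_interior_of_isMaximalClique hG hK hk htc hxk)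
  have hst := hS.notMem s hs
  have hut := hdiv.symm.isPart.notMem u hu
  have hsU : (s : V) ∈ U := by
    refine ⟨fun h => hst ((hmem s).1 h), fun k hk hsk x hx hxt => ?_⟩
    exact hclosed s ⟨s, hs, rfl⟩ x (hB hk hx) hxt (hclique hk (hnot hk s.2 hsk) hx)
  have hsub := o.exterior_subset_of_isPart hG hK htc hpart ⟨s, hext s hst, hsU⟩
  obtain ⟨k, hk, huk⟩ := u.2
  obtain ⟨u', hu', huu⟩ := (hsub (hext u hut)).2 k hk (Or.inl huk) u huk
    (fun h => hut ((hmem u).1 h))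
  rw [Subtype.val_injective huu] at hu'
  exact Set.disjoint_left.1 hdiv.disjoint hu' hu

/-- Removing the interiors of maximal triangles preserves the number `3n - 6` of edges. -/
theorem le_dartCount_maximalUnionVerts [DecidableEq V] [DecidableRel G.Adj] (B : Finset V)
    (hB : (B : Set V) = o.maximalUnionVerts) : 6 * B.card ≤ G.dartCount B + 12 := by
  classical
  -- The interiors are deleted one at a time; different ones may coincide or overlap, so each step
  -- works with what is left.
  have key : ∀ F : Finset (Finset V), (∀ k ∈ F, o.IsMaximalClique k) →
      6 * (Finset.univ.filter fun v => ∀ k ∈ F, v ∉ o.interior k).card ≤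
        G.dartCount (Finset.univ.filter fun v => ∀ k ∈ F, v ∉ o.interior k) + 12 := by
    intro F
    induction F using Finset.induction_on with
    | empty =>
      intro _
      simpa using hG.le_dartCount_add hK
    | insert k F hkF ih =>
      intro hF
      have ih := ih fun k' hk' => hF k' (Finset.mem_insert_of_mem hk')
      have hk := hF k (Finset.mem_insert_self k F)
      set Y := Finset.univ.filter fun v => ∀ k ∈ F, v ∉ o.interior k with hY
      set A := Finset.univ.filter fun v => ∀ k' ∈ insert k F, v ∉ o.interior k' with hA
      set C := Y.filter fun v => v ∈ (k : Set V) ∪ o.interior k with hC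
      have hmA : ∀ x, x ∈ A ↔ x ∈ Y ∧ x ∉ o.interior k := by
        intro x
        simp only [hA, hY, Finset.mem_filter, Finset.mem_univ, true_and, Finset.forall_mem_insert]
        exact and_comm
      have hmC : ∀ x, x ∈ C ↔ x ∈ Y ∧ (x ∈ k ∨ x ∈ o.interior k) := by
        intro x
        simp [hC]
      have hkY : ∀ x ∈ k, x ∈ Y := by
        intro x hx
        simp only [hY, Finset.mem_filter, Finset.mem_univ, true_and]
        exact fun k' hk' => o.notMem_interior_of_isMaximalClique hG hK hk
          (hF k' (Finset.mem_insert_of_mem hk')).1 hx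
      have hkint : ∀ x ∈ k, x ∉ o.interior k := fun x hx h =>
        (o.isPart_interior hk.1).notMem x h hx
      have hunion : A ∪ C = Y := by
        ext x
        rw [Finset.mem_union, hmA, hmC]
        tauto
      have hinter : A ∩ C = k := by
        ext x
        rw [Finset.mem_inter, hmA, hmC]
        have := hkY x
        have := hkint x
        tauto
      -- What is left splits along `k`, with six darts, into the remainder `A` and the piece `C` in
      -- the closed interior. The planar bound for `C` passes the lower bound on to `A`.
      have h1 := G.dartCount_union_add_inter (A := A) (B := C) (by
        intro x hx hxC y hy hyA hxy
        rw [hmA] at hx hyA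
        rw [hmC] at hxC hy
        have hyI : y ∈ o.interior k := by
          by_contra h
          exact hyA ⟨hy.1, h⟩
        have hxk : x ∉ k := fun h => hxC ⟨hx.1, Or.inl h⟩
        exact hx.2 ((o.isPart_interior hk.1).closed y hyI x hxy.symm hxk))
      have h2 := Finset.card_union_add_card_inter A C
      rw [hunion, hinter] at h1 h2
      rw [hk.1.card_eq] at h2
      have hkC : k ⊆ C := fun x hx => (hmC x).2 ⟨hkY x hx, Or.inl hx⟩
      have h3 := Finset.card_le_card hkC
      rw [hk.1.card_eq] at h3
      have h4 := hG.1.dartCount_add_le C h3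
      have h5 := G.dartCount_of_isClique hk.1.isClique
      rw [hk.1.card_eq] at h5
      omega
  have := key (Finset.univ.filter o.IsMaximalClique) (fun k hk => (Finset.mem_filter.1 hk).2)
  convert this using 3 <;>
  · ext v
    rw [← Finset.mem_coe, hB]
    simp only [Finset.mem_filter, Finset.mem_univ, true_and]
    constructor
    · rintro ⟨k, hk, hv⟩ k' hk'
      exact o.notMem_interior_of_isMaximalClique hG hK hk hk'.1 hv
    · intro h
      obtain ⟨k, hk, hv⟩ := o.exists_isMaximalClique hK v
      exact ⟨k, hk, hv.resolve_right (h k hk)⟩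

/-- The union already has the largest number of edges that a planar graph on its vertices can have,
so a planar supergraph adds none. -/
theorem maximalUnion_isMaximalPlanar : IsMaximalPlanar o.maximalUnion := by
  classical
  refine ⟨hG.1.induce _, fun H hH hle => ?_⟩
  set B : Finset V := o.maximalUnionVerts.toFinset with hBdef
  have hB : (B : Set V) = o.maximalUnionVerts := Set.coe_toFinset _
  have h1 := o.le_dartCount_maximalUnionVerts hG hK B hB
  have h2 : o.maximalUnion.dartCount Finset.univ = G.dartCount B := by
    exact G.dartCount_induce_of_coe_eq hB
  have hcard : B.card = Fintype.card o.maximalUnionVerts := Set.toFinset_card _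
  have h3 : 3 ≤ (Finset.univ : Finset o.maximalUnionVerts).card := by
    obtain ⟨k, hk, -⟩ := o.exists_isMaximalClique hK (Classical.arbitrary V)
    rw [Finset.card_univ, ← hcard, ← hk.1.card_eq]
    exact Finset.card_le_card fun x hx => Set.mem_toFinset.2 ⟨k, hk, hx⟩
  have h4 := hH.dartCount_add_le Finset.univ h3
  rw [Finset.card_univ, ← hcard] at h4
  intro x y hxy
  have hsub : (Finset.univ ×ˢ Finset.univ).filter
      (fun p : o.maximalUnionVerts × o.maximalUnionVerts => o.maximalUnion.Adj p.1 p.2) ⊆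
      (Finset.univ ×ˢ Finset.univ).filter fun p => H.Adj p.1 p.2 := by
    intro p hp
    simp only [Finset.mem_filter, Finset.mem_product, Finset.mem_univ, true_and] at hp ⊢
    exact hle hp
  have heq := Finset.eq_of_subset_of_card_le hsub (by
    change H.dartCount Finset.univ ≤ o.maximalUnion.dartCount Finset.univ
    omega)
  have hmem : (x, y) ∈ (Finset.univ ×ˢ Finset.univ).filter
      fun p : o.maximalUnionVerts × o.maximalUnionVerts => H.Adj p.1 p.2 := by
    simpa using hxy
  rw [← heq] at hmem
  exact (Finset.mem_filter.1 hmem).2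

end CliqueOrientation

theorem mainTheorem9 {V : Type*} [Finite V] [Nonempty V] (G : SimpleGraph V)
    (hG : IsMaximalPlanar G) (hK : ∀ v, ∃ k, G.IsNClique 3 k ∧ v ∈ k)
    (o : CliqueOrientation G) :
    IsBubble o.maximalUnion := by
  classical
  have := Fintype.ofFinite V
  refine ⟨?_, o.maximalUnion_isMaximalPlanar hG hK, ?_,
    fun k hk => o.maximalUnion_not_isSeparating hG hK hk⟩
  · obtain ⟨k, hk, -⟩ := o.exists_isMaximalClique hK (Classical.arbitrary V)
    obtain ⟨x, hx⟩ : k.Nonempty := Finset.card_pos.1 (by rw [hk.1.card_eq]; norm_num)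
    exact ⟨⟨x, k, hk, hx⟩⟩
  · rintro ⟨v, k, hk, hv⟩
    refine ⟨k.attach.map ⟨fun x => ⟨x.1, k, hk, x.2⟩, fun x y h => ?_⟩, ⟨?_, ?_⟩, ?_⟩
    · exact Subtype.ext (Subtype.mk.inj h)
    · intro x hx y hy hxy
      obtain ⟨x', -, rfl⟩ := Finset.mem_map.1 hx
      obtain ⟨y', -, rfl⟩ := Finset.mem_map.1 hy
      exact hk.1.isClique x'.2 y'.2 fun h => hxy (by rw [Subtype.ext h])
    · rw [Finset.card_map, Finset.card_attach, hk.1.card_eq]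
    · exact Finset.mem_map.2 ⟨⟨v, hv⟩, Finset.mem_attach _ _, rfl⟩
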